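/- **Setting.** A discrete latent tree model consists of a finite tree whose leaves are the observed variables $X_1,\dots,X_d$ ($d\ge 4$), each with $n$ states, and whose inner nodes are hidden variables, each with $k$ states. The tree is oriented away from a hidden root, and the joint distribution is $\prod_i P(x_i\mid x_{\pi_i})$, where $\pi_i$ is the parent of $i$ (for the root, its marginal). For a fourth order tensor $P(x_1,x_2,x_3,x_4)$ let $A,B,C\in\mathbb R^{n^2\times n^2}$ be its unfoldings for the groupings $\{1,2\}|\{3,4\}$, $\{1,3\}|\{2,4\}$, $\{1,4\}|\{2,3\}$, let $\|\cdot\|_*$ be the nuclear norm (sum of the singular values), and put $\mathrm{gap}(P)=\min\{\|B\|_*-\|A\|_*,\ \|C\|_*-\|A\|_*\}$. A quartet $q$ is a choice of four observed variables, numbered so that $\{1,2\}|\{3,4\}$ is the relation that holds in the tree (some edge separates $1,2$ from $3,4$). Let $\alpha_q=\mathrm{gap}(P_{1234})$ for the joint table $P_{1234}$ of the four variables, $\theta_q=\mathrm{gap}\big(P_{12}(x_1,x_2)\,P_{34}(x_3,x_4)\big)$ for the pairwise marginals $P_{12},P_{34}$, and $\alpha_{\min}=\min_q\alpha_q$, $\theta_{\min}=\min_q\theta_q$,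 the minima being over all quartets. For hidden variables $H,G$ let $\Delta_{HG}=P_{HG}-P_HP_G^\top$, and let $\gamma_{\min}$ be the smallest probability $P_H(i)$ over all hidden $H$ and all states $i$. Assumptions: - (A1) every conditional probability table $P(X_i\mid X_{\pi_i})$, for $i$ not the root, has full column rank $k$; - (A2) every hidden variable has exactly 3 neighbours; - (A3) $\Delta_{HG}\mathbf 1=0$ and $\Delta_{HG}^\top\mathbf 1=0$ for every edge $H-G$ between hidden variables; - (A4) $\|\Delta_{HG}\|_F\le\min\{\theta_{\min}/(k^2+k),\ \gamma_{\min}\}$ for every edge $H-G$ between hidden variables; - (A4$'$) for every quartet $q$, $\|\Delta_{HG}\|_F\le\theta_q/(k^2+k)$, where $H$ and $G$ are the two hidden variables at which $q$ branches (the paths between $1,2,3$ meet in $H$, those between $3,4,1$ meet in $G$). **Algorithm BuildTree.** All tests use the same $m$ samples. The quartet test $\mathrm{Quartet}(Y_0,Y_1,Y_2,Y_3)$ forms the empirical joint table of the four variables, computes the nuclear norms of its three unfoldings, and groups $Y_0$ with the $Y_{i^*}$ whose grouping has the smallest one (ties are broken arbitrarily). The algorithm connects the first four variables with two hidden nodes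 according to the quartet test. Then it joins the other variables one by one. To join $Y$ to the current tree $T$, start with the subtree $S=T$; as long as $S$ is not a single edge, choose an inner node $R$ of $S$ which splits $S$ into three branches none of which has (not counting $R$) more than a fraction $\beta$ of the nodes of $S$, choose leaves $X_{i_1},X_{i_2},X_{i_3}$ of $T$ in the three directions at $R$, and replace $S$ by the branch selected by $\mathrm{Quartet}(Y,X_{i_1},X_{i_2},X_{i_3})$ together with $R$. When $S$ is a single edge, subdivide it by a new hidden node and attach $Y$ to that node. The order of the variables, the nodes $R$, the leaves and the tie-breaking are given by an arbitrary rule, which may use a (countably valued) random seed independent of the samples; a choice of $R$ and of the leaves depends only on $T$, $S$ and the seed. **Theorem.** Let $\tfrac12\le\beta<1$ and let $m$ i.i.d. samples of $(X_1,\dots,X_d)$ from a model with (A1)–(A4) be given. More generally, (A4) may be replaced by (A4$'$). 1. There are constants $c,C>0$, which depend only on $\beta$, such that, whenever $m$ is sufficiently large in the sense that $m\,\alpha_{\min}^2\ge C n^2$, with probability at least $$1-8\,c\,d\log d\;e^{-\frac1{32}m\alpha_{\min}^2}$$ BuildTree recovers the correct tree topology (its output is isomorphic to the true tree by an isomorphism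 that fixes every $X_i$). 2. For every $n$ there is a constant $c>0$, which depends only on $n$ and $\beta$, such that this holds for every $m\ge 0$. -/

import Mathlib

/-! ### Unfoldings and nuclear norm -/

/-- A fourth order tensor of format `n × n × n × n` (the joint table of four variables). -/
abbrev Tensor4 (n : ℕ) : Type := Fin n → Fin n → Fin n → Fin n → ℝ

/-- The three `n² × n²` unfoldings of a tensor: the groupings `{1,2}|{3,4}` (the matrix `A`),
`{1,3}|{2,4}` (the matrix `B`) and `{1,4}|{2,3}` (the matrix `C`). -/
def unfolding {n : ℕ} (P : Tensor4 n) : Fin 3 → Matrix (Fin n × Fin n) (Fin n × Fin n) ℝ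
  | 0 => Matrix.of fun r s => P r.1 r.2 s.1 s.2
  | 1 => Matrix.of fun r s => P r.1 s.1 r.2 s.2
  | 2 => Matrix.of fun r s => P r.1 s.1 s.2 r.2

/-- The nuclear norm: the sum of all singular values. -/
noncomputable def nuclearNorm {ι κ : Type*} [Fintype ι] [DecidableEq ι] [Fintype κ]
    [DecidableEq κ] (M : Matrix ι κ ℝ) : ℝ :=
  (Matrix.toEuclideanLin M).singularValues.sum fun _ s => s

/-- The Frobenius norm. -/
noncomputable def frobNorm {ι κ : Type*} [Fintype ι] [Fintype κ] (M : Matrix ι κ ℝ) : ℝ :=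
  Real.sqrt (∑ i, ∑ j, M i j ^ 2)

/-- `min {‖B‖_* - ‖A‖_*, ‖C‖_* - ‖A‖_*}` for the three unfoldings `A, B, C` of a tensor. -/
noncomputable def nuclearGap {n : ℕ} (P : Tensor4 n) : ℝ :=
  min (nuclearNorm (unfolding P 1) - nuclearNorm (unfolding P 0))
    (nuclearNorm (unfolding P 2) - nuclearNorm (unfolding P 0))

/-! ### Trees -/

/-- `side T u v`: the vertices on the `v`-side of the edge `u - v`, that is the vertices that can
still be reached from `v` when this edge is removed. -/
def side {V : Type*} (T : SimpleGraph V) (u v : V) : Set V :=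
  {w | (T.deleteEdges {s(u, v)}).Reachable v w}

/-- The quartet relation `{x,y}|{z,w}` holds in the tree: some edge separates `x, y` from `z, w`. -/
def Resolves {V : Type*} (T : SimpleGraph V) (x y z w : V) : Prop :=
  ∃ u v, T.Adj u v ∧ x ∈ side T v u ∧ y ∈ side T v u ∧ z ∈ side T u v ∧ w ∈ side T u v

/-- `v` is the vertex at which the paths between `x`, `y`, `z` meet: these three lie in the
subtrees hanging at three distinct neighbours of `v`. -/
def IsMedian {V : Type*} (T : SimpleGraph V) (v x y z : V) : Prop :=
  ∃ a b c, a ≠ b ∧ a ≠ c ∧ b ≠ c ∧ T.Adj v a ∧ T.Adj v b ∧ T.Adj v c ∧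
    x ∈ side T v a ∧ y ∈ side T v b ∧ z ∈ side T v c

/-- The quartets of a leaf-labelled tree, each written so that the correct relation is
`{q 0, q 1}|{q 2, q 3}`. -/
def Quartet {d : ℕ} {H : Type*} (T : SimpleGraph (Fin d ⊕ H)) : Type :=
  {q : Fin 4 → Fin d // Function.Injective q ∧
    Resolves T (Sum.inl (q 0)) (Sum.inl (q 1)) (Sum.inl (q 2)) (Sum.inl (q 3))}

/-! ### Discrete latent tree models -/

/-- A discrete latent tree model: `d` observed variables with `n` states each are the leaves of a
tree, the hidden variables `H` have `k` states each. A hidden node is selected as root, all edges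
are oriented away from it, and the joint distribution is given by the marginal of the root and a
conditional probability table (columns indexed by the state of the parent) for every other node. -/
structure LatentTreeModel (d n k : ℕ) (H : Type*) [Fintype H] where
  tree : SimpleGraph (Fin d ⊕ H)
  isTree : tree.IsTree
  observed_isLeaf : ∀ i : Fin d, (tree.neighborSet (Sum.inl i)).ncard = 1
  root : H
  parent : Fin d ⊕ H → H
  parent_adj : ∀ v, v ≠ Sum.inr root → tree.Adj v (Sum.inr (parent v))
  parent_closer : ∀ v, v ≠ Sum.inr root →
    tree.dist (Sum.inr (parent v)) (Sum.inr root) < tree.dist v (Sum.inr root)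
  /-- the marginal distribution of the root -/
  prior : Fin k → ℝ
  /-- the table `P(X_i | X_{π_i})` of an observed variable -/
  cptObs : Fin d → Matrix (Fin n) (Fin k) ℝ
  /-- the table `P(X_h | X_{π_h})` of a hidden variable (its value at the root is not used) -/
  cptHid : H → Matrix (Fin k) (Fin k) ℝ
  prior_nonneg : ∀ s, 0 ≤ prior s
  prior_sum : ∑ s, prior s = 1
  cptObs_nonneg : ∀ i x s, 0 ≤ cptObs i x s
  cptObs_sum : ∀ i s, ∑ x, cptObs i x s = 1
  cptHid_nonneg : ∀ h, h ≠ root → ∀ s t, 0 ≤ cptHid h s t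
  cptHid_sum : ∀ h, h ≠ root → ∀ t, ∑ s, cptHid h s t = 1

namespace LatentTreeModel

variable {d n k : ℕ} {H : Type*} [Fintype H] (M : LatentTreeModel d n k H)

open Classical in
/-- The joint probability table of all variables, `∏ P(x_i | x_{π_i})`. -/
noncomputable def joint (x : Fin d → Fin n) (z : H → Fin k) : ℝ :=
  (∏ i, M.cptObs i (x i) (z (M.parent (Sum.inl i)))) *
    ∏ h, if h = M.root then M.prior (z h) else M.cptHid h (z h) (z (M.parent (Sum.inr h)))

open Classical in
/-- The probability table of the observed variables. -/
noncomputable def obs (x : Fin d → Fin n) : ℝ := ∑ z : H → Fin k, M.joint x z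

/-- The joint probability table of four observed variables. -/
noncomputable def table4 (q : Fin 4 → Fin d) : Tensor4 n := fun x₁ x₂ x₃ x₄ =>
  ∑ x : Fin d → Fin n,
    if x (q 0) = x₁ ∧ x (q 1) = x₂ ∧ x (q 2) = x₃ ∧ x (q 3) = x₄ then M.obs x else 0

/-- The joint probability table of two observed variables. -/
noncomputable def table2 (a b : Fin d) (x₁ x₂ : Fin n) : ℝ :=
  ∑ x : Fin d → Fin n, if x a = x₁ ∧ x b = x₂ then M.obs x else 0

open Classical in
/-- The marginal distribution `P_H` of a hidden variable. -/
noncomputable def hidden1 (h : H) (s : Fin k) : ℝ :=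
  ∑ x : Fin d → Fin n, ∑ z : H → Fin k, if z h = s then M.joint x z else 0

open Classical in
/-- The joint probability table `P_{HG}` of two hidden variables. -/
noncomputable def hidden2 (h g : H) (s t : Fin k) : ℝ :=
  ∑ x : Fin d → Fin n, ∑ z : H → Fin k, if z h = s ∧ z g = t then M.joint x z else 0

/-- The perturbation away from independence, `Δ = P_{HG} - P_H P_Gᵀ`. -/
noncomputable def Delta (h g : H) : Matrix (Fin k) (Fin k) ℝ :=
  Matrix.of fun s t => M.hidden2 h g s t - M.hidden1 h s * M.hidden1 g t

/-- `α_q`, computed from the joint table of the quartet. -/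
noncomputable def alpha (q : Quartet M.tree) : ℝ := nuclearGap (M.table4 q.1)

/-- The excessive dependence `θ_q`: the same quantity for the table `P₁₂(x₁,x₂) P₃₄(x₃,x₄)` that
the quartet has when its two latent variables are independent. -/
noncomputable def theta (q : Quartet M.tree) : ℝ :=
  nuclearGap fun x₁ x₂ x₃ x₄ => M.table2 (q.1 0) (q.1 1) x₁ x₂ * M.table2 (q.1 2) (q.1 3) x₃ x₄

/-- `α_min`, the minimum over all quartets. -/
noncomputable def alphaMin : ℝ := ⨅ q : Quartet M.tree, M.alpha q

/-- `θ_min`, the minimum over all quartets. -/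
noncomputable def thetaMin : ℝ := ⨅ q : Quartet M.tree, M.theta q

/-- `γ_min`, the smallest marginal probability of a state of a hidden variable. -/
noncomputable def gammaMin : ℝ := ⨅ h : H, ⨅ s : Fin k, M.hidden1 h s

/-- (A1): all conditional probability tables have full column rank `k`. -/
def A1 : Prop := (∀ i, (M.cptObs i).rank = k) ∧ ∀ h, h ≠ M.root → (M.cptHid h).rank = k

/-- (A2): every latent variable has exactly three neighbours. -/
def A2 : Prop := ∀ h : H, (M.tree.neighborSet (Sum.inr h)).ncard = 3

/-- (A3): the perturbations have zero row sums and zero column sums. -/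
def A3 : Prop := ∀ h g : H, M.tree.Adj (Sum.inr h) (Sum.inr g) →
  (∀ s, ∑ t, M.Delta h g s t = 0) ∧ ∀ t, ∑ s, M.Delta h g s t = 0

/-- (A4): the perturbation on each edge between latent variables is at most
`min {θ_min / (k² + k), γ_min}`. -/
def A4 : Prop := ∀ h g : H, M.tree.Adj (Sum.inr h) (Sum.inr g) →
  frobNorm (M.Delta h g) ≤ min (M.thetaMin / ((k : ℝ) ^ 2 + k)) M.gammaMin

/-- The recovery condition quartet by quartet: if `h` and `g` are the two latent variables at which
the quartet `q` branches, then `‖Δ_{hg}‖_F ≤ θ_q / (k² + k)`. -/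
def QuartetwiseA4 : Prop := ∀ (q : Quartet M.tree) (h g : H),
  IsMedian M.tree (Sum.inr h) (Sum.inl (q.1 0)) (Sum.inl (q.1 1)) (Sum.inl (q.1 2)) →
  IsMedian M.tree (Sum.inr g) (Sum.inl (q.1 2)) (Sum.inl (q.1 3)) (Sum.inl (q.1 0)) →
  frobNorm (M.Delta h g) ≤ M.theta q / ((k : ℝ) ^ 2 + k)

end LatentTreeModel

/-! ### The algorithm -/

/-- The empirical joint table of four observed variables, from `m` samples. -/
noncomputable def empirical4 {d n m : ℕ} (data : Fin m → Fin d → Fin n) (q : Fin 4 → Fin d) :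
    Tensor4 n := fun x₁ x₂ x₃ x₄ =>
  (∑ l : Fin m, if data l (q 0) = x₁ ∧ data l (q 1) = x₂ ∧ data l (q 2) = x₃ ∧ data l (q 3) = x₄
    then (1 : ℝ) else 0) / m

/-- The quartet test: a minimiser `i*` of the nuclear norms of the three unfoldings of the
empirical table (`argmin` says which minimiser is taken when there are several). The result `j`
means that the first variable is grouped with the variable number `j + 1` of the other three. -/
noncomputable def quartetTest {d n m : ℕ} (argmin : (Fin 3 → ℝ) → Fin 3)
    (data : Fin m → Fin d → Fin n) (q : Fin 4 → Fin d) : Fin 3 :=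
  argmin fun j => nuclearNorm (unfolding (empirical4 data q) j)

/-- Nodes of the trees built by the algorithm: the observed variables and `d - 2` hidden ones.
Nodes that have not been joined yet are isolated. -/
abbrev Node (d : ℕ) : Type := Fin d ⊕ Fin (d - 2)

/-- The choices made before one quartet test: a root, its three neighbours, which point to the
three branches, and one leaf for each branch. -/
structure Split (d : ℕ) where
  root : Node d
  branch : Fin 3 → Node d
  leaf : Fin 3 → Fin d

/-- `T` is the current tree, `U` the set of nodes of the current subtree. The root is an inner node
of the subtree, it splits the subtree into three parts of roughly equal size (none has more than
the fraction `β` of the nodes), and the leaves are taken from its three branches. -/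
def Split.IsValid {d : ℕ} (β : ℝ) (T : SimpleGraph (Node d)) (U : Set (Node d)) (s : Split d) :
    Prop :=
  s.root ∈ U ∧ Function.Injective s.branch ∧ (∀ v, T.Adj s.root v ↔ ∃ j, s.branch j = v) ∧
    ∀ j, s.branch j ∈ U ∧ Sum.inl (s.leaf j) ∈ side T s.root (s.branch j) ∧
      ((U ∩ side T s.root (s.branch j)).ncard : ℝ) ≤ β * (U.ncard : ℝ)

/-- A rule for all the choices that the algorithm leaves open: the order in which the variables are
joined, the minimiser in the quartet test, and the roots and triplets of leaves. -/
structure ChoiceRule (d : ℕ) (β : ℝ) where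
  order : Equiv.Perm (Fin d)
  argmin : (Fin 3 → ℝ) → Fin 3
  argmin_le : ∀ (a : Fin 3 → ℝ) (i : Fin 3), a (argmin a) ≤ a i
  split : SimpleGraph (Node d) → Set (Node d) → Split d
  split_isValid : ∀ T U, (∃ s, Split.IsValid β T U s) → Split.IsValid β T U (split T U)

namespace BuildTree

variable {d n m : ℕ} {β : ℝ}

/-- The tree on the first four variables, with two latent variables: the first variable is grouped
with the variable number `j + 1` of the other three. -/
def initialTree (hd : 4 ≤ d) (ρ : ChoiceRule d β) (j : Fin 3) : SimpleGraph (Node d) :=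
  let X : Fin 4 → Node d := fun t => Sum.inl (ρ.order (Fin.castLE hd t))
  let h : Node d := Sum.inr ⟨0, by omega⟩
  let g : Node d := Sum.inr ⟨1, by omega⟩
  SimpleGraph.fromRel fun a b =>
    (a = h ∧ (b = g ∨ b = X 0 ∨ b = X j.succ)) ∨ (a = g ∧ ∃ t, t ≠ 0 ∧ t ≠ j.succ ∧ b = X t)

open Classical in
/-- One round of the search for the place of the new variable `i` in the tree `T`: if the current
subtree `U` is not yet a single edge, it is split at the chosen root `R`, and the quartet test
selects the branch with which the search goes on (together with the edge from it to `R`). -/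
noncomputable def searchStep (ρ : ChoiceRule d β) (data : Fin m → Fin d → Fin n)
    (T : SimpleGraph (Node d)) (i : Fin d) (U : Set (Node d)) : Set (Node d) :=
  if U.ncard ≤ 2 then U
  else
    let s := ρ.split T U
    let j := quartetTest ρ.argmin data ![i, s.leaf 0, s.leaf 1, s.leaf 2]
    insert s.root (U ∩ side T s.root (s.branch j))

/-- The two end points of the edge at which the search ends. It starts from the whole tree; since a
subtree has fewer than `2 * d` nodes and every round removes at least one node, `2 * d` rounds
suffice. -/
noncomputable def search (ρ : ChoiceRule d β) (data : Fin m → Fin d → Fin n)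
    (T : SimpleGraph (Node d)) (i : Fin d) : Set (Node d) :=
  (searchStep ρ data T i)^[2 * d] T.support

/-- The new leaf `x` is joined, via the new hidden node `h`, to the edge with end points `U`. -/
def joinLeaf (T : SimpleGraph (Node d)) (U : Set (Node d)) (h x : Node d) :
    SimpleGraph (Node d) :=
  SimpleGraph.fromRel fun a b =>
    (T.Adj a b ∧ ¬(a ∈ U ∧ b ∈ U)) ∨ (a = h ∧ (b ∈ U ∨ b = x))

/-- The tree after the first `4 + t` variables (at most all `d`) have been joined. -/
noncomputable def treeAfter (hd : 4 ≤ d) (ρ : ChoiceRule d β) (data : Fin m → Fin d → Fin n) :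
    ℕ → SimpleGraph (Node d)
  | 0 => initialTree hd ρ
      (quartetTest ρ.argmin data fun t => ρ.order (Fin.castLE hd t))
  | t + 1 =>
    let T := treeAfter hd ρ data t
    if ht : 4 + t < d then
      let i := ρ.order ⟨4 + t, ht⟩
      joinLeaf T (search ρ data T i) (Sum.inr ⟨2 + t, by omega⟩) (Sum.inl i)
    else T

/-- The output of the tree building algorithm. -/
noncomputable def output (hd : 4 ≤ d) (ρ : ChoiceRule d β) (data : Fin m → Fin d → Fin n) :
    SimpleGraph (Node d) := treeAfter hd ρ data (d - 4)

end BuildTree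

/-- The two leaf-labelled trees have the same topology: they are isomorphic by an isomorphism that
fixes every observed variable. -/
def SameTopology {d : ℕ} {H H' : Type*} (T : SimpleGraph (Fin d ⊕ H))
    (T' : SimpleGraph (Fin d ⊕ H')) : Prop :=
  ∃ e : T ≃g T', ∀ i : Fin d, e (Sum.inl i) = Sum.inl i

/-- `X` consists of `m` i.i.d. samples of the observed variables of the model, and the random seed
`ξ` that the algorithm may use for its choices is independent of the samples. -/
structure IsSampling {d n k m : ℕ} {H Ω S : Type*} [Fintype H] [MeasurableSpace Ω]
    [MeasurableSpace S] (M : LatentTreeModel d n k H) (μ : MeasureTheory.Measure Ω)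
    (X : Fin m → Ω → Fin d → Fin n) (ξ : Ω → S) : Prop where
  measurable_sample : ∀ l, Measurable (X l)
  iIndepFun_sample : ProbabilityTheory.iIndepFun X μ
  law_sample : ∀ l x, μ.real {ω | X l ω = x} = M.obs x
  measurable_seed : Measurable ξ
  indepFun_seed : ProbabilityTheory.IndepFun ξ (fun ω l => X l ω) μ

/-! The proof combines a deterministic statement about trees, a lower bound for the gaps, and a
concentration inequality.

Trees. The tests that are asked when every answer is correct are determined by the true tree and the
choice rule, not by the data. They form a fixed finite set `Q`, and only these tests have to
succeed; `exists_tests` bounds the size of `Q` by `(1 + 2 * searchRate β) * d log d`. The invariant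
behind this is `Spans`: the current tree is spanned by a set of vertices of the true tree which
contains the median of any three of its points. Joining a leaf at the right edge adds that leaf and
one new median (`Spans.join`). A search keeps a subtree in which the place of the new leaf lies;
such a subtree has a centroid, and a balanced split shrinks it at least by the factor `(1 + β) / 2`,
so that logarithmically many rounds suffice. Once all leaves are present, every hidden vertex is a
median of three of them, and the spanned tree is the true one (`Spans.sameTopology`). The geometry
is expressed by distances: the four-point condition `quad` leaves problems of linear arithmetic.

Gaps. By conditional independence the table of a quartet is a combination of `k²` product tensors
with coefficients `P_HG` (`table4_eq_sum`). Replacing `P_HG` by `P_H P_Gᵀ` moves each of the three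
nuclear norms by at most `k ‖Δ‖_F`, so `α_q ≥ θ_q - 2k ‖Δ‖_F` (`theta_sub_le_alpha`). Under (A4) the
bound on edges passes to all pairs of hidden variables, because `Δ` is multiplicative along paths up
to the weights `1 / P` (`Delta_eq_sum`). As `2k ≤ k² + k`, no gap is negative (`alphaMin_nonneg`).

Concentration. Let `f` be the empirical norm of the correct grouping minus that of a wrong one.
Replacing one sample changes `f` by at most `4 / m`. The mean error of an empirical norm is at most
`n` times a mean Frobenius error, hence at most `n / √m`, so the mean of `f` is at most `-α + 2n /
√m ≤ -α / 2` as soon as `m α² ≥ 16 n²`. The bounded differences inequality `iidMean_exp_le` then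
gives the failure probability `exp (-m α² / 32)` (`iidMean_nuclearNorm_le`), and a union bound over
`Q` gives the first part. For smaller `m` the exponential exceeds `exp (-n² / 2)`, and a constant
depending on `n` makes the bound vacuous. -/

/-! ### The metric of a tree -/

namespace SimpleGraph.IsTree

variable {V : Type*} {T : SimpleGraph V}

/-- A walk from `w` to `v` can change sides only along the edge `u - v` itself, and there it stands
at one of the end points. -/
theorem mem_side_or_mem_side (hT : T.IsTree) {u v : V} (w : V) :
    w ∈ side T u v ∨ w ∈ side T v u := by
  obtain ⟨p⟩ := hT.connected.preconnected w v
  induction p with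
  | nil => exact Or.inl (Reachable.refl _)
  | @cons a b c hab p ih =>
    by_cases he : s(a, b) = s(u, c)
    · rcases Sym2.eq_iff.1 he with ⟨rfl, rfl⟩ | ⟨rfl, rfl⟩
      · exact Or.inr (Reachable.refl _)
      · exact Or.inl (Reachable.refl _)
    · have hr : (T.deleteEdges {s(u, c)}).Reachable b a :=
        Adj.reachable (by rw [deleteEdges_adj]; exact ⟨hab.symm, fun h => he (Sym2.eq_swap.trans h)⟩)
      refine (ih).imp (fun h => Reachable.trans h hr) fun h => ?_
      have h' : (T.deleteEdges {s(c, u)}).Reachable u b := h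
      rw [Sym2.eq_swap] at h'
      have := h'.trans hr
      rw [Sym2.eq_swap] at this
      exact this

/-- The edge is a bridge, so a shortest walk from `x` to `y` uses it; cutting a shortest walk at one
of its vertices leaves two shortest walks. -/
theorem dist_eq_add_of_mem_side (hT : T.IsTree) {u v x y : V} (h : T.Adj u v)
    (hx : x ∈ side T u v) (hy : y ∈ side T v u) :
    T.dist x y = T.dist x v + T.dist v y ∧ T.dist x y = T.dist x u + T.dist u y := by
  obtain ⟨p, hp⟩ := hT.connected.exists_walk_length_eq_dist x y
  have hbr : ¬ (T.deleteEdges {s(u, v)}).Reachable u v := by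
    have := (isAcyclic_iff_forall_adj_isBridge.1 hT.isAcyclic) h
    rw [isBridge_iff] at this
    exact this
  have he : s(u, v) ∈ p.edges := by
    by_contra hne
    apply hbr
    have h1 : (T.deleteEdges {s(u, v)}).Reachable x y :=
      ⟨p.toDeleteEdges {s(u, v)} (by
        intro e he h2
        rw [Set.mem_singleton_iff] at h2
        exact hne (h2 ▸ he))⟩
    have h2 : (T.deleteEdges {s(v, u)}).Reachable u y := hy
    rw [Sym2.eq_swap] at h2
    exact h2.trans (h1.symm.trans (Reachable.symm hx))
  have key : ∀ w ∈ p.support, T.dist x y = T.dist x w + T.dist w y := by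
    classical
    intro w hw
    have h1 := dist_le (p.takeUntil w hw)
    have h2 := dist_le (p.dropUntil w hw)
    have h3 : (p.takeUntil w hw).length + (p.dropUntil w hw).length = p.length := by
      rw [← Walk.length_append, Walk.take_spec]
    have h4 := hT.connected.dist_triangle (u := x) (v := w) (w := y)
    omega
  exact ⟨key v (p.snd_mem_support_of_mem_edges he), key u (p.fst_mem_support_of_mem_edges he)⟩

theorem mem_side_self (u v : V) : v ∈ side T u v := Reachable.refl _

/-- This translates sides of edges into equations between distances, which `omega` can use. -/
theorem mem_side_iff (hT : T.IsTree) {u v w : V} (h : T.Adj u v) :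
    w ∈ side T u v ↔ T.dist w u = T.dist w v + 1 := by
  have key : ∀ {u v : V}, T.Adj u v → w ∈ side T u v → T.dist w u = T.dist w v + 1 := by
    intro u v h hw
    have := (hT.dist_eq_add_of_mem_side h hw (mem_side_self v u)).1
    rwa [dist_eq_one_iff_adj.2 h.symm] at this
  refine ⟨key h, fun hd => ?_⟩
  rcases hT.mem_side_or_mem_side (u := u) (v := v) w with h1 | h1
  · exact h1
  · have := key h.symm h1
    omega

theorem dist_across (hT : T.IsTree) {u v x y : V} (h : T.Adj u v)
    (hx : T.dist x u = T.dist x v + 1) (hy : T.dist y v = T.dist y u + 1) :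
    T.dist x y = T.dist x v + 1 + T.dist u y := by
  have := (hT.dist_eq_add_of_mem_side h ((hT.mem_side_iff h).2 hx)
    ((hT.mem_side_iff h.symm).2 hy)).2
  omega

theorem dist_eq_or (hT : T.IsTree) {u v : V} (h : T.Adj u v) (x : V) :
    T.dist x u = T.dist x v + 1 ∨ T.dist x v = T.dist x u + 1 := by
  rcases hT.mem_side_or_mem_side (u := u) (v := v) x with h1 | h1
  · exact Or.inl ((hT.mem_side_iff h).1 h1)
  · exact Or.inr ((hT.mem_side_iff h.symm).1 h1)

/-- The neighbour of `x` in the direction of `y`. -/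
theorem exists_adj_toward (hT : T.IsTree) {x y : V} (h : x ≠ y) :
    ∃ x', T.Adj x x' ∧ T.dist y x = T.dist y x' + 1 := by
  obtain ⟨p, hp⟩ := hT.connected.exists_walk_length_eq_dist x y
  cases p with
  | nil => exact absurd rfl h
  | @cons _ b _ hab q =>
    refine ⟨b, hab, ?_⟩
    have h1 := dist_le q
    rw [Walk.length_cons] at hp
    have h2 := hT.dist_eq_or hab y
    rw [T.dist_comm (u := y) (v := x), T.dist_comm (u := y) (v := b)] at *
    omega

/-- Move `x` one step towards `y`. If this is also a step towards `z`, the median stays the same;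
otherwise `x` is itself the median. -/
theorem exists_median (hT : T.IsTree) (x y z : V) : ∃ m, T.dist x m + T.dist m y = T.dist x y ∧
    T.dist x m + T.dist m z = T.dist x z ∧ T.dist y m + T.dist m z = T.dist y z := by
  induction hn : T.dist x y generalizing x with
  | zero =>
    rw [hT.connected.dist_eq_zero_iff] at hn
    subst hn
    exact ⟨x, by simp⟩
  | succ n ih =>
    have hne : x ≠ y := by rintro rfl; simp at hn
    obtain ⟨x', ha, hd⟩ := hT.exists_adj_toward hne
    have c1 := T.dist_comm (u := x) (v := y)
    have c2 := T.dist_comm (u := x') (v := y)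
    have c3 := T.dist_comm (u := x) (v := z)
    have c4 := T.dist_comm (u := x') (v := z)
    rcases hT.dist_eq_or ha z with hz | hz
    · obtain ⟨m, h1, h2, h3⟩ := ih x' (by omega)
      have a1 := hT.connected.dist_triangle (u := x) (v := x') (w := m)
      have a2 := hT.connected.dist_triangle (u := x) (v := m) (w := y)
      have a3 := hT.connected.dist_triangle (u := x) (v := m) (w := z)
      rw [dist_eq_one_iff_adj.2 ha] at a1
      exact ⟨m, by omega, by omega, h3⟩
    · have := hT.dist_across ha hd hz
      exact ⟨x, by simp [hn], by simp, by omega⟩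

/-- This is the four-point condition. A step from `x` towards `y` lowers both sides alike if `z` and
`w` lie in the same direction; if one of them does not, its path to `y` passes through `x` and the
triangle inequality is enough. -/
theorem dist_add_dist_le (hT : T.IsTree) (x y z w : V) :
    T.dist x y + T.dist z w ≤ T.dist x z + T.dist y w ∨
      T.dist x y + T.dist z w ≤ T.dist x w + T.dist y z := by
  induction hn : T.dist x y generalizing x with
  | zero =>
    rw [hT.connected.dist_eq_zero_iff] at hn
    subst hn
    have := hT.connected.dist_triangle (u := z) (v := x) (w := w)
    have := T.dist_comm (u := x) (v := z)
    omega
  | succ n ih =>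
    have hne : x ≠ y := by rintro rfl; simp at hn
    obtain ⟨x', ha, hd⟩ := hT.exists_adj_toward hne
    have c1 := T.dist_comm (u := x) (v := y)
    have c2 := T.dist_comm (u := x') (v := y)
    have c3 := T.dist_comm (u := x) (v := z)
    have c4 := T.dist_comm (u := x') (v := z)
    have c5 := T.dist_comm (u := x) (v := w)
    have c6 := T.dist_comm (u := x') (v := w)
    have t := hT.connected.dist_triangle (u := z) (v := x) (w := w)
    rcases hT.dist_eq_or ha z with hz | hz <;> rcases hT.dist_eq_or ha w with hw | hw
    · have := ih x' (by omega)
      omega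
    · have := hT.dist_across ha hd hw
      omega
    · have := hT.dist_across ha hd hz
      omega
    · have := hT.dist_across ha hd hz
      have := hT.dist_across ha hd hw
      omega

/-- Symmetry, triangle inequalities and the four-point condition for four vertices. -/
theorem quad (hT : T.IsTree) (x y z w : V) :
    (T.dist y x = T.dist x y ∧ T.dist z x = T.dist x z ∧ T.dist w x = T.dist x w ∧
      T.dist z y = T.dist y z ∧ T.dist w y = T.dist y w ∧ T.dist w z = T.dist z w) ∧
    (T.dist x y ≤ T.dist x z + T.dist y z ∧ T.dist x y ≤ T.dist x w + T.dist y w ∧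
      T.dist x z ≤ T.dist x y + T.dist y z ∧ T.dist x z ≤ T.dist x w + T.dist z w ∧
      T.dist x w ≤ T.dist x y + T.dist y w ∧ T.dist x w ≤ T.dist x z + T.dist z w ∧
      T.dist y z ≤ T.dist x y + T.dist x z ∧ T.dist y z ≤ T.dist y w + T.dist z w ∧
      T.dist y w ≤ T.dist x y + T.dist x w ∧ T.dist y w ≤ T.dist y z + T.dist z w ∧
      T.dist z w ≤ T.dist x z + T.dist x w ∧ T.dist z w ≤ T.dist y z + T.dist y w) ∧
    ((T.dist x y + T.dist z w ≤ T.dist x z + T.dist y w ∧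
        T.dist x z + T.dist y w = T.dist x w + T.dist y z) ∨
      (T.dist x z + T.dist y w ≤ T.dist x w + T.dist y z ∧
        T.dist x w + T.dist y z = T.dist x y + T.dist z w) ∨
      (T.dist x w + T.dist y z ≤ T.dist x y + T.dist z w ∧
        T.dist x y + T.dist z w = T.dist x z + T.dist y w)) := by
  have s := fun a b => T.dist_comm (u := a) (v := b)
  have t := fun a b c => hT.connected.dist_triangle (u := a) (v := b) (w := c)
  have f1 := hT.dist_add_dist_le x y z w
  have f2 := hT.dist_add_dist_le x z y w
  have f3 := hT.dist_add_dist_le x w y z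
  rw [s z y] at f2
  rw [s w z, s w y] at f3
  refine ⟨⟨s _ _, s _ _, s _ _, s _ _, s _ _, s _ _⟩, ⟨?_, ?_, ?_, ?_, ?_, ?_, ?_, ?_, ?_, ?_, ?_, ?_⟩,
    by omega⟩
  · rw [s y z]; exact t _ _ _
  · rw [s y w]; exact t _ _ _
  · exact t _ _ _
  · rw [s z w]; exact t _ _ _
  · exact t _ _ _
  · exact t _ _ _
  · rw [s x y]; exact t _ _ _
  · rw [s z w]; exact t _ _ _
  · rw [s x y]; exact t _ _ _
  · exact t _ _ _
  · rw [s x z]; exact t _ _ _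
  · rw [s y z]; exact t _ _ _

end SimpleGraph.IsTree

/-! ### Betweenness and median closed sets -/

/-- `m` lies on the path between `x` and `y`. -/
def OnPath {V : Type*} (T : SimpleGraph V) (x m y : V) : Prop :=
  T.dist x m + T.dist m y = T.dist x y

/-- Two points of `S` which are joined by a path without inner points in `S`. -/
def AdjIn {V : Type*} (T : SimpleGraph V) (S : Set V) (x y : V) : Prop :=
  x ≠ y ∧ ∀ w ∈ S, OnPath T x w y → w = x ∨ w = y

/-- `m` is the common point of the paths between `x`, `y`, `z`. -/
def IsMed {V : Type*} (T : SimpleGraph V) (m x y z : V) : Prop :=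
  OnPath T x m y ∧ OnPath T x m z ∧ OnPath T y m z

/-- `S` contains the median of any three of its points. -/
def MedianClosed {V : Type*} (T : SimpleGraph V) (S : Set V) : Prop :=
  ∀ x ∈ S, ∀ y ∈ S, ∀ z ∈ S, ∃ m ∈ S, IsMed T m x y z

namespace SimpleGraph.IsTree

variable {V : Type*} {T : SimpleGraph V} {S : Set V}

theorem onPath_comm (x m y : V) : OnPath T x m y ↔ OnPath T y m x := by
  have := T.dist_comm (u := x) (v := y)
  have := T.dist_comm (u := x) (v := m)
  have := T.dist_comm (u := m) (v := y)
  unfold OnPath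
  omega

theorem onPath_left (x y : V) : OnPath T x x y := by simp [OnPath]

theorem onPath_right (x y : V) : OnPath T x y y := by simp [OnPath]

theorem dist_pos (hT : T.IsTree) {x y : V} (h : x ≠ y) : 0 < T.dist x y :=
  hT.connected.pos_dist_of_ne h

theorem eq_of_dist (hT : T.IsTree) {x y : V} (h : T.dist x y = 0) : x = y :=
  hT.connected.dist_eq_zero_iff.1 h

/-- Being on the same side of `r` is transitive. -/
theorem not_onPath_trans (hT : T.IsTree) {r x y z : V} (h1 : ¬OnPath T x r y) (h2 : ¬OnPath T y r z) :
    ¬OnPath T x r z := by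
  have := hT.quad r x y z
  unfold OnPath at *
  omega

theorem not_onPath_symm {r x y : V} (h : ¬OnPath T x r y) : ¬OnPath T y r x := by rwa [onPath_comm]

theorem onPath_of_not_onPath (hT : T.IsTree) {r x y z : V} (h1 : ¬OnPath T x r y) (h2 : OnPath T x r z) :
    OnPath T y r z := by
  by_contra h
  exact hT.not_onPath_trans h1 h h2

theorem not_onPath_self (hT : T.IsTree) {r x : V} (h : x ≠ r) : ¬OnPath T x r x := by
  have := hT.dist_pos h
  have := T.dist_self (v := x)
  unfold OnPath
  omega

/-- Distinct neighbours of `r` lie on different sides of `r`. -/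
theorem onPath_of_adjIn (hS : MedianClosed T S) {r x z : V} (hr : r ∈ S) (hx : x ∈ S)
    (hz : z ∈ S) (h1 : AdjIn T S r x) (h2 : AdjIn T S r z) (hne : x ≠ z) : OnPath T x r z := by
  obtain ⟨m, hm, m1, m2, m3⟩ := hS r hr x hx z hz
  rcases h1.2 m hm m1 with rfl | rfl
  · exact m3
  · rcases h2.2 m hm m2 with rfl | rfl
    · exact absurd rfl h1.1
    · exact absurd rfl hne

/-- The neighbour of `r` in `S` in the direction of `w`. -/
theorem exists_adjIn_toward (hT : T.IsTree) {r w : V} (hw : w ∈ S) (hne : r ≠ w) :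
    ∃ c ∈ S, AdjIn T S r c ∧ OnPath T r c w := by
  -- The neighbour is the point of `S` on the path from `r` to `w`, other than `r`, which is closest
  -- to `r`.
  have hex : ∃ n, ∃ c ∈ S, c ≠ r ∧ OnPath T r c w ∧ T.dist r c = n :=
    ⟨_, w, hw, hne.symm, onPath_right _ _, rfl⟩
  classical
  obtain ⟨c, hc, hcr, hb, hn⟩ := Nat.find_spec hex
  refine ⟨c, hc, ⟨hcr.symm, fun x hx hbx => ?_⟩, hb⟩
  by_contra! hcon
  have hlt : T.dist r x < Nat.find hex := by
    have := hT.dist_pos hcon.2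
    unfold OnPath at hbx
    omega
  refine Nat.find_min hex hlt ⟨x, hx, hcon.1, ?_, rfl⟩
  have := hT.quad r x c w
  unfold OnPath at *
  omega

/-- A neighbour of `r` in the direction of `w` is on the side of `w`. -/
theorem not_onPath_of_onPath (hT : T.IsTree) {r c w : V} (hne : r ≠ c) (h : OnPath T r c w) :
    ¬OnPath T c r w := by
  have := hT.dist_pos hne
  have := T.dist_comm (u := r) (v := c)
  unfold OnPath at *
  omega

/-! ### Adding a leaf and its point of attachment to a median closed set -/

section Join

variable {a b m y : V}

/-- In a median closed set every point reaches the edge `a - b` in `a` or in `b`. -/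
theorem gate (hT : T.IsTree) (hS : MedianClosed T S) (ha : a ∈ S) (hb : b ∈ S)
    (hab : AdjIn T S a b) (hm : IsMed T m a b y) (hma : m ≠ a) (hmb : m ≠ b) {x : V}
    (hx : x ∈ S) :
    (T.dist x b = T.dist x a + T.dist a b ∧ T.dist x m = T.dist x a + T.dist a m ∧
      T.dist x y = T.dist x a + T.dist a y) ∨
    (T.dist x a = T.dist x b + T.dist b a ∧ T.dist x m = T.dist x b + T.dist b m ∧
      T.dist x y = T.dist x b + T.dist b y) := by
  -- The median of `a`, `b`, `x` belongs to `S` and lies on the path from `a` to `b`, which has no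
  -- inner points in `S`; so it is `a` or `b`.
  obtain ⟨p, hp, p1, p2, p3⟩ := hS a ha b hb x hx
  have := hT.dist_pos hma
  have := hT.dist_pos hmb
  obtain ⟨m1, m2, m3⟩ := hm
  have q1 := hT.quad x a b m
  have q2 := hT.quad x a m y
  have q3 := hT.quad x b m y
  unfold OnPath at *
  rcases hab.2 p hp p1 with rfl | rfl
  · left
    omega
  · right
    omega

theorem not_mem_of_isMed (hab : AdjIn T S a b) (hm : IsMed T m a b y) (hma : m ≠ a)
    (hmb : m ≠ b) : m ∉ S := fun h => by
  rcases hab.2 m h hm.1 with h | h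
  · exact hma h
  · exact hmb h

theorem dist_of_gates (hT : T.IsTree) {a b x z : V} (hab : a ≠ b)
    (hx : T.dist x b = T.dist x a + T.dist a b) (hz : T.dist z a = T.dist z b + T.dist b a) :
    T.dist x z = T.dist x a + T.dist a b + T.dist b z := by
  have := hT.dist_pos hab
  have := hT.quad x z a b
  omega

/-- The point `m` lies between two points of `S` only if they reach the edge at different ends. Then
`a` and `b` lie between them too, so neighbours with `m` between them can only be `a` and `b`. The
point `y` is inner to no path. -/
theorem adjIn_join_iff (hT : T.IsTree) (hS : MedianClosed T S) (ha : a ∈ S) (hb : b ∈ S)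
    (hab : AdjIn T S a b) (hm : IsMed T m a b y) (hma : m ≠ a) (hmb : m ≠ b)
    (hy : ∀ x z, OnPath T x y z → x = y ∨ z = y) (hyS : y ∉ S) {x z : V} (hx : x ∈ S) (hz : z ∈ S) :
    AdjIn T (insert m (insert y S)) x z ↔
      AdjIn T S x z ∧ ¬((x = a ∨ x = b) ∧ (z = a ∨ z = b)) := by
  have hmS := not_mem_of_isMed hab hm hma hmb
  constructor
  · rintro ⟨hne, h⟩
    refine ⟨⟨hne, fun w hw => h w (by simp [hw])⟩, ?_⟩
    have hb' : ¬ OnPath T x m z := fun hb => by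
      rcases h m (by simp) hb with rfl | rfl
      · exact hmS hx
      · exact hmS hz
    have h1 := hm.1
    rintro ⟨rfl | rfl, rfl | rfl⟩
    · exact hne rfl
    · exact hb' h1
    · exact hb' ((onPath_comm _ _ _).1 h1)
    · exact hne rfl
  · rintro ⟨⟨hne, h⟩, hn⟩
    refine ⟨hne, ?_⟩
    rintro w (rfl | rfl | hw) hbw
    · exfalso
      have hpa := hT.dist_pos hma
      have hpb := hT.dist_pos hmb
      have gx := hT.gate hS ha hb hab hm hma hmb hx
      have gz := hT.gate hS ha hb hab hm hma hmb hz
      have q1 := hT.quad x z a w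
      have q2 := hT.quad x z b w
      have hbw' := hbw
      unfold OnPath at hbw'
      rcases gx with gx | gx <;> rcases gz with gz | gz
      · omega
      · have hd := hT.dist_of_gates hab.1 gx.1 gz.1
        have q := hT.quad x z a b
        have e1 := h a ha (by unfold OnPath; omega)
        have e2 := h b hb (by unfold OnPath; omega)
        apply hn
        rcases e1 with rfl | rfl <;> rcases e2 with rfl | rfl <;> simp
        · exact absurd rfl hab.1
        · exact absurd rfl hab.1
      · have hd := hT.dist_of_gates hab.1 gz.1 gx.1
        have q := hT.quad x z a b
        have e1 := h a ha (by unfold OnPath; omega)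
        have e2 := h b hb (by unfold OnPath; omega)
        apply hn
        rcases e1 with rfl | rfl <;> rcases e2 with rfl | rfl <;> simp
        · exact absurd rfl hab.1
        · exact absurd rfl hab.1
      · omega
    · rcases hy _ _ hbw with rfl | rfl
      · exact absurd hx hyS
      · exact absurd hz hyS
    · exact h w hw hbw

/-- By `gate` every path from `m` to a point of `S` runs through `a` or `b`. -/
theorem adjIn_join_new_iff (hT : T.IsTree) (hS : MedianClosed T S) (ha : a ∈ S) (hb : b ∈ S)
    (hab : AdjIn T S a b) (hm : IsMed T m a b y) (hma : m ≠ a) (hmb : m ≠ b) (hmy : m ≠ y)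
    (hy : ∀ x z, OnPath T x y z → x = y ∨ z = y) (hyS : y ∉ S) {x : V} (hx : x ∈ S) :
    AdjIn T (insert m (insert y S)) m x ↔ x = a ∨ x = b := by
  have hmS := not_mem_of_isMed hab hm hma hmb
  have m1 := hm.1
  have q := hT.quad m a b x
  have hpa := hT.dist_pos hma
  have hpb := hT.dist_pos hmb
  constructor
  · rintro ⟨hne, h⟩
    rcases hT.gate hS ha hb hab hm hma hmb hx with g | g
    · rcases h a (by simp [ha]) (by unfold OnPath; omega) with h | h
      · exact absurd h.symm hma
      · exact Or.inl h.symm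
    · rcases h b (by simp [hb]) (by unfold OnPath; omega) with h | h
      · exact absurd h.symm hmb
      · exact Or.inr h.symm
  · intro hxab
    refine ⟨by rcases hxab with rfl | rfl <;> assumption, ?_⟩
    rintro w (rfl | rfl | hw) hbw
    · exact Or.inl rfl
    · rcases hy _ _ hbw with h | h
      · exact absurd h hmy
      · exact Or.inr h.symm
    · right
      have q' := hT.quad m a b w
      have hbw' := hbw
      unfold OnPath at m1 hbw'
      have hpw := hT.dist_pos (x := m) (y := w) (by rintro rfl; exact hmS hw)
      have hw' : w = a ∨ w = b := hab.2 w hw (by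
        unfold OnPath
        rcases hxab with rfl | rfl <;> omega)
      rcases hxab with rfl | rfl <;> rcases hw' with rfl | rfl
      · rfl
      · exfalso; omega
      · exfalso; omega
      · rfl

theorem adjIn_join_leaf (hT : T.IsTree) (hS : MedianClosed T S) (ha : a ∈ S) (hb : b ∈ S)
    (hab : AdjIn T S a b) (hm : IsMed T m a b y) (hma : m ≠ a) (hmb : m ≠ b) (hmy : m ≠ y) :
    AdjIn T (insert m (insert y S)) m y := by
  refine ⟨hmy, ?_⟩
  rintro w (rfl | rfl | hw) hbw
  · exact Or.inl rfl
  · exact Or.inr rfl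
  · exfalso
    have hpa := hT.dist_pos hma
    have hpb := hT.dist_pos hmb
    obtain ⟨m1, m2, m3⟩ := hm
    have q := hT.quad m a w y
    have q' := hT.quad m b w y
    unfold OnPath at *
    rcases hT.gate hS ha hb hab ⟨m1, m2, m3⟩ hma hmb hw with g | g <;> omega

theorem not_adjIn_join_leaf (hT : T.IsTree) (hS : MedianClosed T S) (ha : a ∈ S) (hb : b ∈ S)
    (hab : AdjIn T S a b) (hm : IsMed T m a b y) (hma : m ≠ a) (hmb : m ≠ b) (hmy : m ≠ y)
    {x : V} (hx : x ∈ S) : ¬AdjIn T (insert m (insert y S)) y x := by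
  have hmS := not_mem_of_isMed hab hm hma hmb
  rintro ⟨hne, h⟩
  obtain ⟨m1, m2, m3⟩ := hm
  have q := hT.quad m a x y
  have q' := hT.quad m b x y
  have hbt : OnPath T y m x := by
    unfold OnPath at *
    rcases hT.gate hS ha hb hab ⟨m1, m2, m3⟩ hma hmb hx with g | g <;> omega
  rcases h m (by simp) hbt with h | h
  · exact hmy h
  · exact hmS (h ▸ hx)

theorem isMed_swap {m x y z : V} (h : IsMed T m x y z) : IsMed T m y x z :=
  ⟨(onPath_comm _ _ _).1 h.1, h.2.2, h.2.1⟩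

theorem isMed_rotate {m x y z : V} (h : IsMed T m x y z) : IsMed T m y z x :=
  ⟨h.2.2, (onPath_comm _ _ _).1 h.1, (onPath_comm _ _ _).1 h.2.1⟩

/-- Up to the order, a triple of distinct points has three, two or one members in `S`. Three are
covered by `hS`. For one, the median with `m` and `y` is `m`. Two are treated according to the ends
at which they reach the edge `a - b`. -/
theorem medianClosed_join (hT : T.IsTree) (hS : MedianClosed T S) (ha : a ∈ S) (hb : b ∈ S)
    (hab : AdjIn T S a b) (hm : IsMed T m a b y) (hma : m ≠ a) (hmb : m ≠ b) :
    MedianClosed T (insert m (insert y S)) := by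
  have g := fun {x} (hx : x ∈ S) => hT.gate hS ha hb hab hm hma hmb hx
  have hpa := hT.dist_pos hma
  have hpb := hT.dist_pos hmb
  have old : ∀ x ∈ S, ∀ z ∈ S, ∀ t, t = m ∨ t = y →
      ∃ p ∈ insert m (insert y S), IsMed T p x z t := by
    intro x hx z hz t ht
    -- With different ends, the path from `x` to `z` contains `m`, where the path to `y` leaves it.
    have mixed : ∀ {x z}, x ∈ S → z ∈ S → T.dist x b = T.dist x a + T.dist a b →
        T.dist z a = T.dist z b + T.dist b a → IsMed T m x z t := by
      intro x z hx hz h1 h2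
      have hd := hT.dist_of_gates hab.1 h1 h2
      have q := hT.quad x z a b
      have q1 := hT.quad x m a y
      have q2 := hT.quad z m b y
      have q3 := hT.quad a b m y
      have gx := g hx
      have gz := g hz
      obtain ⟨m1, m2, m3⟩ := hm
      unfold IsMed OnPath at *
      rcases ht with rfl | rfl
      · refine ⟨by omega, by simp, by simp⟩
      · refine ⟨by omega, by omega, by omega⟩
    -- With the same end `c`, the new point can be replaced by `c`, and the median of `x`, `z`, `c`
    -- is in `S`.
    have same : ∀ c ∈ S, (T.dist x t = T.dist x c + T.dist c t) →
        (T.dist z t = T.dist z c + T.dist c t) →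
        ∃ p ∈ insert m (insert y S), IsMed T p x z t := by
      intro c hc h1 h2
      obtain ⟨p, hp, p1, p2, p3⟩ := hS x hx z hz c hc
      refine ⟨p, by simp [hp], p1, ?_, ?_⟩
      · have := hT.quad x p c t
        unfold OnPath at *
        omega
      · have := hT.quad z p c t
        unfold OnPath at *
        omega
    rcases g hx with gx | gx <;> rcases g hz with gz | gz
    · exact same a ha (by rcases ht with rfl | rfl <;> omega)
        (by rcases ht with rfl | rfl <;> omega)
    · exact ⟨m, by simp, mixed hx hz gx.1 gz.1⟩
    · exact ⟨m, by simp, isMed_swap (mixed hz hx gz.1 gx.1)⟩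
    · exact same b hb (by rcases ht with rfl | rfl <;> omega)
        (by rcases ht with rfl | rfl <;> omega)
  have one : ∀ x ∈ S, OnPath T x m y := by
    intro x hx
    have q := hT.quad m a x y
    have q' := hT.quad m b x y
    obtain ⟨m1, m2, m3⟩ := hm
    unfold OnPath at *
    rcases g hx with g | g <;> omega
  have triv : ∀ u ∈ insert m (insert y S), ∀ v, ∃ p ∈ insert m (insert y S), IsMed T p u u v :=
    fun u hu v => ⟨u, hu, onPath_left _ _, onPath_left _ _, onPath_left _ _⟩
  have new2 : ∀ x ∈ S, ∃ p ∈ insert m (insert y S), IsMed T p m y x := fun x hx =>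
    ⟨m, by simp, onPath_left _ _, onPath_left _ _, (onPath_comm _ _ _).1 (one x hx)⟩
  have rot : ∀ {x y z : V} {S : Set V}, (∃ p ∈ S, IsMed T p x y z) → ∃ p ∈ S, IsMed T p y z x :=
    fun ⟨p, hp, h⟩ => ⟨p, hp, isMed_rotate h⟩
  have swp : ∀ {x y z : V} {S : Set V}, (∃ p ∈ S, IsMed T p x y z) → ∃ p ∈ S, IsMed T p y x z :=
    fun ⟨p, hp, h⟩ => ⟨p, hp, isMed_swap h⟩
  intro x hx z hz w hw
  by_cases h1 : x = z
  · subst h1; exact triv _ hx _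
  by_cases h2 : z = w
  · subst h2; exact rot (rot (triv _ hz _))
  by_cases h3 : x = w
  · subst h3; exact rot (triv _ hx _)
  have cls : ∀ u ∈ insert m (insert y S), (u = m ∨ u = y) ∨ u ∈ S := by
    rintro u (h | h | h) <;> simp [h]
  rcases cls x hx with kx | kx <;> rcases cls z hz with kz | kz <;> rcases cls w hw with kw | kw
  · exfalso
    rcases kx with rfl | rfl <;> rcases kz with rfl | rfl <;> rcases kw with rfl | rfl <;> simp_all
  · rcases kx with rfl | rfl <;> rcases kz with rfl | rfl
    · exact absurd rfl h1
    · exact new2 w kw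
    · exact swp (new2 w kw)
    · exact absurd rfl h1
  · rcases kx with rfl | rfl <;> rcases kw with rfl | rfl
    · exact absurd rfl h3
    · exact swp (rot (rot (new2 z kz)))
    · exact rot (new2 z kz)
    · exact absurd rfl h3
  · exact rot (rot (old z kz w kw x kx))
  · rcases kz with rfl | rfl <;> rcases kw with rfl | rfl
    · exact absurd rfl h2
    · exact rot (rot (new2 x kx))
    · exact swp (rot (new2 x kx))
    · exact absurd rfl h2
  · exact rot (old w kw x kx z kz)
  · exact old x kx z kz w kw
  · obtain ⟨p, hp, h⟩ := hS x kx z kz w kw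
    exact ⟨p, by simp [hp], h⟩

end Join

end SimpleGraph.IsTree

/-! ### Trivalent trees with labelled leaves -/

/-- A tree whose leaves are the observed variables and whose inner nodes have three neighbours. -/
structure IsTrivalent {d : ℕ} {H : Type*} (G : SimpleGraph (Fin d ⊕ H)) : Prop where
  isTree : G.IsTree
  ncard_leaf : ∀ i, (G.neighborSet (Sum.inl i)).ncard = 1
  ncard_inner : ∀ h, (G.neighborSet (Sum.inr h)).ncard = 3

section

open SimpleGraph.IsTree

variable {d : ℕ} {H : Type*} {G : SimpleGraph (Fin d ⊕ H)}

theorem AdjIn.symm {V : Type*} {T : SimpleGraph V} {S : Set V} {x y : V} (h : AdjIn T S x y) :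
    AdjIn T S y x :=
  ⟨h.1.symm, fun w hw hb => (h.2 w hw ((onPath_comm _ _ _).1 hb)).symm⟩

theorem adjIn_comm {V : Type*} {T : SimpleGraph V} {S : Set V} {x y : V} :
    AdjIn T S x y ↔ AdjIn T S y x := ⟨AdjIn.symm, AdjIn.symm⟩

theorem onPath_pairwise {a b c : Fin d} {v : Fin d ⊕ H}
    (h1 : OnPath G (Sum.inl a) v (Sum.inl b)) (h2 : OnPath G (Sum.inl a) v (Sum.inl c))
    (h3 : OnPath G (Sum.inl b) v (Sum.inl c)) (j j' : Fin 3) (hj : j ≠ j') :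
    OnPath G (Sum.inl (![a, b, c] j)) v (Sum.inl (![a, b, c] j')) := by
  have h1' := (onPath_comm _ _ _).1 h1
  have h2' := (onPath_comm _ _ _).1 h2
  have h3' := (onPath_comm _ _ _).1 h3
  fin_cases j <;> fin_cases j' <;> first | exact absurd rfl hj | assumption

/-- Vertices in the direction of the same neighbour are on the same side. -/
theorem SimpleGraph.IsTree.not_onPath_of_toward {V : Type*} {T : SimpleGraph V} (hT : T.IsTree)
    {r c x y : V} (hx : T.dist x r = T.dist x c + 1) (hy : T.dist y r = T.dist y c + 1) :
    ¬OnPath T x r y := by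
  have := hT.quad r c x y
  unfold OnPath
  omega

namespace IsTrivalent

/-- The only neighbour of a leaf is the first step towards both ends, so the leaf cannot separate
them. -/
theorem eq_of_onPath_leaf (hG : IsTrivalent G) {x z : Fin d ⊕ H} {i : Fin d}
    (h : OnPath G x (Sum.inl i) z) : x = Sum.inl i ∨ z = Sum.inl i := by
  by_contra! hne
  obtain ⟨c, hc, h1⟩ := hG.isTree.exists_adj_toward hne.1.symm
  obtain ⟨c', hc', h2⟩ := hG.isTree.exists_adj_toward hne.2.symm
  obtain ⟨e, he⟩ := Set.ncard_eq_one.1 (hG.ncard_leaf i)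
  have e1 : c ∈ G.neighborSet (Sum.inl i) := hc
  have e2 : c' ∈ G.neighborSet (Sum.inl i) := hc'
  rw [he, Set.mem_singleton_iff] at e1 e2
  subst e1 e2
  exact hG.isTree.not_onPath_of_toward h1 h2 h

theorem exists_inr_of_onPath (hG : IsTrivalent G) {x v z : Fin d ⊕ H} (h : OnPath G x v z)
    (hx : x ≠ v) (hz : z ≠ v) : ∃ h, v = Sum.inr h := by
  rcases v with i | h'
  · rcases hG.eq_of_onPath_leaf h with h | h
    · exact absurd h hx
    · exact absurd h hz
  · exact ⟨h', rfl⟩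

/-- Every other vertex is on one of the three sides of an inner node. -/
theorem exists_not_onPath (hG : IsTrivalent G) {h : H} {x : Fin 3 → Fin d ⊕ H}
    (hx : ∀ j, x j ≠ Sum.inr h) (hs : ∀ j l, j ≠ l → OnPath G (x j) (Sum.inr h) (x l))
    {y : Fin d ⊕ H} (hy : y ≠ Sum.inr h) : ∃ j, ¬OnPath G y (Sum.inr h) (x j) := by
  choose c hc hd using fun j => hG.isTree.exists_adj_toward (hx j).symm
  obtain ⟨c', hc', hd'⟩ := hG.isTree.exists_adj_toward hy.symm
  -- Separated points have different first steps, so the three directions exhaust the three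
  -- neighbours of the node, and the first step towards `y` is one of them.
  have hinj : Function.Injective c := by
    intro j l hjl
    by_contra hne
    exact hG.isTree.not_onPath_of_toward (hd j) (hjl ▸ hd l) (hs j l hne)
  have hsub : Set.range c ⊆ G.neighborSet (Sum.inr h) := by
    rintro _ ⟨j, rfl⟩
    exact hc j
  have hcard : (Set.range c).ncard = 3 := by
    rw [Set.ncard_range_of_injective hinj, Nat.card_eq_fintype_card, Fintype.card_fin]
  have heq : Set.range c = G.neighborSet (Sum.inr h) :=
    Set.eq_of_subset_of_ncard_le hsub (by rw [hcard, hG.ncard_inner])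
      (Set.finite_of_ncard_ne_zero (by rw [hG.ncard_inner]; norm_num))
  have : c' ∈ Set.range c := heq ▸ hc'
  obtain ⟨j, rfl⟩ := this
  exact ⟨j, hG.isTree.not_onPath_of_toward hd' (hd j)⟩

/-- A vertex `r` separates `x, y` from `z, w` if it separates `x` from `z` and `w`, and if `y` is
on the side of `x`. -/
theorem resolves (hG : IsTrivalent G) {r x y z w : Fin d ⊕ H} (hxy : ¬OnPath G x r y)
    (hz : OnPath G x r z) (hw : OnPath G x r w) : Resolves G x y z w := by
  have hne : r ≠ x := by
    rintro rfl
    exact hxy (onPath_left _ _)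
  -- The separating edge is the one by which the path from `r` to `x` starts.
  obtain ⟨c, hc, hd⟩ := hG.isTree.exists_adj_toward hne
  have key : ∀ z, OnPath G x r z → z ∈ side G c r := by
    intro z hz
    rw [hG.isTree.mem_side_iff hc.symm]
    rcases hG.isTree.dist_eq_or hc z with h | h
    · exact absurd hz (hG.isTree.not_onPath_of_toward hd h)
    · exact h
  refine ⟨c, r, hc.symm, (hG.isTree.mem_side_iff hc).2 hd, (hG.isTree.mem_side_iff hc).2 ?_,
    key z hz, key w hw⟩
  rcases hG.isTree.dist_eq_or hc y with h | h
  · exact h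
  · exfalso
    have h1 := hG.isTree.dist_across hc hd h
    apply hxy
    have := G.dist_comm (u := r) (v := y)
    have := G.dist_comm (u := x) (v := r)
    unfold OnPath
    omega

end IsTrivalent

/-! ### Trees spanned by median closed sets -/

/-- `T` is the tree which the median closed set `φ '' N` of nodes of `G` spans. -/
structure Spans (G : SimpleGraph (Fin d ⊕ H)) (T : SimpleGraph (Node d)) (N : Set (Node d))
    (φ : Node d → Fin d ⊕ H) : Prop where
  leaf : ∀ i, φ (Sum.inl i) = Sum.inl i
  inner : ∀ k, Sum.inr k ∈ N → ∃ h, φ (Sum.inr k) = Sum.inr h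
  injOn : Set.InjOn φ N
  adj_iff : ∀ a b, T.Adj a b ↔ a ∈ N ∧ b ∈ N ∧ AdjIn G (φ '' N) (φ a) (φ b)
  closed : MedianClosed G (φ '' N)
  branches : ∀ k, Sum.inr k ∈ N → ∃ l : Fin 3 → Fin d, (∀ j, Sum.inl (l j) ∈ N) ∧
    ∀ j j', j ≠ j' → OnPath G (Sum.inl (l j)) (φ (Sum.inr k)) (Sum.inl (l j'))

namespace Spans

variable {T : SimpleGraph (Node d)} {N : Set (Node d)} {φ : Node d → Fin d ⊕ H}

theorem leaf_mem_image (hs : Spans G T N φ) {i : Fin d} (h : Sum.inl i ∈ φ '' N) :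
    Sum.inl i ∈ N := by
  obtain ⟨w, hw, he⟩ := h
  rcases w with j | k
  · rw [hs.leaf, Sum.inl.injEq] at he
    exact he ▸ hw
  · obtain ⟨h', e⟩ := hs.inner k hw
    rw [e] at he
    cases he

/-- Every node of the spanned tree has a leaf behind it, as seen from any other vertex. -/
theorem exists_leaf_behind (hG : IsTrivalent G) (hs : Spans G T N φ) {a : Node d} (ha : a ∈ N)
    (z : Fin d ⊕ H) : ∃ l : Fin d, Sum.inl l ∈ N ∧ OnPath G (Sum.inl l) (φ a) z := by
  rcases a with i | k
  · exact ⟨i, ha, by rw [hs.leaf]; exact onPath_left _ _⟩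
  · obtain ⟨l, hl, hsep⟩ := hs.branches k ha
    -- Two leaves on different sides cannot both be on the side of `z`.
    by_cases h0 : OnPath G (Sum.inl (l 0)) (φ (Sum.inr k)) z
    · exact ⟨_, hl 0, h0⟩
    · refine ⟨_, hl 1, (onPath_comm _ _ _).1 ?_⟩
      exact hG.isTree.onPath_of_not_onPath h0 (hsep 0 1 (by decide))

/-- The hypotheses `h1` and `h2` say that the new leaf branches off strictly between `φ a` and `φ
b`. The median of these three vertices is therefore a new hidden vertex, and it becomes the image of
the new inner node. -/
theorem join (hG : IsTrivalent G) (hs : Spans G T N φ) {a b : Node d} (hab : T.Adj a b)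
    {i : Fin d} {k : Fin (d - 2)} (hi : Sum.inl i ∉ N) (hk : Sum.inr k ∉ N)
    (h1 : ¬OnPath G (φ b) (φ a) (Sum.inl i)) (h2 : ¬OnPath G (φ a) (φ b) (Sum.inl i)) :
    ∃ φ', Spans G (BuildTree.joinLeaf T {a, b} (Sum.inr k) (Sum.inl i))
      (insert (Sum.inr k) (insert (Sum.inl i) N)) φ' := by
  classical
  obtain ⟨ha, hb, hadj⟩ := (hs.adj_iff a b).1 hab
  obtain ⟨m, hm⟩ := hG.isTree.exists_median (φ a) (φ b) (Sum.inl i)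
  replace hm : IsMed G m (φ a) (φ b) (Sum.inl i) := hm
  have hiS : Sum.inl i ∉ φ '' N := fun h => hi (hs.leaf_mem_image h)
  have haS : φ a ∈ φ '' N := ⟨a, ha, rfl⟩
  have hbS : φ b ∈ φ '' N := ⟨b, hb, rfl⟩
  have hma : m ≠ φ a := fun h => h1 (h ▸ hm.2.2)
  have hmb : m ≠ φ b := fun h => h2 (h ▸ hm.2.1)
  have hmy : m ≠ Sum.inl i := by
    intro h
    rcases hG.eq_of_onPath_leaf (h ▸ hm.1) with h | h
    · exact hiS (h ▸ haS)
    · exact hiS (h ▸ hbS)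
  have hy : ∀ x z, OnPath G x (Sum.inl i) z → x = Sum.inl i ∨ z = Sum.inl i :=
    fun x z => hG.eq_of_onPath_leaf
  obtain ⟨h, rfl⟩ := hG.exists_inr_of_onPath hm.1 hma.symm hmb.symm
  -- One new value is enough, since `φ` fixes all leaves, including those not yet joined.
  set φ' := Function.update φ (Sum.inr k) (Sum.inr h) with hφ'
  have hφk : φ' (Sum.inr k) = Sum.inr h := Function.update_self _ _ _
  have hφi : ∀ j, φ' (Sum.inl j) = Sum.inl j := fun j => by
    rw [hφ', Function.update_of_ne (by simp), hs.leaf]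
  have hφN : ∀ x ∈ N, φ' x = φ x := fun x hx => by
    rw [hφ', Function.update_of_ne (by rintro rfl; exact hk hx)]
  have himg : φ' '' (insert (Sum.inr k) (insert (Sum.inl i) N)) =
      insert (Sum.inr h) (insert (Sum.inl i) (φ '' N)) := by
    rw [Set.image_insert_eq, Set.image_insert_eq, hφk, hφi, Set.image_congr hφN]
  have hmS : Sum.inr h ∉ φ '' N := not_mem_of_isMed hadj hm hma hmb
  have hU : ∀ {x}, x ∈ N → ((φ x = φ a ∨ φ x = φ b) ↔ x ∈ ({a, b} : Set (Node d))) := by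
    intro x hx
    rw [hs.injOn.eq_iff hx ha, hs.injOn.eq_iff hx hb]
    rfl
  have hkU : Sum.inr k ∉ ({a, b} : Set (Node d)) := by
    rintro (h | h)
    · exact hk (h ▸ ha)
    · exact hk (h ▸ hb)
  have hiU : Sum.inl i ∉ ({a, b} : Set (Node d)) := by
    rintro (h | h)
    · exact hi (h ▸ ha)
    · exact hi (h ▸ hb)
  have hTN : ∀ {x y}, T.Adj x y → x ∈ N ∧ y ∈ N := fun hxy =>
    ⟨((hs.adj_iff _ _).1 hxy).1, ((hs.adj_iff _ _).1 hxy).2.1⟩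
  have hTk : ∀ x, ¬T.Adj (Sum.inr k) x ∧ ¬T.Adj x (Sum.inr k) := fun x =>
    ⟨fun h => hk (hTN h).1, fun h => hk (hTN h).2⟩
  have hTi : ∀ x, ¬T.Adj (Sum.inl i) x ∧ ¬T.Adj x (Sum.inl i) := fun x =>
    ⟨fun h => hi (hTN h).1, fun h => hi (hTN h).2⟩
  have hnk : ∀ {x}, x ∈ N → x ≠ Sum.inr k := fun hx h => hk (h ▸ hx)
  have hni : ∀ {x}, x ∈ N → x ≠ Sum.inl i := fun hx h => hi (h ▸ hx)
  refine ⟨φ', hφi, ?_, ?_, ?_, ?_, ?_⟩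
  · rintro k' (hk' | hk' | hk')
    · rw [hk']
      exact ⟨h, hφk⟩
    · cases hk'
    · rw [hφN _ hk']
      exact hs.inner k' hk'
  · have hinjN : Set.InjOn φ' N := (Set.EqOn.injOn_iff (fun x hx => hφN x hx)).2 hs.injOn
    refine (Set.injOn_insert ?_).2 ⟨(Set.injOn_insert hi).2 ⟨hinjN, ?_⟩, ?_⟩
    · rintro (h | h)
      · cases h
      · exact hk h
    · rw [Set.image_congr hφN, hφi]
      exact hiS
    · rw [Set.image_insert_eq, Set.image_congr hφN, hφi, hφk]
      rintro (h | h)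
      · cases h
      · exact hmS h
  · have new : ∀ x ∈ N, AdjIn G (insert (Sum.inr h) (insert (Sum.inl i) (φ '' N))) (Sum.inr h) (φ x) ↔
        x ∈ ({a, b} : Set (Node d)) := fun x hx => by
      rw [hG.isTree.adjIn_join_new_iff hs.closed haS hbS hadj hm hma hmb hmy hy hiS
        ⟨x, hx, rfl⟩, hU hx]
    have newi := hG.isTree.adjIn_join_leaf hs.closed haS hbS hadj hm hma hmb hmy
    have oldi : ∀ x ∈ N, ¬AdjIn G (insert (Sum.inr h) (insert (Sum.inl i) (φ '' N)))
        (Sum.inl i) (φ x) := fun x hx =>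
      hG.isTree.not_adjIn_join_leaf hs.closed haS hbS hadj hm hma hmb hmy ⟨x, hx, rfl⟩
    have irr : ∀ z S, ¬AdjIn G S z z := fun z S h => h.1 rfl
    intro x y
    rw [himg, BuildTree.joinLeaf, SimpleGraph.fromRel_adj]
    by_cases hx : x ∈ (insert (Sum.inr k) (insert (Sum.inl i) N) : Set (Node d))
    swap
    · simp only [hx, false_and, iff_false]
      simp only [Set.mem_insert_iff, not_or] at hx
      have : ∀ y, ¬T.Adj x y ∧ ¬T.Adj y x := fun y =>
        ⟨fun h => hx.2.2 (hTN h).1, fun h => hx.2.2 (hTN h).2⟩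
      have hxU : x ∉ ({a, b} : Set (Node d)) := by
        rintro (h | h)
        · exact hx.2.2 (h ▸ ha)
        · exact hx.2.2 (h ▸ hb)
      simp [this y, hx.1, hx.2.1, hxU]
    by_cases hy : y ∈ (insert (Sum.inr k) (insert (Sum.inl i) N) : Set (Node d))
    swap
    · simp only [hy, false_and, and_false, iff_false]
      simp only [Set.mem_insert_iff, not_or] at hy
      have : ∀ x, ¬T.Adj x y ∧ ¬T.Adj y x := fun x =>
        ⟨fun h => hy.2.2 (hTN h).2, fun h => hy.2.2 (hTN h).1⟩
      have hyU : y ∉ ({a, b} : Set (Node d)) := by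
        rintro (h | h)
        · exact hy.2.2 (h ▸ ha)
        · exact hy.2.2 (h ▸ hb)
      simp [this x, hy.1, hy.2.1, hyU]
    simp only [hx, hy, true_and]
    rcases hx with rfl | rfl | hx <;> rcases hy with rfl | rfl | hy
    · simp [irr]
    · simp only [hφk, hφi, newi, iff_true]
      simp
    · rw [hφk, hφN y hy, new y hy]
      simp [hTk, hkU, (hnk hy).symm, hnk hy, hni hy]
    · simp only [hφk, hφi, newi.symm, iff_true]
      simp
    · simp [irr]
    · rw [hφi, hφN y hy]
      simp [hTi, oldi y hy, hnk hy]
    · rw [hφk, hφN x hx, adjIn_comm, new x hx]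
      simp [hTk, hkU, hnk hx, hni hx]
    · rw [hφi, hφN x hx, adjIn_comm]
      simp [hTi, oldi x hx, hnk hx]
    · rw [hφN x hx, hφN y hy, hG.isTree.adjIn_join_iff hs.closed haS hbS hadj hm hma hmb ‹_› hiS
        ⟨x, hx, rfl⟩ ⟨y, hy, rfl⟩, hU hx, hU hy]
      have e : T.Adj x y ↔ AdjIn G (φ '' N) (φ x) (φ y) := by
        rw [hs.adj_iff]
        simp [hx, hy]
      simp only [hnk hx, hnk hy, false_and, or_false, T.adj_comm y x, ← e]
      constructor
      · rintro ⟨_, h | h⟩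
        · exact h
        · exact ⟨h.1, fun h' => h.2 h'.symm⟩
      · exact fun h => ⟨h.1.ne, Or.inl h⟩
  · rw [himg]
    exact hG.isTree.medianClosed_join hs.closed haS hbS hadj hm hma hmb
  · rintro k' (hk' | hk' | hk')
    · rw [hk', hφk]
      -- The three leaves around the new inner node are one behind `a`, one behind `b`, and the leaf
      -- just joined.
      obtain ⟨la, hla, pa⟩ := hs.exists_leaf_behind hG ha (φ b)
      obtain ⟨lb, hlb, pb⟩ := hs.exists_leaf_behind hG hb (φ a)
      have hpa := hG.isTree.dist_pos hma
      have hpb := hG.isTree.dist_pos hmb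
      have p1 : OnPath G (Sum.inl la) (Sum.inr h) (Sum.inl i) ∧
          OnPath G (Sum.inl lb) (Sum.inr h) (Sum.inl i) ∧
          OnPath G (Sum.inl la) (Sum.inr h) (Sum.inl lb) := by
        obtain ⟨m1, m2, m3⟩ := hm
        have q1 := hG.isTree.quad (Sum.inl la) (φ a) (φ b) (Sum.inr h)
        have q2 := hG.isTree.quad (Sum.inl lb) (φ a) (φ b) (Sum.inr h)
        have q3 := hG.isTree.quad (Sum.inl la) (φ a) (Sum.inr h) (Sum.inl i)
        have q4 := hG.isTree.quad (Sum.inl lb) (φ b) (Sum.inr h) (Sum.inl i)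
        have q5 := hG.isTree.quad (Sum.inl la) (Sum.inl lb) (φ a) (φ b)
        unfold OnPath at *
        refine ⟨by omega, by omega, by omega⟩
      refine ⟨![la, lb, i], ?_, ?_⟩
      · intro j
        fin_cases j <;> simp [hla, hlb]
      · exact onPath_pairwise p1.2.2 p1.1 p1.2.1
    · cases hk'
    · obtain ⟨l, hl, hsep⟩ := hs.branches k' hk'
      exact ⟨l, fun j => by simp [hl j], by rw [hφN _ hk']; exact hsep⟩

/-- The sides of an edge of the spanned tree. -/
theorem mem_side_iff (hG : IsTrivalent G) (hs : Spans G T N φ) {r c w : Node d} (h : T.Adj r c) :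
    w ∈ side T r c ↔ w ∈ N ∧ ¬OnPath G (φ c) (φ r) (φ w) := by
  obtain ⟨hr, hc, hrc⟩ := (hs.adj_iff r c).1 h
  constructor
  · rintro ⟨p⟩
    -- A step `x - z` that leaves the side of `c` would have to end in `r`. As the edge `r - c` is
    -- removed, `x` would be another neighbour of `r`, and such a neighbour is not on the side of
    -- `c`.
    have key : ∀ (x w : Node d) (p : (T.deleteEdges {s(r, c)}).Walk x w),
        x ∈ N → ¬OnPath G (φ c) (φ r) (φ x) → w ∈ N ∧ ¬OnPath G (φ c) (φ r) (φ w) := by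
      intro x w p
      induction p with
      | nil => exact fun h1 h2 => ⟨h1, h2⟩
      | @cons x z w hxz p ih =>
        intro hx hx'
        rw [SimpleGraph.deleteEdges_adj] at hxz
        obtain ⟨hT, he⟩ := hxz
        obtain ⟨-, hz, hxz'⟩ := (hs.adj_iff x z).1 hT
        refine ih hz fun hcon => ?_
        have hb : OnPath G (φ x) (φ r) (φ z) := hG.isTree.onPath_of_not_onPath hx' hcon
        have hxr : x ≠ r := by
          rintro rfl
          exact hx' (onPath_right _ _)
        rcases hxz'.2 _ ⟨r, hr, rfl⟩ hb with h' | h'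
        · exact hxr (hs.injOn hx hr h'.symm)
        · have hzr := hs.injOn hz hr h'.symm
          subst hzr
          by_cases hxc : x = c
          · subst hxc
            exact he Sym2.eq_swap
          · exact hx' (onPath_of_adjIn hs.closed ⟨z, hr, rfl⟩ ⟨c, hc, rfl⟩ ⟨x, hx, rfl⟩ hrc
              hxz'.symm fun h => hxc (hs.injOn hc hx h).symm)
    exact key c w p hc (hG.isTree.not_onPath_self hrc.1.symm)
  · rintro ⟨hw, hn⟩
    -- From `w` one moves to its neighbour `v` in the direction of `c`, which is nearer to `c` and
    -- still on the same side of `r`.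
    induction hd : G.dist (φ c) (φ w) using Nat.strong_induction_on generalizing w with
    | _ n ih =>
      by_cases hwc : w = c
      · subst hwc
        exact SimpleGraph.Reachable.refl _
      obtain ⟨_, ⟨v, hv, rfl⟩, hwv, hb⟩ := hG.isTree.exists_adjIn_toward (S := φ '' N)
        (r := φ w) (w := φ c) ⟨c, hc, rfl⟩ (fun h => hwc (hs.injOn hw hc h))
      have q := hG.isTree.quad (φ c) (φ r) (φ w) (φ v)
      have hp := hG.isTree.dist_pos hwv.1
      have hn' : ¬OnPath G (φ c) (φ r) (φ v) := by
        unfold OnPath at *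
        omega
      have hlt : G.dist (φ c) (φ v) < n := by
        unfold OnPath at *
        omega
      have hv' := ih _ hlt hv hn' rfl
      have hTvw : T.Adj v w := (hs.adj_iff v w).2 ⟨hv, hw, hwv.symm⟩
      refine SimpleGraph.Reachable.trans hv' (SimpleGraph.Adj.reachable ?_)
      rw [SimpleGraph.deleteEdges_adj]
      refine ⟨hTvw, fun he => ?_⟩
      rw [Set.mem_singleton_iff, Sym2.eq_iff] at he
      rcases he with ⟨rfl, -⟩ | ⟨-, rfl⟩
      · exact hn' (onPath_right _ _)
      · exact hn (onPath_right _ _)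

/-- The neighbour of `r` in the direction of `w`. -/
theorem exists_adj_toward (hG : IsTrivalent G) (hs : Spans G T N φ) {r w : Node d} (hr : r ∈ N)
    (hw : w ∈ N) (hne : r ≠ w) : ∃ c, T.Adj r c ∧ w ∈ side T r c := by
  obtain ⟨_, ⟨c, hc, rfl⟩, hadj, hb⟩ := hG.isTree.exists_adjIn_toward (S := φ '' N) (r := φ r)
    (w := φ w) ⟨w, hw, rfl⟩ fun h => hne (hs.injOn hr hw h)
  have hT : T.Adj r c := (hs.adj_iff r c).2 ⟨hr, hc, hadj⟩
  exact ⟨c, hT, (hs.mem_side_iff hG hT).2 ⟨hw, hG.isTree.not_onPath_of_onPath hadj.1 hb⟩⟩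

theorem onPath_of_adj (hs : Spans G T N φ) {r x z : Node d} (h1 : T.Adj r x) (h2 : T.Adj r z)
    (hne : x ≠ z) : OnPath G (φ x) (φ r) (φ z) := by
  obtain ⟨hr, hx, a1⟩ := (hs.adj_iff r x).1 h1
  obtain ⟨-, hz, a2⟩ := (hs.adj_iff r z).1 h2
  exact onPath_of_adjIn hs.closed ⟨r, hr, rfl⟩ ⟨x, hx, rfl⟩ ⟨z, hz, rfl⟩ a1 a2
    fun h => hne (hs.injOn hx hz h)

theorem eq_of_adj_leaf (hG : IsTrivalent G) (hs : Spans G T N φ) {i : Fin d} {x z : Node d}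
    (h1 : T.Adj (Sum.inl i) x) (h2 : T.Adj (Sum.inl i) z) : x = z := by
  by_contra hne
  have hb := hs.onPath_of_adj h1 h2 hne
  obtain ⟨hr, hx, a1⟩ := (hs.adj_iff _ x).1 h1
  obtain ⟨-, hz, a2⟩ := (hs.adj_iff _ z).1 h2
  rw [hs.leaf] at *
  rcases hG.eq_of_onPath_leaf hb with h | h
  · exact a1.1 h.symm
  · exact a2.1 h.symm

/-- An inner node of the spanned tree has three neighbours, with a leaf in each direction. -/
theorem exists_branches (hG : IsTrivalent G) (hs : Spans G T N φ) {k : Fin (d - 2)}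
    (hk : Sum.inr k ∈ N) : ∃ (c : Fin 3 → Node d) (l : Fin 3 → Fin d), Function.Injective c ∧
      (∀ v, T.Adj (Sum.inr k) v ↔ ∃ j, c j = v) ∧
      ∀ j, Sum.inl (l j) ∈ side T (Sum.inr k) (c j) := by
  obtain ⟨l, hl, hsep⟩ := hs.branches k hk
  obtain ⟨h, hφ⟩ := hs.inner k hk
  choose c hc hd using fun j => hs.exists_adj_toward hG hk (hl j) (by simp)
  have hcl : ∀ j, ¬OnPath G (φ (c j)) (φ (Sum.inr k)) (Sum.inl (l j)) := fun j => by
    have := ((hs.mem_side_iff hG (hc j)).1 (hd j)).2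
    rwa [hs.leaf] at this
  refine ⟨c, l, ?_, ?_, hd⟩
  · intro j j' hjj
    by_contra hne
    have h1 := hcl j
    rw [hjj] at h1
    exact hG.isTree.not_onPath_trans (not_onPath_symm h1) (hcl j') (hsep j j' hne)
  · intro v
    refine ⟨fun hv => ?_, ?_⟩
    -- The neighbour `v` shares its side with some leaf `l j`, hence with `c j`; distinct neighbours
    -- never share a side.
    · obtain ⟨-, hvN, hadj⟩ := (hs.adj_iff _ v).1 hv
      rw [hφ] at hsep hcl hadj
      obtain ⟨j, hj⟩ := hG.exists_not_onPath (x := fun j => Sum.inl (l j)) (by simp) hsep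
        hadj.1.symm
      refine ⟨j, ?_⟩
      by_contra hne
      have := hs.onPath_of_adj hv (hc j) (Ne.symm hne)
      rw [hφ] at this
      exact hG.isTree.not_onPath_trans hj (not_onPath_symm (hcl j)) this
    · rintro ⟨j, rfl⟩
      exact hc j

end Spans

end

/-! ### The search for the place of a new leaf -/

/-- The order in which `regroup j` lists four variables: the first is grouped with the variable
number `j + 1` of the other three. -/
def regroup : Fin 3 → Fin 4 → Fin 4
  | 0 => ![0, 1, 2, 3]
  | 1 => ![0, 2, 1, 3]
  | 2 => ![0, 3, 1, 2]

/-- The correct answer to the quartet test on `q` is `j`. -/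
def Answer {d : ℕ} {H : Type*} (G : SimpleGraph (Fin d ⊕ H)) (q : Fin 4 → Fin d) (j : Fin 3) :
    Prop :=
  Resolves G (Sum.inl (q (regroup j 0))) (Sum.inl (q (regroup j 1)))
    (Sum.inl (q (regroup j 2))) (Sum.inl (q (regroup j 3)))

/-- All the quartet tests in `Q` are answered correctly. -/
def TestsCorrect {d n m : ℕ} {H : Type*} (G : SimpleGraph (Fin d ⊕ H))
    (argmin : (Fin 3 → ℝ) → Fin 3) (data : Fin m → Fin d → Fin n)
    (Q : Finset (Fin 4 → Fin d)) : Prop :=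
  ∀ q ∈ Q, ∀ j, Answer G q j → quartetTest argmin data q = j

section

open SimpleGraph.IsTree

variable {d : ℕ} {H : Type*} {G : SimpleGraph (Fin d ⊕ H)} {T : SimpleGraph (Node d)}
  {N : Set (Node d)} {φ : Node d → Fin d ⊕ H}

theorem injective_vec4 {α : Type*} {a b c e : α} (h1 : a ≠ b) (h2 : a ≠ c) (h3 : a ≠ e)
    (h4 : b ≠ c) (h5 : b ≠ e) (h6 : c ≠ e) : Function.Injective ![a, b, c, e] := by
  intro x y hxy
  fin_cases x <;> fin_cases y <;> simp_all

theorem Resolves.symm {V : Type*} {T : SimpleGraph V} {x y z w : V} (h : Resolves T x y z w) :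
    Resolves T z w x y := by
  obtain ⟨u, v, huv, hx, hy, hz, hw⟩ := h
  exact ⟨v, u, huv.symm, hz, hw, hx, hy⟩

/-- The properties of the subtrees `U` which the search for the place of the leaf `i` visits. -/
structure IsSearchSet (G : SimpleGraph (Fin d ⊕ H)) (T : SimpleGraph (Node d)) (N : Set (Node d))
    (φ : Node d → Fin d ⊕ H) (i : Fin d) (U : Set (Node d)) : Prop where
  subset : U ⊆ N
  convex : ∀ a ∈ U, ∀ c, T.Adj a c → (U ∩ side T a c).Nonempty → c ∈ U
  full : ∀ a ∈ U, ∀ c ∈ U, ∀ c' ∈ U, c ≠ c' → T.Adj a c → T.Adj a c' → ∀ v, T.Adj a v → v ∈ U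
  toward : ∀ k, Sum.inr k ∈ U → ∃ c ∈ U, T.Adj (Sum.inr k) c ∧
    ¬OnPath G (φ c) (φ (Sum.inr k)) (Sum.inl i)
  two_le : 2 ≤ U.ncard

namespace Spans

theorem mem_left (hs : Spans G T N φ) {a b : Node d} (h : T.Adj a b) : a ∈ N :=
  ((hs.adj_iff a b).1 h).1

theorem disjoint_side (hG : IsTrivalent G) (hs : Spans G T N φ) {r x z w : Node d}
    (h1 : T.Adj r x) (h2 : T.Adj r z) (hx : w ∈ side T r x) (hz : w ∈ side T r z) : x = z := by
  by_contra hne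
  rw [hs.mem_side_iff hG h1] at hx
  rw [hs.mem_side_iff hG h2] at hz
  exact hG.isTree.not_onPath_trans hx.2 (not_onPath_symm hz.2) (hs.onPath_of_adj h1 h2 hne)

theorem root_not_mem_side (hG : IsTrivalent G) (hs : Spans G T N φ) {r x : Node d}
    (h : T.Adj r x) : r ∉ side T r x := fun hr =>
  ((hs.mem_side_iff hG h).1 hr).2 (onPath_right _ _)

/-- A side of an edge is closed under all neighbours but the other end point. -/
theorem mem_side_of_adj (hG : IsTrivalent G) (hs : Spans G T N φ) {r c a b : Node d}
    (h : T.Adj r c) (ha : a ∈ side T r c) (hab : T.Adj a b) : b ∈ side T r c ∨ b = r := by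
  by_cases hbr : b = r
  · exact Or.inr hbr
  left
  have har : a ≠ r := by
    rintro rfl
    exact hs.root_not_mem_side hG h ha
  have ha' : (T.deleteEdges {s(r, c)}).Reachable c a := ha
  refine SimpleGraph.Reachable.trans ha' (SimpleGraph.Adj.reachable ?_)
  rw [SimpleGraph.deleteEdges_adj]
  refine ⟨hab, fun he => ?_⟩
  rw [Set.mem_singleton_iff, Sym2.eq_iff] at he
  rcases he with ⟨e, -⟩ | ⟨-, e⟩
  · exact har e
  · exact hbr e

/-- The sides of consecutive edges are nested. -/
theorem side_subset (hG : IsTrivalent G) (hs : Spans G T N φ) {r c v : Node d} (h1 : T.Adj r c)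
    (h2 : T.Adj c v) (hne : v ≠ r) : side T c v ⊆ side T r c \ {c} := by
  intro w hw
  refine ⟨?_, fun hwc => hs.root_not_mem_side hG h2 (hwc ▸ hw)⟩
  have hwN := ((hs.mem_side_iff hG h2).1 hw).1
  rw [hs.mem_side_iff hG h1]
  refine ⟨hwN, fun hb => ?_⟩
  have hr : w ∉ side T c r := fun h => hne (hs.disjoint_side hG h2 h1.symm hw h)
  rw [hs.mem_side_iff hG h1.symm] at hr
  have h' : OnPath G (φ r) (φ c) (φ w) := by
    by_contra hcon
    exact hr ⟨hwN, hcon⟩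
  have := hG.isTree.dist_pos ((hs.adj_iff r c).1 h1).2.2.1
  have q := hG.isTree.quad (φ r) (φ c) (φ w) (φ w)
  unfold OnPath at *
  omega

/-- The search starts from `T.support`; this identifies it with the set of nodes joined so far. -/
theorem support_eq (hG : IsTrivalent G) (hs : Spans G T N φ) {a b : Node d} (ha : a ∈ N)
    (hb : b ∈ N) (hab : a ≠ b) : T.support = N := by
  ext x
  rw [SimpleGraph.mem_support]
  constructor
  · rintro ⟨w, hw⟩
    exact hs.mem_left hw
  · intro hx
    by_cases hxa : x = a
    · subst hxa
      obtain ⟨c, hc, -⟩ := hs.exists_adj_toward hG hx hb hab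
      exact ⟨c, hc⟩
    · obtain ⟨c, hc, -⟩ := hs.exists_adj_toward hG hx ha hxa
      exact ⟨c, hc⟩

end Spans

namespace IsSearchSet

variable {i : Fin d} {U : Set (Node d)}

/-- The neighbour in the direction of another node of `U`. -/
theorem exists_adj_toward (hG : IsTrivalent G) (hs : Spans G T N φ) (hU : IsSearchSet G T N φ i U)
    {a w : Node d} (ha : a ∈ U) (hw : w ∈ U) (hne : a ≠ w) :
    ∃ c ∈ U, T.Adj a c ∧ w ∈ side T a c := by
  obtain ⟨c, hc, hwc⟩ := hs.exists_adj_toward hG (hU.subset ha) (hU.subset hw) hne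
  exact ⟨c, hU.convex a ha c hc ⟨w, hw, hwc⟩, hc, hwc⟩

/-- At an end point of `U`, one branch contains all other nodes of `U`. -/
theorem exists_heavy_branch (hG : IsTrivalent G) (hs : Spans G T N φ)
    (hU : IsSearchSet G T N φ i U) (h3 : 3 ≤ U.ncard) {a : Node d} (ha : a ∈ U)
    (hbad : (∃ l, a = Sum.inl l) ∨ ∃ v, T.Adj a v ∧ v ∉ U) :
    ∃ c ∈ U, T.Adj a c ∧ U.ncard < 2 * (U ∩ side T a c).ncard := by
  obtain ⟨w, hw, hwa⟩ := Set.exists_ne_of_one_lt_ncard (by omega : 1 < U.ncard) a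
  obtain ⟨c, hc, hac, -⟩ := hU.exists_adj_toward hG hs ha hw hwa.symm
  refine ⟨c, hc, hac, ?_⟩
  have hsub : U \ {a} ⊆ U ∩ side T a c := by
    rintro x ⟨hx, hxa⟩
    obtain ⟨c', hc', hac', hxc⟩ := hU.exists_adj_toward hG hs ha hx (Ne.symm hxa)
    -- A leaf has a single neighbour. A node with a neighbour outside `U` has at most one inside, by
    -- `full`.
    have : c' = c := by
      rcases hbad with ⟨l, rfl⟩ | ⟨v, hv, hvU⟩
      · exact hs.eq_of_adj_leaf hG hac' hac
      · by_contra hne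
        exact hvU (hU.full a ha c' hc' c hc hne hac' hac v hv)
    exact ⟨hx, this ▸ hxc⟩
  have h1 := Set.ncard_le_ncard hsub (Set.toFinite _)
  have h2 := Set.ncard_sdiff_singleton_add_one ha (Set.toFinite _)
  omega

/-- A node which splits `U` into branches with at most half of its nodes. -/
theorem exists_centroid (hG : IsTrivalent G) (hs : Spans G T N φ)
    (hU : IsSearchSet G T N φ i U) (h3 : 3 ≤ U.ncard) :
    ∃ k, Sum.inr k ∈ U ∧ ∀ c, T.Adj (Sum.inr k) c →
      c ∈ U ∧ 2 * (U ∩ side T (Sum.inr k) c).ncard ≤ U.ncard := by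
  have main : ∃ a ∈ U, ∀ c ∈ U, T.Adj a c → 2 * (U ∩ side T a c).ncard ≤ U.ncard := by
    by_contra! hcon
    -- Take a branch with more than half of the nodes and as few nodes as possible, and a branch
    -- with more than half at its first node `c`. If the latter leads back to `a`, two disjoint sets
    -- each contain more than half; otherwise it is strictly smaller.
    have hex : ∃ n, ∃ a c, a ∈ U ∧ c ∈ U ∧ T.Adj a c ∧
        U.ncard < 2 * (U ∩ side T a c).ncard ∧ (U ∩ side T a c).ncard = n := by
      obtain ⟨a, ha⟩ := (Set.ncard_pos (Set.toFinite U)).1 (by omega)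
      obtain ⟨c, hc, h1, h2⟩ := hcon a ha
      exact ⟨_, a, c, ha, hc, h1, h2, rfl⟩
    classical
    obtain ⟨a, c, ha, hc, hac, hlt, hn⟩ := Nat.find_spec hex
    obtain ⟨v, hv, hcv, hlt'⟩ := hcon c hc
    by_cases hva : v = a
    · subst hva
      have hdis : Disjoint (U ∩ side T v c) (U ∩ side T c v) := by
        rw [Set.disjoint_left]
        rintro x ⟨-, h1⟩ ⟨-, h2⟩
        rw [hs.mem_side_iff hG hac] at h1
        rw [hs.mem_side_iff hG hcv] at h2
        obtain ⟨m, hm, m1, m2, m3⟩ :=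
          hs.closed _ ⟨v, hs.mem_left hac, rfl⟩ _ ⟨c, hs.mem_left hcv, rfl⟩ _ ⟨x, h1.1, rfl⟩
        rcases ((hs.adj_iff _ _).1 hac).2.2.2 m hm m1 with rfl | rfl
        · exact h1.2 m3
        · exact h2.2 m2
      have h1 := Set.ncard_union_eq hdis (Set.toFinite _) (Set.toFinite _)
      have h2 := Set.ncard_le_ncard (Set.union_subset (Set.inter_subset_left)
        (Set.inter_subset_left) : (U ∩ side T v c) ∪ (U ∩ side T c v) ⊆ U) (Set.toFinite _)
      omega
    · have hss : U ∩ side T c v ⊂ U ∩ side T a c := by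
        refine ⟨fun x hx => ⟨hx.1, (hs.side_subset hG hac hcv hva hx.2).1⟩, fun h => ?_⟩
        have := h ⟨hc, SimpleGraph.Reachable.refl _⟩
        exact hs.root_not_mem_side hG hcv this.2
      have hlt2 := Set.ncard_lt_ncard hss (Set.toFinite _)
      exact Nat.find_min hex (hn ▸ hlt2) ⟨c, v, hc, hv, hcv, hlt', rfl⟩
  obtain ⟨a, ha, hle⟩ := main
  -- Leaves and boundary nodes of `U` have a branch with all other nodes of `U`, too many as `U` has
  -- at least three. So the centroid is an inner node with all its neighbours in `U`.
  have hgood : ¬((∃ l, a = Sum.inl l) ∨ ∃ v, T.Adj a v ∧ v ∉ U) := fun hbad => by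
    obtain ⟨c, hc, hac, hlt⟩ := hU.exists_heavy_branch hG hs h3 ha hbad
    have := hle c hc hac
    omega
  push Not at hgood
  rcases a with l | k
  · exact absurd rfl (hgood.1 l)
  · exact ⟨k, ha, fun c hc => ⟨hgood.2 c hc, hle c (hgood.2 c hc) hc⟩⟩

/-- A subtree with more than two nodes can be split. -/
theorem exists_isValid (hG : IsTrivalent G) (hs : Spans G T N φ)
    (hU : IsSearchSet G T N φ i U) (h3 : 3 ≤ U.ncard) {β : ℝ} (hβ : 1 / 2 ≤ β) :
    ∃ s : Split d, s.IsValid β T U := by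
  obtain ⟨k, hk, hk'⟩ := hU.exists_centroid hG hs h3
  obtain ⟨c, l, hinj, hc, hl⟩ := hs.exists_branches hG (hU.subset hk)
  refine ⟨⟨Sum.inr k, c, l⟩, hk, hinj, hc, fun j => ?_⟩
  have hadj : T.Adj (Sum.inr k) (c j) := (hc _).2 ⟨j, rfl⟩
  refine ⟨(hk' _ hadj).1, hl j, ?_⟩
  have h1 : (2 : ℝ) * ((U ∩ side T (Sum.inr k) (c j)).ncard : ℝ) ≤ (U.ncard : ℝ) := by
    exact_mod_cast (hk' _ hadj).2
  have h2 : (0 : ℝ) ≤ (U.ncard : ℝ) := Nat.cast_nonneg _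
  change ((U ∩ side T (Sum.inr k) (c j)).ncard : ℝ) ≤ β * (U.ncard : ℝ)
  nlinarith

/-- The branch in the direction of the new leaf, together with the root. -/
theorem insert_inter_side (hG : IsTrivalent G) (hs : Spans G T N φ)
    (hU : IsSearchSet G T N φ i U) {r c : Node d} (hr : r ∈ U) (hc : c ∈ U) (hrc : T.Adj r c)
    (hi : ¬OnPath G (φ c) (φ r) (Sum.inl i)) :
    IsSearchSet G T N φ i (insert r (U ∩ side T r c)) := by
  have hsub : insert r (U ∩ side T r c) ⊆ U :=
    Set.insert_subset hr Set.inter_subset_left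
  have hcs : c ∈ side T r c := SimpleGraph.Reachable.refl _
  have step : ∀ a, a ∈ U ∩ side T r c → ∀ b ∈ U, T.Adj a b → b ∈ insert r (U ∩ side T r c) := by
    intro a ha b hb hab
    rcases hs.mem_side_of_adj hG hrc ha.2 hab with h | h
    · exact Or.inr ⟨hb, h⟩
    · exact Or.inl h
  have root : ∀ b, b ∈ insert r (U ∩ side T r c) → T.Adj r b → b = c := by
    rintro b (hb | hb) hrb
    · subst hb
      exact absurd hrb (SimpleGraph.irrefl _)
    · exact hs.disjoint_side hG hrb hrc (SimpleGraph.Reachable.refl _) hb.2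
  refine ⟨hsub.trans hU.subset, ?_, ?_, ?_, ?_⟩
  · rintro a (ha | ha) v hav ⟨w, hw, hwv⟩
    · subst ha
      rcases hw with hw | hw
      · subst hw
        exact absurd hwv (hs.root_not_mem_side hG hav)
      · have := hs.disjoint_side hG hrc hav hw.2 hwv
        exact Or.inr ⟨this ▸ hc, this ▸ hcs⟩
    · exact step a ha v (hU.convex a ha.1 v hav ⟨w, hsub hw, hwv⟩) hav
  -- At the root the condition is vacuous, because `c` is its only neighbour that remains.
  · rintro a (ha | ha) x hx x' hx' hne hax hax' v hav
    · subst ha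
      exact absurd ((root x hx hax).trans (root x' hx' hax').symm) hne
    · exact step a ha v (hU.full a ha.1 x (hsub hx) x' (hsub hx') hne hax hax' v hav) hav
  · rintro k (hk | hk)
    · rw [hk]
      exact ⟨c, Or.inr ⟨hc, hcs⟩, hrc, hi⟩
    · obtain ⟨v, hv, hkv, hvi⟩ := hU.toward k hk.1
      exact ⟨v, step _ hk v hv hkv, hkv, hvi⟩
  · have : ({r, c} : Set (Node d)) ⊆ insert r (U ∩ side T r c) := by
      rintro x (rfl | rfl)
      · exact Or.inl rfl
      · exact Or.inr ⟨hc, hcs⟩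
    have h2 := Set.ncard_le_ncard this (Set.toFinite _)
    rwa [Set.ncard_pair hrc.ne] at h2

/-- A round of the search, provided that the quartet test is answered correctly. -/
theorem exists_searchStep (hG : IsTrivalent G) (hs : Spans G T N φ)
    (hU : IsSearchSet G T N φ i U) (hi : Sum.inl i ∉ N) (h3 : 3 ≤ U.ncard) {β : ℝ}
    (hβ : 1 / 2 ≤ β) (ρ : ChoiceRule d β) :
    ∃ (q : Fin 4 → Fin d) (U' : Set (Node d)), Function.Injective q ∧ IsSearchSet G T N φ i U' ∧
      U'.ncard < U.ncard ∧ (U'.ncard : ℝ) ≤ β * U.ncard + 1 ∧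
      ∀ (n m : ℕ) (data : Fin m → Fin d → Fin n), TestsCorrect G ρ.argmin data {q} →
        BuildTree.searchStep ρ data T i U = U' := by
  have hval := ρ.split_isValid T U (hU.exists_isValid hG hs h3 hβ)
  set s := ρ.split T U with hsdef
  obtain ⟨hr, hinj, hnb, hbr⟩ := hval
  have hadj : ∀ j, T.Adj s.root (s.branch j) := fun j => (hnb _).2 ⟨j, rfl⟩
  obtain ⟨k, hk⟩ : ∃ k, s.root = Sum.inr k := by
    rcases hroot : s.root with l | k
    · have h0 := hadj 0
      have h1 := hadj 1
      rw [hroot] at h0 h1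
      exact absurd (hinj (hs.eq_of_adj_leaf hG h0 h1)) (by decide)
    · exact ⟨k, rfl⟩
  obtain ⟨c, hcU, hkc, hci⟩ := hU.toward k (hk ▸ hr)
  rw [← hk] at hkc hci
  obtain ⟨j, rfl⟩ := (hnb c).1 hkc
  have hleaf : ∀ l, ¬OnPath G (φ (s.branch l)) (φ s.root) (Sum.inl (s.leaf l)) ∧
      Sum.inl (s.leaf l) ∈ N := fun l => by
    have := (hs.mem_side_iff hG (hadj l)).1 (hbr l).2.1
    rw [hs.leaf] at this
    exact ⟨this.2, this.1⟩
  have hsep : ∀ l l', l ≠ l' → OnPath G (Sum.inl (s.leaf l)) (φ s.root) (Sum.inl (s.leaf l')) := by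
    intro l l' hne
    have h1 := hs.onPath_of_adj (hadj l) (hadj l') (fun h => hne (hinj h))
    by_contra hcon
    exact hG.isTree.not_onPath_trans (hleaf l).1
      (hG.isTree.not_onPath_trans hcon (not_onPath_symm (hleaf l').1)) h1
  have hij : ¬OnPath G (Sum.inl i) (φ s.root) (Sum.inl (s.leaf j)) :=
    hG.isTree.not_onPath_trans (not_onPath_symm hci) (hleaf j).1
  have hsepi : ∀ l, l ≠ j → OnPath G (Sum.inl i) (φ s.root) (Sum.inl (s.leaf l)) := by
    intro l hl
    by_contra hcon
    exact hG.isTree.not_onPath_trans (not_onPath_symm hij) hcon (hsep j l hl.symm)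
  have hne : ∀ l, i ≠ s.leaf l := by
    rintro l rfl
    exact hi (hleaf l).2
  obtain ⟨h, hφ⟩ := hs.inner k (hk ▸ hU.subset hr)
  have hlinj : ∀ l l', l ≠ l' → s.leaf l ≠ s.leaf l' := by
    intro l l' hll he
    have h1 := hsep l l' hll
    rw [← he] at h1
    rw [← hk] at hφ
    exact hG.isTree.not_onPath_self (by rw [hφ]; simp) h1
  refine ⟨![i, s.leaf 0, s.leaf 1, s.leaf 2], insert s.root (U ∩ side T s.root (s.branch j)), ?_,
    hU.insert_inter_side hG hs hr hcU hkc hci, ?_, ?_, ?_⟩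
  · exact injective_vec4 (hne 0) (hne 1) (hne 2) (hlinj 0 1 (by decide)) (hlinj 0 2 (by decide))
      (hlinj 1 2 (by decide))
  -- The first node of any branch that is not selected gets lost, so the subtree shrinks even when
  -- `β` is close to 1.
  · obtain ⟨l, hl⟩ : ∃ l, l ≠ j := ⟨j + 1, by fin_cases j <;> decide⟩
    refine Set.ncard_lt_ncard ⟨Set.insert_subset hr Set.inter_subset_left, fun hsub => ?_⟩
      (Set.toFinite _)
    rcases hsub (hbr l).1 with h | h
    · exact (hadj l).ne h.symm
    · exact hl (hinj (hs.disjoint_side hG (hadj l) hkc (SimpleGraph.Reachable.refl _) h.2))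
  -- The summand 1 is the root, which stays in the subtree.
  · have h1 := Set.ncard_insert_le s.root (U ∩ side T s.root (s.branch j))
    have h2 := (hbr j).2.2
    have h1' : ((insert s.root (U ∩ side T s.root (s.branch j))).ncard : ℝ) ≤
        ((U ∩ side T s.root (s.branch j)).ncard : ℝ) + 1 := by exact_mod_cast h1
    linarith
  · intro n m data hdata
    have hans : Answer G ![i, s.leaf 0, s.leaf 1, s.leaf 2] j := by
      have r : ∀ l l', l ≠ j → l' ≠ j → Resolves G (Sum.inl i) (Sum.inl (s.leaf j))
          (Sum.inl (s.leaf l)) (Sum.inl (s.leaf l')) := fun l l' h1 h2 =>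
        hG.resolves hij (hsepi l h1) (hsepi l' h2)
      unfold Answer
      fin_cases j
      · exact r 1 2 (by decide) (by decide)
      · exact r 0 2 (by decide) (by decide)
      · exact r 0 1 (by decide) (by decide)
    have := hdata _ (Finset.mem_singleton_self _) j hans
    unfold BuildTree.searchStep
    rw [if_neg (by omega)]
    simp only [← hsdef, this]

end IsSearchSet

/-! ### The length of a search -/

/-- The number of rounds of a search grows at most with `searchRate β` times the logarithm of the
size. -/
noncomputable def searchRate (β : ℝ) : ℝ := 1 / Real.log (2 / (1 + β))

theorem searchRate_pos {β : ℝ} (hβ : 1 / 2 ≤ β) (hβ' : β < 1) : 0 < searchRate β := by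
  have : 1 < 2 / (1 + β) := by
    rw [lt_div_iff₀ (by linarith)]
    linarith
  exact one_div_pos.2 (Real.log_pos this)

/-- A round multiplies the size by at most `(1 + β) / 2`: the bound `u - 1` gives this if `(1 - β) u
≤ 2`, and the bound `β u + 1` otherwise. The rate is chosen so that this factor lowers `searchRate β
* log` by exactly 1. -/
theorem one_add_searchRate_mul_log_le {β : ℝ} (hβ : 1 / 2 ≤ β) (hβ' : β < 1) {u v : ℝ}
    (hv : 0 < v) (h1 : v ≤ u - 1) (h2 : v ≤ β * u + 1) :
    1 + searchRate β * Real.log v ≤ searchRate β * Real.log u := by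
  have hlog : 0 < Real.log (2 / (1 + β)) := by
    have := searchRate_pos hβ hβ'
    exact one_div_pos.1 this
  have hvu : 2 / (1 + β) * v ≤ u := by
    rw [div_mul_eq_mul_div, div_le_iff₀ (by linarith)]
    rcases le_total ((1 - β) * u) 2 with h | h <;> nlinarith
  have h3 := Real.log_le_log (by positivity) hvu
  rw [Real.log_mul (by positivity) (by positivity)] at h3
  have h4 : searchRate β * Real.log (2 / (1 + β)) = 1 := by
    unfold searchRate
    field_simp
  have h5 := mul_le_mul_of_nonneg_left h3 (searchRate_pos hβ hβ').le
  linarith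

theorem TestsCorrect.mono {n m : ℕ} {argmin : (Fin 3 → ℝ) → Fin 3} {data : Fin m → Fin d → Fin n}
    {Q Q' : Finset (Fin 4 → Fin d)} (h : TestsCorrect G argmin data Q) (hQ : Q' ⊆ Q) :
    TestsCorrect G argmin data Q' := fun q hq => h q (hQ hq)

/-- Following the correct answers fixes the sequence of subtrees before any data are seen, and `Q`
collects the tests along it. The potential `searchRate β * log` of the size pays for one test per
round. -/
theorem IsSearchSet.exists_iterate (hG : IsTrivalent G) (hs : Spans G T N φ) {i : Fin d}
    (hi : Sum.inl i ∉ N) {β : ℝ} (hβ : 1 / 2 ≤ β) (hβ' : β < 1) (ρ : ChoiceRule d β)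
    (U : Set (Node d)) (hU : IsSearchSet G T N φ i U) :
    ∃ (Q : Finset (Fin 4 → Fin d)) (U' : Set (Node d)), (∀ q ∈ Q, Function.Injective q) ∧
      (Q.card : ℝ) ≤ searchRate β * Real.log U.ncard ∧ IsSearchSet G T N φ i U' ∧
      U'.ncard = 2 ∧ ∀ (n m : ℕ) (data : Fin m → Fin d → Fin n), TestsCorrect G ρ.argmin data Q →
        ∀ t, U.ncard ≤ t → (BuildTree.searchStep ρ data T i)^[t] U = U' := by
  classical
  induction hn : U.ncard using Nat.strong_induction_on generalizing U with
  | _ n ih =>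
    by_cases h3 : 3 ≤ U.ncard
    · obtain ⟨q, V, hq, hV, hlt, hle, hstep⟩ := hU.exists_searchStep hG hs hi h3 hβ ρ
      obtain ⟨Q, W, hQ, hcard, hW, hW2, hit⟩ := ih _ (hn ▸ hlt) V hV rfl
      refine ⟨insert q Q, W, ?_, ?_, hW, hW2, ?_⟩
      · intro p hp
        rcases Finset.mem_insert.1 hp with rfl | hp
        · exact hq
        · exact hQ p hp
      · have h1 : ((insert q Q).card : ℝ) ≤ Q.card + 1 := by
          exact_mod_cast Finset.card_insert_le q Q
        have h2 : (V.ncard : ℝ) ≤ U.ncard - 1 := by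
          have : V.ncard + 1 ≤ U.ncard := hlt
          have : (V.ncard : ℝ) + 1 ≤ U.ncard := by exact_mod_cast this
          linarith
        have h0 : (0 : ℝ) < V.ncard := by
          have := hV.two_le
          exact_mod_cast (by omega : 0 < V.ncard)
        have h4 := one_add_searchRate_mul_log_le hβ hβ' h0 h2 hle
        rw [← hn]
        linarith
      · intro n' m data hdata t ht
        obtain ⟨t, rfl⟩ : ∃ t', t = t' + 1 := ⟨t - 1, by omega⟩
        rw [Function.iterate_succ_apply, hstep n' m data (hdata.mono (by simp))]
        exact hit n' m data (hdata.mono (Finset.subset_insert _ _)) t (by omega)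
    · refine ⟨∅, U, by simp, ?_, hU, by have := hU.two_le; omega, ?_⟩
      · have h2 : (1 : ℝ) ≤ (n : ℝ) := by
          have := hU.two_le
          exact_mod_cast (by omega : 1 ≤ n)
        rw [Finset.card_empty, Nat.cast_zero]
        exact mul_nonneg (searchRate_pos hβ hβ').le (Real.log_nonneg h2)
      · intro n' m data _ t _
        -- A subtree with two nodes is a fixed point, so superfluous rounds do no harm.
        refine Function.iterate_fixed ?_ t
        unfold BuildTree.searchStep
        rw [if_pos (by omega)]

/-- A search, provided that its quartet tests are answered correctly. -/
theorem Spans.exists_search (hG : IsTrivalent G) (hs : Spans G T N φ) {i : Fin d}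
    (hi : Sum.inl i ∉ N) (hN : 2 ≤ N.ncard) {β : ℝ} (hβ : 1 / 2 ≤ β) (hβ' : β < 1)
    (ρ : ChoiceRule d β) :
    ∃ (Q : Finset (Fin 4 → Fin d)) (a b : Node d), (∀ q ∈ Q, Function.Injective q) ∧
      (Q.card : ℝ) ≤ searchRate β * Real.log (2 * d) ∧ T.Adj a b ∧
      ¬OnPath G (φ b) (φ a) (Sum.inl i) ∧ ¬OnPath G (φ a) (φ b) (Sum.inl i) ∧
      ∀ (n m : ℕ) (data : Fin m → Fin d → Fin n), TestsCorrect G ρ.argmin data Q →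
        BuildTree.search ρ data T i = {a, b} := by
  obtain ⟨a, b, ha, hb, hab⟩ := (Set.one_lt_ncard_iff (Set.toFinite N)).1 hN
  have hsupp := hs.support_eq hG ha hb hab
  have hmemN : ∀ {x y}, T.Adj x y → y ∈ N := fun h => hs.mem_left h.symm
  have hU : IsSearchSet G T N φ i T.support := by
    rw [hsupp]
    refine ⟨subset_rfl, fun a _ c hac _ => hmemN hac, fun a _ _ _ _ _ _ _ _ v hv => hmemN hv,
      fun k hk => ?_, hN⟩
    obtain ⟨c, l, hcinj, hc, hl⟩ := hs.exists_branches hG hk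
    obtain ⟨h, hφ⟩ := hs.inner k hk
    have hadj : ∀ j, T.Adj (Sum.inr k) (c j) := fun j => (hc _).2 ⟨j, rfl⟩
    obtain ⟨j, hj⟩ := hG.exists_not_onPath (h := h) (x := fun j => φ (c j)) (y := Sum.inl i)
      (fun j => by rw [← hφ]; exact ((hs.adj_iff _ _).1 (hadj j)).2.2.1.symm)
      (fun j j' hne => hφ ▸ hs.onPath_of_adj (hadj j) (hadj j') fun he => hne (hcinj he))
      (by simp)
    rw [← hφ] at hj
    exact ⟨c j, hmemN (hadj j), hadj j, not_onPath_symm hj⟩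
  obtain ⟨Q, U, hQ, hcard, hU', h2, hit⟩ := hU.exists_iterate hG hs hi hβ hβ' ρ
  obtain ⟨x, y, hxy, rfl⟩ := Set.ncard_eq_two.1 h2
  have key : ∀ x y : Node d, x ≠ y → IsSearchSet G T N φ i {x, y} →
      T.Adj x y ∧ ¬OnPath G (φ y) (φ x) (Sum.inl i) := by
    intro x y hxy hU
    obtain ⟨c, hc, hxc, -⟩ := hU.exists_adj_toward hG hs (Or.inl rfl) (Or.inr rfl) hxy
    have hadj : T.Adj x y := by
      rcases hc with rfl | rfl
      · exact absurd rfl hxc.ne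
      · exact hxc
    refine ⟨hadj, ?_⟩
    -- The condition `toward` concerns inner nodes only; at a leaf the claim holds because a leaf is
    -- inner to no path.
    rcases x with l | k
    · intro hb
      rw [hs.leaf] at hb
      rcases hG.eq_of_onPath_leaf hb with h | h
      · have := ((hs.adj_iff _ _).1 hadj).2.2.1
        rw [hs.leaf] at this
        exact this h.symm
      · obtain rfl := Sum.inl_injective h
        exact hi (hs.mem_left hadj)
    · obtain ⟨c, hc, hkc, hci⟩ := hU.toward k (Or.inl rfl)
      rcases hc with rfl | rfl
      · exact absurd rfl hkc.ne
      · exact hci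
  -- There are `d + (d - 2)` nodes in all, so the `2 * d` rounds of `search` suffice.
  have hcard2 : T.support.ncard ≤ 2 * d := by
    have h1 := Set.ncard_le_card T.support
    rw [Nat.card_eq_fintype_card, Fintype.card_sum, Fintype.card_fin, Fintype.card_fin] at h1
    omega
  refine ⟨Q, x, y, hQ, hcard.trans ?_, (key x y hxy hU').1, (key x y hxy hU').2,
    (key y x hxy.symm (Set.pair_comm x y ▸ hU')).2, fun n m data hdata => ?_⟩
  · refine mul_le_mul_of_nonneg_left (Real.log_le_log ?_ (by exact_mod_cast hcard2))
      (searchRate_pos hβ hβ').le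
    rw [hsupp]
    exact_mod_cast (by omega : 0 < N.ncard)
  · exact hit n m data hdata _ hcard2

end

section

open SimpleGraph.IsTree

variable {d : ℕ} {H : Type*} {G : SimpleGraph (Fin d ⊕ H)} {T : SimpleGraph (Node d)}
  {N : Set (Node d)} {φ : Node d → Fin d ⊕ H}

/-! ### The tree on the first four leaves -/

/-- The tree with the single edge between two leaves. -/
theorem spans_pair (G : SimpleGraph (Fin d ⊕ H)) (h : H) {p q : Fin d} (hpq : p ≠ q) :
    Spans G (SimpleGraph.fromRel fun a b : Node d => a = Sum.inl p ∧ b = Sum.inl q)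
      {Sum.inl p, Sum.inl q} (Sum.elim Sum.inl fun _ => Sum.inr h) := by
  have himg : (Sum.elim Sum.inl fun _ => Sum.inr h : Node d → Fin d ⊕ H) ''
      {Sum.inl p, Sum.inl q} = {Sum.inl p, Sum.inl q} := by
    rw [Set.image_pair]
    rfl
  -- No inner node is present yet, so the value `Sum.inr h` is only a filler.
  have hinr : ∀ k : Fin (d - 2), (Sum.inr k : Node d) ∉ ({Sum.inl p, Sum.inl q} : Set (Node d)) := by
    simp
  refine ⟨fun _ => rfl, fun k hk => absurd hk (hinr k), ?_, ?_, ?_,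
    fun k hk => absurd hk (hinr k)⟩
  · rintro _ (rfl | rfl) _ (rfl | rfl) h <;> simp_all
  · intro a b
    rw [himg, SimpleGraph.fromRel_adj]
    have key : AdjIn G {Sum.inl p, Sum.inl q} (Sum.inl p) (Sum.inl q) :=
      ⟨by simpa using hpq, fun w hw _ => by simpa using hw⟩
    constructor
    · rintro ⟨-, ⟨rfl, rfl⟩ | ⟨rfl, rfl⟩⟩
      · exact ⟨Or.inl rfl, Or.inr rfl, key⟩
      · exact ⟨Or.inr rfl, Or.inl rfl, key.symm⟩
    · rintro ⟨rfl | rfl, rfl | rfl, hadj⟩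
      · exact absurd rfl hadj.1
      · exact ⟨by simpa using hpq, Or.inl ⟨rfl, rfl⟩⟩
      · exact ⟨by simpa using hpq.symm, Or.inr ⟨rfl, rfl⟩⟩
      · exact absurd rfl hadj.1
  · rw [himg]
    rintro x (rfl | rfl) y (rfl | rfl) z (rfl | rfl)
    · exact ⟨_, Or.inl rfl, onPath_left _ _, onPath_left _ _, onPath_left _ _⟩
    · exact ⟨_, Or.inl rfl, onPath_left _ _, onPath_left _ _, onPath_left _ _⟩
    · exact ⟨_, Or.inl rfl, onPath_left _ _, onPath_left _ _, onPath_right _ _⟩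
    · exact ⟨_, Or.inr rfl, onPath_right _ _, onPath_right _ _, onPath_left _ _⟩
    · exact ⟨_, Or.inl rfl, onPath_right _ _, onPath_right _ _, onPath_left _ _⟩
    · exact ⟨_, Or.inr rfl, onPath_left _ _, onPath_left _ _, onPath_right _ _⟩
    · exact ⟨_, Or.inr rfl, onPath_left _ _, onPath_left _ _, onPath_left _ _⟩
    · exact ⟨_, Or.inr rfl, onPath_left _ _, onPath_left _ _, onPath_left _ _⟩

/-- The paths from `x` to `z` and from `y` to `w` both cross the separating edge, which is extra
length beyond the distances to its ends. -/
theorem Resolves.dist_lt (hG : IsTrivalent G) {x y z w : Fin d ⊕ H} (h : Resolves G x y z w) :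
    G.dist x y + G.dist z w < G.dist x z + G.dist y w := by
  obtain ⟨u, v, huv, hx, hy, hz, hw⟩ := h
  rw [hG.isTree.mem_side_iff huv.symm] at hx hy
  rw [hG.isTree.mem_side_iff huv] at hz hw
  have h1 := hG.isTree.dist_across huv.symm hx hz
  have h2 := hG.isTree.dist_across huv.symm hy hw
  have h3 := hG.isTree.quad x y u u
  have h4 := hG.isTree.quad z w v v
  omega

/-- The tree on four leaves arises from a single edge by joining two leaves, so `Spans.join` also
covers the start of the algorithm. -/
theorem BuildTree.joinLeaf_joinLeaf {p q k l : Fin d} (hpk : p ≠ k) (hqk : q ≠ k)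
    {x y : Fin (d - 2)} :
    joinLeaf (joinLeaf (SimpleGraph.fromRel fun a b : Node d => a = Sum.inl p ∧ b = Sum.inl q)
        {Sum.inl p, Sum.inl q} (Sum.inr x) (Sum.inl k)) {Sum.inr x, Sum.inl k} (Sum.inr y)
        (Sum.inl l) =
      SimpleGraph.fromRel fun a b : Node d =>
        (a = Sum.inr x ∧ (b = Sum.inr y ∨ b = Sum.inl p ∨ b = Sum.inl q)) ∨
          (a = Sum.inr y ∧ (b = Sum.inl k ∨ b = Sum.inl l)) := by
  ext a b
  simp only [joinLeaf, SimpleGraph.fromRel_adj, Set.mem_insert_iff, Set.mem_singleton_iff]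
  rcases a with a | a <;> rcases b with b | b <;>
    simp only [ne_eq, Sum.inl.injEq, Sum.inr.injEq, reduceCtorEq, not_false_eq_true, false_and,
      and_false, false_or, or_false, true_and] <;> grind

/-- The tree on four leaves. -/
theorem spans_quartet (hG : IsTrivalent G) (h : H) {p q k l : Fin d} (hinj : [p, q, k, l].Nodup)
    (hres : Resolves G (Sum.inl p) (Sum.inl q) (Sum.inl k) (Sum.inl l)) {x y : Fin (d - 2)}
    (hxy : x ≠ y) : ∃ φ, Spans G (SimpleGraph.fromRel fun a b : Node d =>
      (a = Sum.inr x ∧ (b = Sum.inr y ∨ b = Sum.inl p ∨ b = Sum.inl q)) ∨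
        (a = Sum.inr y ∧ (b = Sum.inl k ∨ b = Sum.inl l)))
      {Sum.inr y, Sum.inl l, Sum.inr x, Sum.inl k, Sum.inl p, Sum.inl q} φ := by
  simp only [List.nodup_cons, List.mem_cons, List.not_mem_nil, or_false, not_or,
    not_false_eq_true, List.nodup_nil, and_true] at hinj
  obtain ⟨⟨hpq, hpk, hpl⟩, ⟨hqk, hql⟩, hkl⟩ := hinj
  have s0 := spans_pair G h hpq
  have far : ∀ {i j : Fin d} {z : Fin d ⊕ H}, z ≠ Sum.inl i → i ≠ j →
      ¬OnPath G z (Sum.inl i) (Sum.inl j) := by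
    intro i j z hz hij hb
    rcases hG.eq_of_onPath_leaf hb with h | h
    · exact hz h
    · exact hij (Sum.inl_injective h).symm
  obtain ⟨φ₁, s1⟩ := s0.join hG (a := Sum.inl p) (b := Sum.inl q) (i := k) (k := x)
    (by rw [SimpleGraph.fromRel_adj]; simpa using hpq) (by simp [Ne.symm hpk, Ne.symm hqk])
    (by simp) (far (by simpa using Ne.symm hpq) hpk) (far (by simpa using hpq) hqk)
  set T₁ := BuildTree.joinLeaf (SimpleGraph.fromRel fun a b : Node d => a = Sum.inl p ∧ b = Sum.inl q)
    {Sum.inl p, Sum.inl q} (Sum.inr x) (Sum.inl k) with hT₁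
  have e : ∀ v, T₁.Adj (Sum.inr x) v ↔ v = Sum.inl p ∨ v = Sum.inl q ∨ v = Sum.inl k := by
    intro v
    rw [hT₁, BuildTree.joinLeaf, SimpleGraph.fromRel_adj]
    rcases v with v | v <;> simp [SimpleGraph.fromRel_adj, or_assoc]
  have ep := (e _).2 (Or.inl rfl)
  have eq := (e _).2 (Or.inr (Or.inl rfl))
  have ek := (e _).2 (Or.inr (Or.inr rfl))
  have b1 := s1.onPath_of_adj ep eq (by simpa using hpq)
  have b2 := s1.onPath_of_adj ep ek (by simpa using hpk)
  have b3 := s1.onPath_of_adj eq ek (by simpa using hqk)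
  rw [s1.leaf, s1.leaf] at b1 b2 b3
  obtain ⟨v, hv⟩ := s1.inner x (Or.inl rfl)
  -- The leaf `l` is on one of the three sides of the first inner node; the sides of `p` and of `q`
  -- contradict the quartet relation `hres`.
  have hside : ¬OnPath G (Sum.inl k) (φ₁ (Sum.inr x)) (Sum.inl l) := by
    rw [hv] at b1 b2 b3 ⊢
    obtain ⟨j, hj⟩ := hG.exists_not_onPath (h := v) (x := fun j => Sum.inl (![p, q, k] j))
      (by simp) (onPath_pairwise b1 b2 b3) (y := Sum.inl l) (by simp)
    have hd := hres.dist_lt hG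
    have q1 := hG.isTree.quad (Sum.inl p) (Sum.inl q) (Sum.inl k) (Sum.inl l)
    fin_cases j
    · have q2 := hG.isTree.quad (Sum.inl p) (Sum.inl k) (Sum.inl l) (Sum.inr v)
      have q3 := hG.isTree.quad (Sum.inl p) (Sum.inl q) (Sum.inl l) (Sum.inr v)
      simp only [Fin.mk_zero, Matrix.cons_val_zero, Fin.isValue] at hj
      exfalso
      unfold OnPath at *
      omega
    · have q2 := hG.isTree.quad (Sum.inl q) (Sum.inl k) (Sum.inl l) (Sum.inr v)
      have q3 := hG.isTree.quad (Sum.inl p) (Sum.inl q) (Sum.inl l) (Sum.inr v)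
      simp only [Fin.mk_one, Matrix.cons_val_one, Matrix.cons_val_zero, Fin.isValue] at hj
      exfalso
      unfold OnPath at *
      omega
    · exact not_onPath_symm hj
  obtain ⟨φ₂, s2⟩ := s1.join hG (a := Sum.inr x) (b := Sum.inl k) (i := l) (k := y) ek
    (by simp [Ne.symm hpl, Ne.symm hql, Ne.symm hkl]) (by simp [hxy.symm])
    (by rw [s1.leaf]; exact hside) (by rw [s1.leaf, hv]; exact far (by simp) hkl)
  refine ⟨φ₂, ?_⟩
  rwa [hT₁, BuildTree.joinLeaf_joinLeaf hpk hqk] at s2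

end

section

open SimpleGraph.IsTree

variable {d : ℕ} {H : Type*} {G : SimpleGraph (Fin d ⊕ H)} {T : SimpleGraph (Node d)}
  {N : Set (Node d)} {φ : Node d → Fin d ⊕ H}

/-! ### The algorithm with correct quartet tests -/

/-- Four leaves of a trivalent tree are resolved in one of the three ways. -/
theorem IsTrivalent.exists_answer (hG : IsTrivalent G) {X : Fin 4 → Fin d}
    (hX : Function.Injective X) : ∃ j, Answer G X j := by
  obtain ⟨m, h1, h2, h3⟩ := hG.isTree.exists_median (Sum.inl (X 0)) (Sum.inl (X 1))
    (Sum.inl (X 2))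
  have hne : ∀ {a b : Fin 4}, a ≠ b → (Sum.inl (X a) : Fin d ⊕ H) ≠ Sum.inl (X b) :=
    fun hab h => hab (hX (Sum.inl_injective h))
  have n0 : Sum.inl (X 0) ≠ m := by
    rintro rfl
    rcases hG.eq_of_onPath_leaf h3 with h | h
    · exact hne (by decide) h
    · exact hne (by decide) h
  have n1 : Sum.inl (X 1) ≠ m := by
    rintro rfl
    rcases hG.eq_of_onPath_leaf h2 with h | h
    · exact hne (by decide) h
    · exact hne (by decide) h
  obtain ⟨h, rfl⟩ := hG.exists_inr_of_onPath h1 n0 n1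
  obtain ⟨j, hj⟩ := hG.exists_not_onPath (h := h) (x := fun j => Sum.inl (![X 0, X 1, X 2] j))
    (by simp) (onPath_pairwise h1 h2 h3) (y := Sum.inl (X 3)) (by simp)
  replace hj := not_onPath_symm hj
  fin_cases j
  · exact ⟨2, hG.resolves hj h1 h2⟩
  · exact ⟨1, (hG.resolves hj ((onPath_comm _ _ _).1 h1) h3).symm⟩
  · exact ⟨0, (hG.resolves hj ((onPath_comm _ _ _).1 h2) ((onPath_comm _ _ _).1 h3)).symm⟩

/-- The nodes of the tree after the first `4 + t` variables have been joined. -/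
def nodesAfter (σ : Equiv.Perm (Fin d)) (t : ℕ) : Set (Node d) :=
  {x | Sum.elim (fun i => (σ.symm i : ℕ) < 4 + t) (fun k => (k : ℕ) < 2 + t) x}

theorem inl_mem_nodesAfter {σ : Equiv.Perm (Fin d)} {t : ℕ} {i : Fin d} :
    Sum.inl i ∈ nodesAfter σ t ↔ (σ.symm i : ℕ) < 4 + t := Iff.rfl

theorem inr_mem_nodesAfter {σ : Equiv.Perm (Fin d)} {t : ℕ} {k : Fin (d - 2)} :
    Sum.inr k ∈ nodesAfter σ t ↔ (k : ℕ) < 2 + t := Iff.rfl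

theorem nodesAfter_succ (σ : Equiv.Perm (Fin d)) {t : ℕ} (ht : 4 + t < d) :
    nodesAfter σ (t + 1) = insert (Sum.inr ⟨2 + t, by omega⟩)
      (insert (Sum.inl (σ ⟨4 + t, ht⟩)) (nodesAfter σ t)) := by
  ext x
  rcases x with i | k
  · simp only [Set.mem_insert_iff, inl_mem_nodesAfter, reduceCtorEq, false_or, Sum.inl.injEq]
    rw [← Equiv.symm_apply_eq, Fin.ext_iff]
    simp only
    omega
  · simp only [Set.mem_insert_iff, inr_mem_nodesAfter, reduceCtorEq, false_or, Sum.inr.injEq,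
      Fin.ext_iff]
    omega

theorem nodesAfter_zero (hd : 4 ≤ d) (σ : Equiv.Perm (Fin d)) (j : Fin 3) :
    nodesAfter σ 0 = {Sum.inr ⟨1, by omega⟩, Sum.inl (σ (Fin.castLE hd (regroup j 3))),
      Sum.inr ⟨0, by omega⟩, Sum.inl (σ (Fin.castLE hd (regroup j 2))),
      Sum.inl (σ (Fin.castLE hd (regroup j 0))), Sum.inl (σ (Fin.castLE hd (regroup j 1)))} := by
  ext x
  rcases x with i | k
  · simp only [Set.mem_insert_iff, Set.mem_singleton_iff, inl_mem_nodesAfter, reduceCtorEq,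
      false_or, Sum.inl.injEq]
    rw [← Equiv.symm_apply_eq, ← Equiv.symm_apply_eq, ← Equiv.symm_apply_eq,
      ← Equiv.symm_apply_eq]
    simp only [Fin.ext_iff, Fin.val_castLE]
    fin_cases j <;> simp [regroup] <;> omega
  · simp only [Set.mem_insert_iff, Set.mem_singleton_iff, inr_mem_nodesAfter, reduceCtorEq,
      false_or, or_false, Sum.inr.injEq, Fin.ext_iff]
    omega

theorem spans_initialTree (hG : IsTrivalent G) (h : H) (hd : 4 ≤ d) {β : ℝ} (ρ : ChoiceRule d β)
    {j : Fin 3} (hj : Answer G (fun t => ρ.order (Fin.castLE hd t)) j) :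
    ∃ φ, Spans G (BuildTree.initialTree hd ρ j) (nodesAfter ρ.order 0) φ := by
  have hinj : Function.Injective fun t => ρ.order (Fin.castLE hd t) :=
    ρ.order.injective.comp (Fin.castLE_injective hd)
  have hnd : ([regroup j 0, regroup j 1, regroup j 2, regroup j 3].map
      fun t => ρ.order (Fin.castLE hd t)).Nodup := by
    refine List.Nodup.map hinj ?_
    fin_cases j <;> decide
  obtain ⟨φ, hs⟩ := spans_quartet hG h (x := ⟨0, by omega⟩) (y := ⟨1, by omega⟩) hnd hj (by simp)
  refine ⟨φ, ?_⟩
  rw [nodesAfter_zero hd ρ.order j]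
  convert hs using 1
  refine congrArg SimpleGraph.fromRel (funext fun a => funext fun b => ?_)
  fin_cases j <;> simp [Fin.exists_fin_succ, regroup]

/-- Both `T` and `Q` come from the run with correct answers and are fixed before the data: one test
for the first four leaves, and those of one search for each further leaf. -/
theorem exists_treeAfter (hG : IsTrivalent G) (h : H) (hd : 4 ≤ d) {β : ℝ} (hβ : 1 / 2 ≤ β)
    (hβ' : β < 1) (ρ : ChoiceRule d β) (t : ℕ) (ht : 4 + t ≤ d) :
    ∃ (Q : Finset (Fin 4 → Fin d)) (T : SimpleGraph (Node d)) (φ : Node d → Fin d ⊕ H),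
      (∀ q ∈ Q, Function.Injective q) ∧
      (Q.card : ℝ) ≤ 1 + t * (searchRate β * Real.log (2 * d)) ∧
      Spans G T (nodesAfter ρ.order t) φ ∧
      ∀ (n m : ℕ) (data : Fin m → Fin d → Fin n), TestsCorrect G ρ.argmin data Q →
        BuildTree.treeAfter hd ρ data t = T := by
  classical
  induction t with
  | zero =>
    have hinj : Function.Injective fun t => ρ.order (Fin.castLE hd t) :=
      ρ.order.injective.comp (Fin.castLE_injective hd)
    obtain ⟨j, hj⟩ := hG.exists_answer hinj
    obtain ⟨φ, hs⟩ := spans_initialTree hG h hd ρ hj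
    refine ⟨{fun t => ρ.order (Fin.castLE hd t)}, _, φ, by simpa using hinj, by simp, hs,
      fun n m data hdata => ?_⟩
    rw [BuildTree.treeAfter, hdata _ (Finset.mem_singleton_self _) j hj]
  | succ t ih =>
    obtain ⟨Q, T, φ, hQ, hcard, hs, hT⟩ := ih (by omega)
    have htd : 4 + t < d := by omega
    have hi : Sum.inl (ρ.order ⟨4 + t, htd⟩) ∉ nodesAfter ρ.order t := by
      simp [inl_mem_nodesAfter]
    have hk : Sum.inr ⟨2 + t, by omega⟩ ∉ nodesAfter ρ.order t := by
      simp [inr_mem_nodesAfter]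
    have hN : 2 ≤ (nodesAfter ρ.order t).ncard := by
      have hsub : {Sum.inr ⟨0, by omega⟩, Sum.inr ⟨1, by omega⟩} ⊆ nodesAfter ρ.order t := by
        rintro x (rfl | rfl) <;> (rw [inr_mem_nodesAfter]; dsimp only; omega)
      have := Set.ncard_le_ncard hsub (Set.toFinite _)
      rwa [Set.ncard_pair (by simp)] at this
    obtain ⟨Q', a, b, hQ', hcard', hab, h1, h2, hsearch⟩ := hs.exists_search hG hi hN hβ hβ' ρ
    obtain ⟨φ', hs'⟩ := hs.join hG hab hi hk h1 h2
    refine ⟨Q ∪ Q', BuildTree.joinLeaf T {a, b} (Sum.inr ⟨2 + t, by omega⟩)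
      (Sum.inl (ρ.order ⟨4 + t, htd⟩)), φ', ?_, ?_, ?_, fun n m data hdata => ?_⟩
    · intro q hq
      rcases Finset.mem_union.1 hq with h | h
      · exact hQ q h
      · exact hQ' q h
    · have h3 : ((Q ∪ Q').card : ℝ) ≤ Q.card + Q'.card := by
        exact_mod_cast Finset.card_union_le Q Q'
      push_cast
      linarith
    · rw [nodesAfter_succ ρ.order htd]
      exact hs'
    · have e1 := hT n m data (hdata.mono Finset.subset_union_left)
      have e2 := hsearch n m data (hdata.mono Finset.subset_union_right)
      simp only [BuildTree.treeAfter, htd, dif_pos, e1, e2]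

/-! ### Identification of the topology -/

/-- There are leaves in the direction of every neighbour of a vertex. -/
theorem IsTrivalent.exists_leaf_toward (hG : IsTrivalent G) [Finite H] {v c : Fin d ⊕ H}
    (hc : G.Adj v c) : ∃ l, G.dist (Sum.inl l) v = G.dist (Sum.inl l) c + 1 := by
  -- A vertex in this direction farthest from `v` is a leaf: an inner node has a further neighbour,
  -- different from the one towards `v`, which is still farther away.
  obtain ⟨w, hw, hmax⟩ := Set.exists_max_image {w | G.dist w v = G.dist w c + 1}
    (fun w => G.dist w v) (Set.toFinite _) ⟨c, by simp [SimpleGraph.dist_eq_one_iff_adj.2 hc.symm]⟩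
  rw [Set.mem_ofPred_eq] at hw
  rcases w with l | h
  · exact ⟨l, hw⟩
  exfalso
  have hne : (Sum.inr h : Fin d ⊕ H) ≠ v := by
    rintro rfl
    simp at hw
  obtain ⟨e, he, hd⟩ := hG.isTree.exists_adj_toward hne
  obtain ⟨x, hx, hxe⟩ := Set.exists_ne_of_one_lt_ncard
    (by rw [hG.ncard_inner h]; norm_num : 1 < (G.neighborSet (Sum.inr h)).ncard) e
  have hx' : G.Adj (Sum.inr h) x := hx
  have q := hG.isTree.quad v (Sum.inr h) e x
  have a1 := SimpleGraph.dist_eq_one_iff_adj.2 he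
  have a2 := SimpleGraph.dist_eq_one_iff_adj.2 hx'
  have a3 := hG.isTree.dist_pos hxe
  rcases hG.isTree.dist_eq_or hx' v with h1 | h1
  · omega
  · have hxv : G.dist x v = G.dist x c + 1 := by
      have q' := hG.isTree.quad v (Sum.inr h) c x
      have a4 := SimpleGraph.dist_eq_one_iff_adj.2 hc
      rcases hG.isTree.dist_eq_or hc x with h2 | h2 <;> omega
    have := hmax x hxv
    omega

/-- A hidden vertex is the median of three leaves, one in each of its directions. The image contains
all leaves and is median closed. -/
theorem Spans.surjective (hG : IsTrivalent G) [Finite H] (hs : Spans G T Set.univ φ) :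
    Function.Surjective φ := by
  rintro (i | h)
  · exact ⟨_, hs.leaf i⟩
  obtain ⟨x, y, z, hxy, hxz, hyz, hset⟩ := Set.ncard_eq_three.1 (hG.ncard_inner h)
  have hx : G.Adj (Sum.inr h) x := by
    change x ∈ G.neighborSet _
    simp [hset]
  have hy : G.Adj (Sum.inr h) y := by
    change y ∈ G.neighborSet _
    simp [hset]
  have hz : G.Adj (Sum.inr h) z := by
    change z ∈ G.neighborSet _
    simp [hset]
  have sep : ∀ {x y : Fin d ⊕ H} {l l' : Fin d}, G.Adj (Sum.inr h) x → G.Adj (Sum.inr h) y →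
      x ≠ y → G.dist (Sum.inl l) (Sum.inr h) = G.dist (Sum.inl l) x + 1 →
      G.dist (Sum.inl l') (Sum.inr h) = G.dist (Sum.inl l') y + 1 →
      OnPath G (Sum.inl l) (Sum.inr h) (Sum.inl l') := by
    intro x y l l' hx hy hxy h1 h2
    have a1 := SimpleGraph.dist_eq_one_iff_adj.2 hx
    have a2 := SimpleGraph.dist_eq_one_iff_adj.2 hy
    have a3 := hG.isTree.dist_pos hxy
    have q1 := hG.isTree.quad (Sum.inr h) x y (Sum.inl l)
    have q2 := hG.isTree.quad (Sum.inr h) x y (Sum.inl l')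
    rcases hG.isTree.dist_eq_or hx (Sum.inl l') with h3 | h3
    · omega
    · have := hG.isTree.dist_across hx h1 h3
      unfold OnPath
      omega
  obtain ⟨lx, hlx⟩ := hG.exists_leaf_toward hx
  obtain ⟨ly, hly⟩ := hG.exists_leaf_toward hy
  obtain ⟨lz, hlz⟩ := hG.exists_leaf_toward hz
  have mem : ∀ l : Fin d, Sum.inl l ∈ φ '' Set.univ := fun l => ⟨Sum.inl l, trivial, hs.leaf l⟩
  obtain ⟨_, ⟨k, -, rfl⟩, m1, m2, m3⟩ := hs.closed _ (mem lx) _ (mem ly) _ (mem lz)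
  refine ⟨k, hG.isTree.eq_of_dist ?_⟩
  have s1 := sep hx hy hxy hlx hly
  have s2 := sep hx hz hxz hlx hlz
  have s3 := sep hy hz hyz hly hlz
  have q1 := hG.isTree.quad (Sum.inl lx) (Sum.inl ly) (φ k) (Sum.inr h)
  have q2 := hG.isTree.quad (Sum.inl lx) (Sum.inl lz) (φ k) (Sum.inr h)
  have q3 := hG.isTree.quad (Sum.inl ly) (Sum.inl lz) (φ k) (Sum.inr h)
  unfold OnPath at *
  omega

/-- The tree spanned by all nodes is the given one. -/
theorem Spans.sameTopology (hG : IsTrivalent G) [Finite H] (hs : Spans G T Set.univ φ) :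
    SameTopology T G := by
  have hsurj := hs.surjective hG
  have hbij : Function.Bijective φ := ⟨Set.injOn_univ.1 hs.injOn, hsurj⟩
  refine ⟨⟨Equiv.ofBijective φ hbij, ?_⟩, fun i => hs.leaf i⟩
  intro a b
  rw [Equiv.ofBijective_apply, Equiv.ofBijective_apply, hs.adj_iff, Set.image_univ,
    hsurj.range_eq]
  simp only [Set.mem_univ, true_and]
  constructor
  · intro hadj
    refine ⟨hadj.ne, fun w _ hb => ?_⟩
    have h1 := SimpleGraph.dist_eq_one_iff_adj.2 hadj
    unfold OnPath at hb
    rcases Nat.eq_zero_or_pos (G.dist (φ a) w) with h | h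
    · exact Or.inl (hG.isTree.eq_of_dist h).symm
    · exact Or.inr (hG.isTree.eq_of_dist (by omega))
  · rintro ⟨hne, hw⟩
    -- The first vertex after `φ a` lies on the path to `φ b`, so it must be `φ b`.
    obtain ⟨c, hc, hd⟩ := hG.isTree.exists_adj_toward hne
    have q := hG.isTree.quad (φ a) (φ b) c c
    have h1 := SimpleGraph.dist_eq_one_iff_adj.2 hc
    rcases hw c trivial (by unfold OnPath; omega) with rfl | rfl
    · exact absurd rfl hc.ne
    · exact hc

/-- If some `O(d log d)` quartet tests are answered correctly, the algorithm recovers the tree. -/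
theorem exists_tests (hG : IsTrivalent G) [Finite H] [Nonempty H] (hd : 4 ≤ d) {β : ℝ}
    (hβ : 1 / 2 ≤ β) (hβ' : β < 1) (ρ : ChoiceRule d β) :
    ∃ Q : Finset (Fin 4 → Fin d), (∀ q ∈ Q, Function.Injective q) ∧
      (Q.card : ℝ) ≤ (1 + 2 * searchRate β) * (d * Real.log d) ∧
      ∀ (n m : ℕ) (data : Fin m → Fin d → Fin n), TestsCorrect G ρ.argmin data Q →
        SameTopology (BuildTree.output hd ρ data) G := by
  obtain ⟨Q, T, φ, hQ, hcard, hs, hT⟩ :=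
    exists_treeAfter hG (Classical.arbitrary H) hd hβ hβ' ρ (d - 4) (by omega)
  refine ⟨Q, hQ, hcard.trans ?_, fun n m data hdata => ?_⟩
  -- The first test is absorbed by `1 ≤ d log d`, and `log (2 d) ≤ 2 log d` yields the factor 2.
  · have hd' : (4 : ℝ) ≤ d := by exact_mod_cast hd
    have hK := searchRate_pos hβ hβ'
    have hlog2 : Real.log 2 ≤ Real.log d := Real.log_le_log (by norm_num) (by linarith)
    have hlog4 : 1 ≤ Real.log d := by
      have h4 : Real.log 4 ≤ Real.log d := Real.log_le_log (by norm_num) hd'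
      have h5 : Real.log 4 = 2 * Real.log 2 := by
        rw [show (4 : ℝ) = 2 ^ 2 by norm_num, Real.log_pow]
        norm_num
      have := Real.log_two_gt_d9
      linarith
    rw [Real.log_mul (by norm_num) (by linarith), Nat.cast_sub hd]
    have h1 : (1 : ℝ) ≤ d * Real.log d := by nlinarith
    have h2 : ((d : ℝ) - (4 : ℕ)) * (searchRate β * (Real.log 2 + Real.log d)) ≤
        d * (searchRate β * (2 * Real.log d)) := by
      have h0 : 0 ≤ Real.log 2 := Real.log_nonneg (by norm_num)
      refine mul_le_mul ?_ ?_ (by positivity) (by positivity)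
      · push_cast
        linarith
      · exact mul_le_mul_of_nonneg_left (by linarith) hK.le
    nlinarith
  · rw [BuildTree.output, hT n m data hdata]
    have huniv : nodesAfter ρ.order (d - 4) = Set.univ := by
      ext x
      rcases x with i | k
      · simp only [inl_mem_nodesAfter, Set.mem_univ, iff_true]
        have := (ρ.order.symm i).isLt
        omega
      · simp only [inr_mem_nodesAfter, Set.mem_univ, iff_true]
        have := k.isLt
        omega
    rw [huniv] at hs
    exact hs.sameTopology hG

end

/-! ### Duality for the nuclear norm -/

section

open scoped InnerProductSpace

variable {E F : Type*} [NormedAddCommGroup E] [InnerProductSpace ℝ E] [FiniteDimensional ℝ E]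
  [NormedAddCommGroup F] [InnerProductSpace ℝ F] [FiniteDimensional ℝ F]

/-- An orthonormal basis of right singular vectors. -/
theorem LinearMap.exists_singular_basis (T : E →ₗ[ℝ] F) :
    ∃ b : OrthonormalBasis (Fin (Module.finrank ℝ E)) ℝ E,
      (∀ i j, i ≠ j → ⟪T (b i), T (b j)⟫_ℝ = 0) ∧
      (T.singularValues.sum fun _ s => s) = ∑ i, ‖T (b i)‖ := by
  have hsym := T.isSymmetric_adjoint_comp_self
  -- On an orthonormal eigenbasis of `T* T` the images `T (b i)` are orthogonal, and their norms are
  -- the singular values.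
  set b := hsym.eigenvectorBasis rfl with hb
  have key : ∀ i j, ⟪T (b i), T (b j)⟫_ℝ = hsym.eigenvalues rfl j * ⟪b i, b j⟫_ℝ := by
    intro i j
    have h1 := hsym.apply_eigenvectorBasis rfl j
    rw [LinearMap.comp_apply] at h1
    rw [← LinearMap.adjoint_inner_right, hb, h1, inner_smul_right]
    rfl
  refine ⟨b, fun i j hij => ?_, ?_⟩
  · rw [key, b.orthonormal.2 hij, mul_zero]
  · rw [Finsupp.sum_of_support_subset (s := Finset.range (Module.finrank ℝ E)) _ ?_ _ (by simp),
      Finset.sum_range]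
    · refine Finset.sum_congr rfl fun i _ => ?_
      rw [T.singularValues_fin rfl i]
      have h2 := key i i
      rw [real_inner_self_eq_norm_sq, real_inner_self_eq_norm_sq, b.orthonormal.1, one_pow,
        mul_one] at h2
      rw [← h2, Real.sqrt_sq (norm_nonneg _)]
    · intro i hi
      rw [Finset.mem_range]
      by_contra hcon
      exact (Finsupp.mem_support_iff.1 hi) (T.singularValues_of_finrank_le (not_lt.1 hcon))

theorem LinearMap.trace_adjoint_comp (W T : E →ₗ[ℝ] F) {ι : Type*} [Fintype ι]
    (b : OrthonormalBasis ι ℝ E) :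
    LinearMap.trace ℝ E (LinearMap.adjoint W ∘ₗ T) = ∑ i, ⟪W (b i), T (b i)⟫_ℝ := by
  rw [LinearMap.trace_eq_sum_inner _ b]
  refine Finset.sum_congr rfl fun i _ => ?_
  rw [LinearMap.comp_apply, LinearMap.adjoint_inner_right]

/-- Compute the trace in a basis of singular vectors and use `⟪W b, T b⟫ ≤ ‖T b‖` for each of them.
-/
theorem LinearMap.trace_adjoint_comp_le (W T : E →ₗ[ℝ] F) (hW : ∀ x, ‖W x‖ ≤ ‖x‖) :
    LinearMap.trace ℝ E (LinearMap.adjoint W ∘ₗ T) ≤ T.singularValues.sum fun _ s => s := by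
  obtain ⟨b, -, hb⟩ := T.exists_singular_basis
  rw [LinearMap.trace_adjoint_comp W T b, hb]
  refine Finset.sum_le_sum fun i _ => (real_inner_le_norm _ _).trans ?_
  have := hW (b i)
  rw [b.orthonormal.1] at this
  nlinarith [norm_nonneg (T (b i))]

theorem LinearMap.exists_trace_adjoint_comp_eq (T : E →ₗ[ℝ] F) :
    ∃ W : E →ₗ[ℝ] F, (∀ x, ‖W x‖ ≤ ‖x‖) ∧
      LinearMap.trace ℝ E (LinearMap.adjoint W ∘ₗ T) = T.singularValues.sum fun _ s => s := by
  obtain ⟨b, hort, hb⟩ := T.exists_singular_basis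
  -- The optimal `W` is the partial isometry of the polar decomposition; it vanishes where `T (b i)
  -- = 0`, since `0⁻¹ = 0`.
  set w : Fin (Module.finrank ℝ E) → F := fun i => ‖T (b i)‖⁻¹ • T (b i) with hw
  refine ⟨b.toBasis.constr ℝ w, fun x => ?_, ?_⟩
  · have h1 : b.toBasis.constr ℝ w x = ∑ i, ⟪b i, x⟫_ℝ • w i := by
      rw [Module.Basis.constr_apply_fintype]
      refine Finset.sum_congr rfl fun i _ => ?_
      rw [Module.Basis.equivFun_apply, b.coe_toBasis_repr_apply, b.repr_apply_apply]
    have h2 : ‖∑ i, ⟪b i, x⟫_ℝ • w i‖ ^ 2 = ∑ i, ‖⟪b i, x⟫_ℝ • w i‖ ^ 2 := by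
      rw [← real_inner_self_eq_norm_sq, sum_inner]
      refine Finset.sum_congr rfl fun i _ => ?_
      rw [inner_sum, Finset.sum_eq_single i, real_inner_self_eq_norm_sq]
      · intro j _ hj
        simp only [hw, inner_smul_left, inner_smul_right, hort i j hj.symm, mul_zero]
      · simp
    have h3 : ∑ i, ‖⟪b i, x⟫_ℝ • w i‖ ^ 2 ≤ ∑ i, ‖⟪b i, x⟫_ℝ‖ ^ 2 := by
      refine Finset.sum_le_sum fun i _ => ?_
      rw [norm_smul, mul_pow]
      refine mul_le_of_le_one_right (sq_nonneg _) ?_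
      rw [hw]
      simp only [norm_smul, norm_inv, norm_norm]
      by_cases h : ‖T (b i)‖ = 0
      · simp [h]
      · rw [inv_mul_cancel₀ h, one_pow]
    rw [b.sum_sq_norm_inner_right] at h3
    rw [h1]
    exact le_of_sq_le_sq (h2.trans_le h3) (norm_nonneg _)
  · rw [LinearMap.trace_adjoint_comp _ T b, hb]
    refine Finset.sum_congr rfl fun i _ => ?_
    have : b.toBasis.constr ℝ w (b i) = w i := by
      rw [← b.coe_toBasis, Module.Basis.constr_basis]
    rw [this, hw]
    simp only [inner_smul_left, real_inner_self_eq_norm_sq, conj_trivial]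
    by_cases h : ‖T (b i)‖ = 0
    · simp [h]
    · field_simp

end

/-! ### The nuclear norm of matrices -/

section

variable {ι κ : Type*} [Fintype ι] [Fintype κ]

/-- A matrix whose operator norm is at most one. -/
def IsContraction (W : Matrix ι κ ℝ) : Prop :=
  ∀ x : κ → ℝ, ∑ r, (∑ s, W r s * x s) ^ 2 ≤ ∑ s, x s ^ 2

theorem IsContraction.neg {W : Matrix ι κ ℝ} (hW : IsContraction W) : IsContraction (-W) := by
  intro x
  simpa [Finset.sum_neg_distrib] using hW x

theorem isContraction_iff [DecidableEq κ] (W : Matrix ι κ ℝ) :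
    IsContraction W ↔ ∀ x, ‖Matrix.toEuclideanLin W x‖ ≤ ‖x‖ := by
  have key : ∀ x : EuclideanSpace ℝ κ, ‖Matrix.toEuclideanLin W x‖ ≤ ‖x‖ ↔
      ∑ r, (∑ s, W r s * x s) ^ 2 ≤ ∑ s, x s ^ 2 := by
    intro x
    rw [← sq_le_sq₀ (norm_nonneg _) (norm_nonneg _), EuclideanSpace.real_norm_sq_eq,
      EuclideanSpace.real_norm_sq_eq]
    simp [Matrix.toLpLin_apply, Matrix.mulVec, dotProduct]
  refine ⟨fun h x => (key x).2 (h x), fun h x => ?_⟩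
  simpa using (key (WithLp.toLp 2 x)).1 (h _)

theorem trace_toEuclideanLin [DecidableEq κ] (W M : Matrix ι κ ℝ) :
    LinearMap.trace ℝ _ (LinearMap.adjoint (Matrix.toEuclideanLin W) ∘ₗ Matrix.toEuclideanLin M) =
      ∑ r, ∑ s, W r s * M r s := by
  rw [LinearMap.trace_adjoint_comp _ _ (EuclideanSpace.basisFun κ ℝ), Finset.sum_comm]
  refine Finset.sum_congr rfl fun s _ => ?_
  simp [Matrix.toLpLin_apply, PiLp.inner_apply, mul_comm]

variable [DecidableEq ι] [DecidableEq κ]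

/-- Together with `exists_sum_mul_eq_nuclearNorm` this makes the nuclear norm a maximum of linear
functionals over contractions; all its properties below are derived from that. -/
theorem sum_mul_le_nuclearNorm {W : Matrix ι κ ℝ} (hW : IsContraction W) (M : Matrix ι κ ℝ) :
    ∑ r, ∑ s, W r s * M r s ≤ nuclearNorm M := by
  rw [← trace_toEuclideanLin]
  exact LinearMap.trace_adjoint_comp_le _ _ ((isContraction_iff W).1 hW)

theorem exists_sum_mul_eq_nuclearNorm (M : Matrix ι κ ℝ) :
    ∃ W : Matrix ι κ ℝ, IsContraction W ∧ ∑ r, ∑ s, W r s * M r s = nuclearNorm M := by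
  obtain ⟨W, hW, h⟩ := LinearMap.exists_trace_adjoint_comp_eq (Matrix.toEuclideanLin M)
  have hWe : Matrix.toEuclideanLin (Matrix.toEuclideanLin.symm W) = W :=
    LinearEquiv.apply_symm_apply _ _
  refine ⟨Matrix.toEuclideanLin.symm W, (isContraction_iff _).2 (by rwa [hWe]), ?_⟩
  rw [← trace_toEuclideanLin, hWe]
  exact h

theorem nuclearNorm_add_le (M M' : Matrix ι κ ℝ) :
    nuclearNorm (M + M') ≤ nuclearNorm M + nuclearNorm M' := by
  obtain ⟨W, hW, h⟩ := exists_sum_mul_eq_nuclearNorm (M + M')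
  rw [← h]
  simp only [Matrix.add_apply, mul_add, Finset.sum_add_distrib]
  exact add_le_add (sum_mul_le_nuclearNorm hW M) (sum_mul_le_nuclearNorm hW M')

theorem abs_sum_mul_le_nuclearNorm {W : Matrix ι κ ℝ} (hW : IsContraction W) (M : Matrix ι κ ℝ) :
    |∑ r, ∑ s, W r s * M r s| ≤ nuclearNorm M := by
  rw [abs_le']
  refine ⟨sum_mul_le_nuclearNorm hW M, ?_⟩
  have := sum_mul_le_nuclearNorm hW.neg M
  simpa [Finset.sum_neg_distrib] using this

theorem nuclearNorm_smul_le (c : ℝ) (M : Matrix ι κ ℝ) :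
    nuclearNorm (c • M) ≤ |c| * nuclearNorm M := by
  obtain ⟨W, hW, h⟩ := exists_sum_mul_eq_nuclearNorm (c • M)
  have h1 : ∑ r, ∑ s, W r s * (c • M) r s = c * ∑ r, ∑ s, W r s * M r s := by
    simp only [Finset.mul_sum, Matrix.smul_apply, smul_eq_mul]
    refine Finset.sum_congr rfl fun r _ => Finset.sum_congr rfl fun s _ => by ring
  rw [← h, h1]
  refine (le_abs_self _).trans ?_
  rw [abs_mul]
  exact mul_le_mul_of_nonneg_left (abs_sum_mul_le_nuclearNorm hW M) (abs_nonneg _)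

theorem nuclearNorm_zero : nuclearNorm (0 : Matrix ι κ ℝ) = 0 := by
  obtain ⟨W, -, h⟩ := exists_sum_mul_eq_nuclearNorm (0 : Matrix ι κ ℝ)
  simpa using h.symm

theorem nuclearNorm_sum_le {α : Type*} (s : Finset α) (M : α → Matrix ι κ ℝ) :
    nuclearNorm (∑ a ∈ s, M a) ≤ ∑ a ∈ s, nuclearNorm (M a) := by
  classical
  induction s using Finset.induction_on with
  | empty => simp [nuclearNorm_zero]
  | insert a s ha ih =>
    rw [Finset.sum_insert ha, Finset.sum_insert ha]
    exact (nuclearNorm_add_le _ _).trans (by gcongr)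

theorem nuclearNorm_sub_le (M M' : Matrix ι κ ℝ) :
    nuclearNorm M - nuclearNorm M' ≤ nuclearNorm (M - M') := by
  have := nuclearNorm_add_le (M - M') M'
  rw [sub_add_cancel] at this
  linarith

theorem nuclearNorm_sub_comm (M M' : Matrix ι κ ℝ) :
    nuclearNorm (M - M') = nuclearNorm (M' - M) := by
  have key : ∀ M M' : Matrix ι κ ℝ, nuclearNorm (M - M') ≤ nuclearNorm (M' - M) := by
    intro M M'
    have := nuclearNorm_smul_le (-1) (M' - M)
    simpa using this
  exact le_antisymm (key _ _) (key _ _)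

theorem abs_nuclearNorm_sub_le (M M' : Matrix ι κ ℝ) :
    |nuclearNorm M - nuclearNorm M'| ≤ nuclearNorm (M - M') := by
  rw [abs_le']
  refine ⟨nuclearNorm_sub_le _ _, ?_⟩
  rw [neg_sub, nuclearNorm_sub_comm]
  exact nuclearNorm_sub_le _ _

/-- The nuclear norm of a matrix of rank one. -/
theorem nuclearNorm_vecMulVec_le (u : ι → ℝ) (v : κ → ℝ) :
    nuclearNorm (Matrix.vecMulVec u v) ≤ √(∑ r, u r ^ 2) * √(∑ s, v s ^ 2) := by
  obtain ⟨W, hW, h⟩ := exists_sum_mul_eq_nuclearNorm (Matrix.vecMulVec u v)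
  have h1 : ∑ r, ∑ s, W r s * Matrix.vecMulVec u v r s = ∑ r, u r * ∑ s, W r s * v s := by
    simp only [Matrix.vecMulVec_apply, Finset.mul_sum]
    refine Finset.sum_congr rfl fun r _ => Finset.sum_congr rfl fun s _ => by ring
  rw [← h, h1]
  refine (Real.sum_mul_le_sqrt_mul_sqrt _ _ _).trans ?_
  gcongr
  exact hW v

/-- The columns of a contraction have length at most 1, which bounds its Frobenius norm by the root
of their number; then apply Cauchy–Schwarz. For an unfolding the factor is `√(n²) = n`. -/
theorem nuclearNorm_le_sqrt_card_mul_frobNorm (M : Matrix ι κ ℝ) :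
    nuclearNorm M ≤ √(Fintype.card κ) * frobNorm M := by
  obtain ⟨W, hW, h⟩ := exists_sum_mul_eq_nuclearNorm M
  have hcol : ∀ s, ∑ r, W r s ^ 2 ≤ 1 := by
    intro s
    simpa [Pi.single_apply] using hW (Pi.single s 1)
  have h1 : ∑ p : ι × κ, W p.1 p.2 ^ 2 ≤ Fintype.card κ := by
    rw [Fintype.sum_prod_type_right]
    calc _ ≤ ∑ _s : κ, (1 : ℝ) := Finset.sum_le_sum fun s _ => hcol s
      _ = _ := by simp
  rw [← h, frobNorm, ← Fintype.sum_prod_type' (f := fun r s => W r s * M r s),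
    ← Fintype.sum_prod_type' (f := fun r s => M r s ^ 2)]
  refine (Real.sum_mul_le_sqrt_mul_sqrt _ _ _).trans ?_
  gcongr

theorem nuclearNorm_submatrix_le {ι' κ' : Type*} [Fintype ι'] [DecidableEq ι'] [Fintype κ']
    [DecidableEq κ'] (M : Matrix ι κ ℝ) (e : ι' ≃ ι) (f : κ' ≃ κ) :
    nuclearNorm (M.submatrix e f) ≤ nuclearNorm M := by
  obtain ⟨W, hW, h⟩ := exists_sum_mul_eq_nuclearNorm (M.submatrix e f)
  have hW' : IsContraction (W.submatrix e.symm f.symm) := by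
    intro x
    have := hW (x ∘ f)
    simp only [Function.comp_apply] at this
    rw [← Equiv.sum_comp e, ← Equiv.sum_comp f (fun s => x s ^ 2)]
    convert this using 3 with r _
    rw [← Equiv.sum_comp f]
    simp
  rw [← h]
  refine le_trans (le_of_eq ?_) (sum_mul_le_nuclearNorm hW' M)
  rw [← Equiv.sum_comp e]
  refine Finset.sum_congr rfl fun r _ => ?_
  rw [← Equiv.sum_comp f]
  simp

theorem nuclearNorm_submatrix {ι' κ' : Type*} [Fintype ι'] [DecidableEq ι'] [Fintype κ']
    [DecidableEq κ'] (M : Matrix ι κ ℝ) (e : ι' ≃ ι) (f : κ' ≃ κ) :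
    nuclearNorm (M.submatrix e f) = nuclearNorm M := by
  refine le_antisymm (nuclearNorm_submatrix_le M e f) ?_
  have := nuclearNorm_submatrix_le (M.submatrix e f) e.symm f.symm
  simpa using this

end

/-! ### Conditional independence in latent tree models -/

namespace LatentTreeModel

variable {d n k : ℕ} {H : Type*}

variable (n k H) in
/-- The indicator of the event that the observed variable `i` has the value `x`. -/
def obsInd (i : Fin d) (x : Fin n) (ω : (Fin d → Fin n) × (H → Fin k)) : ℝ :=
  if ω.1 i = x then 1 else 0

variable (d n) in
/-- The indicator of the event that the hidden variable `h` has the value `s`. -/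
def hidInd (h : H) (s : Fin k) (ω : (Fin d → Fin n) × (H → Fin k)) : ℝ :=
  if ω.2 h = s then 1 else 0

open Classical in
/-- The values of `ω'` on `S` and of `ω` elsewhere. -/
noncomputable def mix (S : Set (Fin d ⊕ H)) (ω ω' : (Fin d → Fin n) × (H → Fin k)) :
    (Fin d → Fin n) × (H → Fin k) :=
  (fun i => if Sum.inl i ∈ S then ω'.1 i else ω.1 i,
    fun h => if Sum.inr h ∈ S then ω'.2 h else ω.2 h)

theorem mix_mix (S : Set (Fin d ⊕ H)) (ω ω' : (Fin d → Fin n) × (H → Fin k)) :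
    mix S (mix S ω ω') (mix S ω' ω) = ω := by
  unfold mix
  refine Prod.ext (funext fun i => ?_) (funext fun h => ?_)
  · by_cases hi : Sum.inl i ∈ S <;> simp [hi]
  · by_cases hi : Sum.inr h ∈ S <;> simp [hi]

/-- `f` does not depend on the variables in `S`. -/
def IndependentOf (S : Set (Fin d ⊕ H)) (f : (Fin d → Fin n) × (H → Fin k) → ℝ) : Prop :=
  ∀ ω ω', f (mix S ω ω') = f ω

/-- `f` depends only on the variables in `S`. -/
def DependsOn (S : Set (Fin d ⊕ H)) (f : (Fin d → Fin n) × (H → Fin k) → ℝ) : Prop :=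
  ∀ ω ω', f (mix S ω ω') = f ω'

theorem IndependentOf.mul {S : Set (Fin d ⊕ H)} {f g : (Fin d → Fin n) × (H → Fin k) → ℝ}
    (hf : IndependentOf S f) (hg : IndependentOf S g) : IndependentOf S fun ω => f ω * g ω :=
  fun ω ω' => by simp only [hf ω ω', hg ω ω']

theorem independentOf_one (S : Set (Fin d ⊕ H)) :
    IndependentOf (n := n) (k := k) S fun _ => 1 := fun _ _ => rfl

theorem independentOf_obsInd {S : Set (Fin d ⊕ H)} {i : Fin d} (hi : Sum.inl i ∉ S) (x : Fin n) :
    IndependentOf S (obsInd n k H i x) := fun ω ω' => by simp [obsInd, mix, hi]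

theorem independentOf_hidInd {S : Set (Fin d ⊕ H)} {h : H} (hh : Sum.inr h ∉ S) (s : Fin k) :
    IndependentOf S (hidInd d n h s) := fun ω ω' => by simp [hidInd, mix, hh]

theorem dependsOn_obsInd {S : Set (Fin d ⊕ H)} {i : Fin d} (hi : Sum.inl i ∈ S) (x : Fin n) :
    DependsOn S (obsInd n k H i x) := fun ω ω' => by simp [obsInd, mix, hi]

theorem dependsOn_hidInd {S : Set (Fin d ⊕ H)} {h : H} (hh : Sum.inr h ∈ S) (s : Fin k) :
    DependsOn S (hidInd d n h s) := fun ω ω' => by simp [hidInd, mix, hh]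

variable [Fintype H] (M : LatentTreeModel d n k H)

open Classical in
/-- The expectation of a function of all variables. -/
noncomputable def expect (f : (Fin d → Fin n) × (H → Fin k) → ℝ) : ℝ :=
  ∑ ω, M.joint ω.1 ω.2 * f ω

/-- `S` is a union of connected components of the tree without the node `h`. -/
def IsBranch (S : Set (Fin d ⊕ H)) (h : H) : Prop :=
  Sum.inr h ∉ S ∧ ∀ v w, M.tree.Adj v w → v ≠ Sum.inr h → w ≠ Sum.inr h → (v ∈ S ↔ w ∈ S)

variable {M}

theorem joint_nonneg (x : Fin d → Fin n) (z : H → Fin k) : 0 ≤ M.joint x z := by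
  unfold joint
  refine mul_nonneg (Finset.prod_nonneg fun i _ => M.cptObs_nonneg _ _ _)
    (Finset.prod_nonneg fun h _ => ?_)
  split_ifs with hr
  · exact M.prior_nonneg _
  · exact M.cptHid_nonneg h hr _ _

/-- Exchanging the values on a branch at `h` between two assignments with the same value at `h`. -/
theorem joint_mix_mul {S : Set (Fin d ⊕ H)} {h : H} (hS : M.IsBranch S h)
    {ω ω' : (Fin d → Fin n) × (H → Fin k)} (he : ω.2 h = ω'.2 h) :
    M.joint (mix S ω ω').1 (mix S ω ω').2 * M.joint (mix S ω' ω).1 (mix S ω' ω).2 =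
      M.joint ω.1 ω.2 * M.joint ω'.1 ω'.2 := by
  classical
  obtain ⟨hh, hS⟩ := hS
  unfold joint
  rw [mul_mul_mul_comm, mul_mul_mul_comm (∏ i, M.cptObs i (ω.1 i) _), ← Finset.prod_mul_distrib,
    ← Finset.prod_mul_distrib, ← Finset.prod_mul_distrib, ← Finset.prod_mul_distrib]
  congr 1
  -- Each factor involves a node and its parent. If neither is `h`, both lie in `S` or both outside,
  -- so at most the factors of `ω` and `ω'` are exchanged; at `h` the two assignments agree.
  · refine Finset.prod_congr rfl fun i _ => ?_
    have hadj := M.parent_adj (Sum.inl i) (by simp)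
    simp only [mix]
    generalize M.parent (Sum.inl i) = p at hadj ⊢
    by_cases hp : p = h
    · subst hp
      by_cases hi : Sum.inl i ∈ S <;> simp [hi, hh, he, mul_comm]
    · have := hS _ _ hadj (by simp) (by simpa using hp)
      by_cases hi : Sum.inl i ∈ S
      · simp [hi, this.1 hi, mul_comm]
      · have hp' : Sum.inr p ∉ S := fun h => hi (this.2 h)
        simp [hi, hp']
  · refine Finset.prod_congr rfl fun g _ => ?_
    by_cases hg : g = M.root
    · subst hg
      simp only [if_true, mix]
      by_cases hi : Sum.inr M.root ∈ S <;> simp [hi, mul_comm]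
    · have hadj := M.parent_adj (Sum.inr g) (by simpa using hg)
      simp only [mix, if_neg hg]
      generalize M.parent (Sum.inr g) = p at hadj ⊢
      by_cases hp : p = h
      · subst hp
        by_cases hi : Sum.inr g ∈ S <;> simp [hi, hh, he, mul_comm]
      · by_cases hgh : g = h
        · subst hgh
          by_cases hi : Sum.inr p ∈ S <;> simp [hi, hh, he, mul_comm]
        · have := hS _ _ hadj (by simpa using hgh) (by simpa using hp)
          by_cases hi : Sum.inr g ∈ S
          · simp [hi, this.1 hi, mul_comm]
          · have hp' : Sum.inr p ∉ S := fun h => hi (this.2 h)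
            simp [hi, hp']

variable (M)

/-- Given `h`, the variables on a branch at `h` are independent of the other ones. -/
theorem expect_mul_expect {S : Set (Fin d ⊕ H)} {h : H} (hS : M.IsBranch S h) (s : Fin k)
    {f g : (Fin d → Fin n) × (H → Fin k) → ℝ} (hf : DependsOn S f) (hg : IndependentOf S g) :
    M.expect (fun ω => f ω * g ω * hidInd d n h s ω) * M.expect (hidInd d n h s) =
      M.expect (fun ω => f ω * hidInd d n h s ω) * M.expect (fun ω => g ω * hidInd d n h s ω) := by
  classical
  have hind := independentOf_hidInd (n := n) hS.1 s
  unfold expect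
  rw [Finset.sum_mul_sum, mul_comm, Finset.sum_mul_sum, ← Fintype.sum_prod_type',
    ← Fintype.sum_prod_type']
  -- Both sides are sums over pairs of assignments; exchanging the values on `S` within a pair is an
  -- involution that matches the terms.
  let σ : (((Fin d → Fin n) × (H → Fin k)) × ((Fin d → Fin n) × (H → Fin k))) ≃
      (((Fin d → Fin n) × (H → Fin k)) × ((Fin d → Fin n) × (H → Fin k))) :=
    ⟨fun p => (mix S p.1 p.2, mix S p.2 p.1), fun p => (mix S p.1 p.2, mix S p.2 p.1),
      fun p => by simp [mix_mix], fun p => by simp [mix_mix]⟩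
  rw [← Equiv.sum_comp σ]
  refine Finset.sum_congr rfl fun p _ => ?_
  obtain ⟨ω, ω'⟩ := p
  simp only [σ, Equiv.coe_fn_mk, hf ω ω', hg ω ω', hind ω ω', hind ω' ω]
  by_cases h1 : ω.2 h = s
  · by_cases h2 : ω'.2 h = s
    · have := joint_mix_mul hS (h1.trans h2.symm)
      linear_combination f ω' * g ω * hidInd d n h s ω * hidInd d n h s ω' * this
    · simp [hidInd, h2]
  · simp [hidInd, h1]

/-- This covers hidden states of probability zero, where conditional probabilities have the default
value 0. -/
theorem expect_mul_hidInd_eq_zero {h : H} {s : Fin k} (h0 : M.expect (hidInd d n h s) = 0)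
    (f : (Fin d → Fin n) × (H → Fin k) → ℝ) : M.expect (fun ω => f ω * hidInd d n h s ω) = 0 := by
  classical
  unfold expect at *
  rw [Finset.sum_eq_zero_iff_of_nonneg] at h0
  · refine Finset.sum_eq_zero fun ω hω => ?_
    have := h0 ω hω
    linear_combination f ω * this
  · intro ω _
    refine mul_nonneg (joint_nonneg _ _) ?_
    unfold hidInd
    split_ifs <;> norm_num

theorem hidden1_eq (h : H) (s : Fin k) : M.hidden1 h s = M.expect (hidInd d n h s) := by
  classical
  unfold hidden1 expect hidInd
  rw [Fintype.sum_prod_type]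
  simp

theorem hidden2_eq (h g : H) (s t : Fin k) :
    M.hidden2 h g s t = M.expect fun ω => hidInd d n h s ω * hidInd d n g t ω := by
  classical
  unfold hidden2 expect hidInd
  rw [Fintype.sum_prod_type]
  simp [← ite_and, and_comm]

theorem table2_eq (a b : Fin d) (x y : Fin n) :
    M.table2 a b x y = M.expect fun ω => obsInd n k H a x ω * obsInd n k H b y ω := by
  classical
  unfold table2 expect obsInd obs
  rw [Fintype.sum_prod_type]
  simp [← ite_and, and_comm, Finset.sum_ite_irrel]

theorem table4_eq (q : Fin 4 → Fin d) (x₁ x₂ x₃ x₄ : Fin n) :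
    M.table4 q x₁ x₂ x₃ x₄ = M.expect fun ω => obsInd n k H (q 0) x₁ ω *
      (obsInd n k H (q 1) x₂ ω * (obsInd n k H (q 2) x₃ ω * obsInd n k H (q 3) x₄ ω)) := by
  classical
  unfold table4 expect obsInd obs
  rw [Fintype.sum_prod_type]
  refine Finset.sum_congr rfl fun x _ => ?_
  by_cases h1 : x (q 0) = x₁ <;> by_cases h2 : x (q 1) = x₂ <;> by_cases h3 : x (q 2) = x₃ <;>
    by_cases h4 : x (q 3) = x₄ <;> simp [h1, h2, h3, h4]

theorem sum_expect_mul_hidInd (h : H) (f : (Fin d → Fin n) × (H → Fin k) → ℝ) :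
    ∑ s, M.expect (fun ω => f ω * hidInd d n h s ω) = M.expect f := by
  classical
  unfold expect hidInd
  rw [Finset.sum_comm]
  refine Finset.sum_congr rfl fun ω _ => ?_
  simp

theorem sum_expect_obsInd_mul (i : Fin d) (f : (Fin d → Fin n) × (H → Fin k) → ℝ) :
    ∑ x, M.expect (fun ω => obsInd n k H i x ω * f ω) = M.expect f := by
  classical
  unfold expect obsInd
  rw [Finset.sum_comm]
  refine Finset.sum_congr rfl fun ω _ => ?_
  simp

theorem expect_nonneg {f : (Fin d → Fin n) × (H → Fin k) → ℝ} (hf : ∀ ω, 0 ≤ f ω) :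
    0 ≤ M.expect f := by
  classical
  exact Finset.sum_nonneg fun ω _ => mul_nonneg (joint_nonneg _ _) (hf ω)

/-- The conditional probability of `X_i = x` given that `h` has the value `s`. -/
noncomputable def condProb (i : Fin d) (h : H) (x : Fin n) (s : Fin k) : ℝ :=
  M.expect (fun ω => obsInd n k H i x ω * hidInd d n h s ω) / M.expect (hidInd d n h s)

theorem condProb_nonneg (i : Fin d) (h : H) (x : Fin n) (s : Fin k) : 0 ≤ M.condProb i h x s := by
  refine div_nonneg (M.expect_nonneg fun ω => ?_) (M.expect_nonneg fun ω => ?_) <;>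
    unfold hidInd <;> try unfold obsInd
  all_goals split_ifs <;> norm_num

/-- The entries are nonnegative with sum at most 1 (the sum is 0 for a state of probability zero),
and for such entries the sum of squares is at most the square of the sum. -/
theorem sum_condProb_sq_le (i : Fin d) (h : H) (s : Fin k) :
    ∑ x, M.condProb i h x s ^ 2 ≤ 1 := by
  have h1 : ∑ x, M.condProb i h x s ≤ 1 := by
    unfold condProb
    rw [← Finset.sum_div, M.sum_expect_obsInd_mul i]
    exact div_self_le_one _
  have h2 := Finset.sum_sq_le_sq_sum_of_nonneg (s := Finset.univ)
    (fun x _ => M.condProb_nonneg i h x s)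
  have h3 : 0 ≤ ∑ x, M.condProb i h x s := Finset.sum_nonneg fun x _ => M.condProb_nonneg i h x s
  nlinarith

theorem isBranch (v : Fin d ⊕ H) (h : H) :
    M.IsBranch {w | ¬OnPath M.tree v (Sum.inr h) w} h := by
  refine ⟨fun hh => hh (SimpleGraph.IsTree.onPath_right _ _), fun a b hab ha hb => ?_⟩
  have key : ¬OnPath M.tree a (Sum.inr h) b := by
    have h1 := M.isTree.dist_pos ha
    have h2 := M.isTree.dist_pos hb.symm
    have h3 := SimpleGraph.dist_eq_one_iff_adj.2 hab
    unfold OnPath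
    omega
  exact ⟨fun h => M.isTree.not_onPath_trans h key,
    fun h => M.isTree.not_onPath_trans h (SimpleGraph.IsTree.not_onPath_symm key)⟩

/-- Splitting off an observed variable. -/
theorem expect_obsInd_mul (i : Fin d) (h : H) (x : Fin n) (s : Fin k)
    {g : (Fin d → Fin n) × (H → Fin k) → ℝ}
    (hg : IndependentOf {w | ¬OnPath M.tree (Sum.inl i) (Sum.inr h) w} g) :
    M.expect (fun ω => obsInd n k H i x ω * g ω * hidInd d n h s ω) =
      M.condProb i h x s * M.expect (fun ω => g ω * hidInd d n h s ω) := by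
  have hi : (Sum.inl i : Fin d ⊕ H) ∈ {w | ¬OnPath M.tree (Sum.inl i) (Sum.inr h) w} :=
    M.isTree.not_onPath_self (by simp)
  have := M.expect_mul_expect (M.isBranch (Sum.inl i) h) s (dependsOn_obsInd hi x) hg
  unfold condProb
  by_cases h0 : M.expect (hidInd d n h s) = 0
  · rw [M.expect_mul_hidInd_eq_zero h0 (fun ω => obsInd n k H i x ω * g ω), h0]
    simp
  · field_simp
    exact this

/-- The joint table of the two observed variables which branch at `h`. -/
theorem table2_eq_sum {a b : Fin d} {h : H}
    (hab : OnPath M.tree (Sum.inl a) (Sum.inr h) (Sum.inl b)) (x y : Fin n) :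
    M.table2 a b x y = ∑ s, M.hidden1 h s * M.condProb a h x s * M.condProb b h y s := by
  rw [table2_eq, ← M.sum_expect_mul_hidInd h]
  refine Finset.sum_congr rfl fun s _ => ?_
  rw [M.expect_obsInd_mul a h x s (independentOf_obsInd (by simpa using hab) y)]
  have := M.expect_obsInd_mul b h y s (g := fun _ => 1) (independentOf_one _)
  simp only [mul_one, one_mul] at this
  rw [this, hidden1_eq, ← mul_assoc, mul_comm, mul_assoc, mul_comm (M.condProb a h x s)]

end LatentTreeModel

/-- `h` and `g` are the nodes at which the quartet `{x, y}|{z, w}` branches. -/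
structure BranchPoints {V : Type*} (T : SimpleGraph V) (h g x y z w : V) : Prop where
  xhy : OnPath T x h y
  xhz : OnPath T x h z
  xhw : OnPath T x h w
  xhg : OnPath T x h g
  yhz : OnPath T y h z
  yhw : OnPath T y h w
  yhg : OnPath T y h g
  zgw : OnPath T z g w
  zgh : OnPath T z g h
  wgh : OnPath T w g h

namespace LatentTreeModel

variable {d n k : ℕ} {H : Type*} [Fintype H] (M : LatentTreeModel d n k H)

/-- The joint table of a quartet. -/
theorem table4_eq_sum {q : Fin 4 → Fin d} {h g : H}
    (hq : BranchPoints M.tree (Sum.inr h) (Sum.inr g) (Sum.inl (q 0)) (Sum.inl (q 1))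
      (Sum.inl (q 2)) (Sum.inl (q 3))) (x₁ x₂ x₃ x₄ : Fin n) :
    M.table4 q x₁ x₂ x₃ x₄ = ∑ s, ∑ t, M.hidden2 h g s t *
      (M.condProb (q 0) h x₁ s * M.condProb (q 1) h x₂ s *
        (M.condProb (q 2) g x₃ t * M.condProb (q 3) g x₄ t)) := by
  rw [table4_eq, ← M.sum_expect_mul_hidInd h]
  refine Finset.sum_congr rfl fun s _ => ?_
  rw [← M.sum_expect_mul_hidInd g]
  refine Finset.sum_congr rfl fun t _ => ?_
  -- The four observed variables are split off one after another: the first two given `h`, the last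
  -- two given `g`. What remains is the joint probability of `h` and `g`.
  have e1 := M.expect_obsInd_mul (q 0) h x₁ s
    (g := fun ω => obsInd n k H (q 1) x₂ ω * (obsInd n k H (q 2) x₃ ω *
      (obsInd n k H (q 3) x₄ ω * hidInd d n g t ω)))
    ((independentOf_obsInd (by simpa using hq.xhy) _).mul <|
      (independentOf_obsInd (by simpa using hq.xhz) _).mul <|
      (independentOf_obsInd (by simpa using hq.xhw) _).mul
        (independentOf_hidInd (by simpa using hq.xhg) _))
  have e2 := M.expect_obsInd_mul (q 1) h x₂ s
    (g := fun ω => obsInd n k H (q 2) x₃ ω * (obsInd n k H (q 3) x₄ ω * hidInd d n g t ω))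
    ((independentOf_obsInd (by simpa using hq.yhz) _).mul <|
      (independentOf_obsInd (by simpa using hq.yhw) _).mul
        (independentOf_hidInd (by simpa using hq.yhg) _))
  have e3 := M.expect_obsInd_mul (q 2) g x₃ t
    (g := fun ω => obsInd n k H (q 3) x₄ ω * hidInd d n h s ω)
    ((independentOf_obsInd (by simpa using hq.zgw) _).mul
        (independentOf_hidInd (by simpa using hq.zgh) _))
  have e4 := M.expect_obsInd_mul (q 3) g x₄ t (g := hidInd d n h s)
    (independentOf_hidInd (by simpa using hq.wgh) _)
  rw [hidden2_eq]
  rw [e4] at e3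
  have c1 : M.expect (fun ω => obsInd n k H (q 2) x₃ ω * (obsInd n k H (q 3) x₄ ω *
      hidInd d n g t ω) * hidInd d n h s ω) = M.expect (fun ω => obsInd n k H (q 2) x₃ ω *
      (obsInd n k H (q 3) x₄ ω * hidInd d n h s ω) * hidInd d n g t ω) := by
    congr 1
    funext ω
    ring
  rw [c1, e3] at e2
  rw [e2] at e1
  rw [show M.condProb (q 0) h x₁ s * M.condProb (q 1) h x₂ s *
    (M.condProb (q 2) g x₃ t * M.condProb (q 3) g x₄ t) = M.condProb (q 0) h x₁ s *
    (M.condProb (q 1) h x₂ s * (M.condProb (q 2) g x₃ t * M.condProb (q 3) g x₄ t)) by ring]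
  have c2 : M.expect (fun ω => obsInd n k H (q 0) x₁ ω * (obsInd n k H (q 1) x₂ ω *
      (obsInd n k H (q 2) x₃ ω * obsInd n k H (q 3) x₄ ω)) * hidInd d n h s ω *
      hidInd d n g t ω) = M.expect (fun ω => obsInd n k H (q 0) x₁ ω * (obsInd n k H (q 1) x₂ ω *
      (obsInd n k H (q 2) x₃ ω * (obsInd n k H (q 3) x₄ ω * hidInd d n g t ω))) *
      hidInd d n h s ω) := by
    congr 1
    funext ω
    ring
  rw [c2, e1]
  ring

/-! ### Perturbation of the nuclear norms -/

theorem sum_sq_mul_le {ι κ : Type*} [Fintype ι] [Fintype κ] {a : ι → ℝ} {b : κ → ℝ}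
    (ha : ∑ x, a x ^ 2 ≤ 1) (hb : ∑ y, b y ^ 2 ≤ 1) :
    ∑ r : ι × κ, (a r.1 * b r.2) ^ 2 ≤ 1 := by
  rw [Fintype.sum_prod_type]
  simp only [mul_pow]
  rw [← Finset.sum_mul_sum]
  exact mul_le_one₀ ha (Finset.sum_nonneg fun _ _ => sq_nonneg _) hb

theorem nuclearNorm_vecMulVec_le_one {ι κ : Type*} [Fintype ι] [DecidableEq ι] [Fintype κ]
    [DecidableEq κ] {u : ι → ℝ} {v : κ → ℝ} (hu : ∑ r, u r ^ 2 ≤ 1) (hv : ∑ s, v s ^ 2 ≤ 1) :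
    nuclearNorm (Matrix.vecMulVec u v) ≤ 1 :=
  (nuclearNorm_vecMulVec_le u v).trans
    (mul_le_one₀ (Real.sqrt_le_one.2 hu) (Real.sqrt_nonneg _) (Real.sqrt_le_one.2 hv))

/-- The unfoldings of a combination of `k²` product tensors. -/
theorem abs_nuclearNorm_unfolding_sub_le {n k : ℕ} {P P' : Tensor4 n} {p p' : Fin k → Fin k → ℝ}
    {a₁ a₂ a₃ a₄ : Fin n → Fin k → ℝ} (h₁ : ∀ s, ∑ x, a₁ x s ^ 2 ≤ 1)
    (h₂ : ∀ s, ∑ x, a₂ x s ^ 2 ≤ 1) (h₃ : ∀ s, ∑ x, a₃ x s ^ 2 ≤ 1)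
    (h₄ : ∀ s, ∑ x, a₄ x s ^ 2 ≤ 1)
    (hP : ∀ x₁ x₂ x₃ x₄, P x₁ x₂ x₃ x₄ =
      ∑ s, ∑ t, p s t * (a₁ x₁ s * a₂ x₂ s * (a₃ x₃ t * a₄ x₄ t)))
    (hP' : ∀ x₁ x₂ x₃ x₄, P' x₁ x₂ x₃ x₄ =
      ∑ s, ∑ t, p' s t * (a₁ x₁ s * a₂ x₂ s * (a₃ x₃ t * a₄ x₄ t))) (j : Fin 3) :
    |nuclearNorm (unfolding P j) - nuclearNorm (unfolding P' j)| ≤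
      ∑ s, ∑ t, |p s t - p' s t| := by
  refine (abs_nuclearNorm_sub_le _ _).trans ?_
  -- Every unfolding of a product tensor has rank one, with factors of length at most 1 whatever the
  -- grouping.
  have main : ∃ u v : Fin k → Fin k → Fin n × Fin n → ℝ, (∀ s t, ∑ r, u s t r ^ 2 ≤ 1) ∧
      (∀ s t, ∑ r, v s t r ^ 2 ≤ 1) ∧ unfolding P j - unfolding P' j =
        ∑ s, ∑ t, (p s t - p' s t) • Matrix.vecMulVec (u s t) (v s t) := by
    fin_cases j
    · refine ⟨fun s t r => a₁ r.1 s * a₂ r.2 s, fun s t r => a₃ r.1 t * a₄ r.2 t,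
        fun s t => sum_sq_mul_le (h₁ s) (h₂ s), fun s t => sum_sq_mul_le (h₃ t) (h₄ t), ?_⟩
      ext r c
      simp only [unfolding, Matrix.sub_apply, Matrix.of_apply, hP, hP', Matrix.sum_apply,
        Matrix.smul_apply, Matrix.vecMulVec_apply, smul_eq_mul, ← Finset.sum_sub_distrib]
      refine Finset.sum_congr rfl fun s _ => Finset.sum_congr rfl fun t _ => by ring
    · refine ⟨fun s t r => a₁ r.1 s * a₃ r.2 t, fun s t r => a₂ r.1 s * a₄ r.2 t,
        fun s t => sum_sq_mul_le (h₁ s) (h₃ t), fun s t => sum_sq_mul_le (h₂ s) (h₄ t), ?_⟩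
      ext r c
      simp only [unfolding, Matrix.sub_apply, Matrix.of_apply, hP, hP', Matrix.sum_apply,
        Matrix.smul_apply, Matrix.vecMulVec_apply, smul_eq_mul, ← Finset.sum_sub_distrib]
      refine Finset.sum_congr rfl fun s _ => Finset.sum_congr rfl fun t _ => by ring
    · refine ⟨fun s t r => a₁ r.1 s * a₄ r.2 t, fun s t r => a₂ r.1 s * a₃ r.2 t,
        fun s t => sum_sq_mul_le (h₁ s) (h₄ t), fun s t => sum_sq_mul_le (h₂ s) (h₃ t), ?_⟩
      ext r c
      simp only [unfolding, Matrix.sub_apply, Matrix.of_apply, hP, hP', Matrix.sum_apply,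
        Matrix.smul_apply, Matrix.vecMulVec_apply, smul_eq_mul, ← Finset.sum_sub_distrib]
      refine Finset.sum_congr rfl fun s _ => Finset.sum_congr rfl fun t _ => by ring
  obtain ⟨u, v, hu, hv, he⟩ := main
  rw [he]
  refine (nuclearNorm_sum_le _ _).trans (Finset.sum_le_sum fun s _ => ?_)
  refine (nuclearNorm_sum_le _ _).trans (Finset.sum_le_sum fun t _ => ?_)
  refine (nuclearNorm_smul_le _ _).trans ?_
  exact mul_le_of_le_one_right (abs_nonneg _) (nuclearNorm_vecMulVec_le_one (hu s t) (hv s t))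

theorem sum_abs_le_mul_frobNorm {k : ℕ} (Δ : Matrix (Fin k) (Fin k) ℝ) :
    ∑ s, ∑ t, |Δ s t| ≤ k * frobNorm Δ := by
  unfold frobNorm
  rw [← Fintype.sum_prod_type' (f := fun s t => |Δ s t|),
    ← Fintype.sum_prod_type' (f := fun s t => Δ s t ^ 2)]
  have := Real.sum_mul_le_sqrt_mul_sqrt (Finset.univ : Finset (Fin k × Fin k)) (fun _ => 1)
    (fun p => |Δ p.1 p.2|)
  simp only [one_mul, one_pow, sq_abs, Finset.sum_const, Finset.card_univ, Fintype.card_prod,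
    Fintype.card_fin, nsmul_eq_mul, mul_one, Nat.cast_mul] at this
  rwa [Real.sqrt_mul_self (Nat.cast_nonneg k)] at this

/-- The gap of a quartet is at least `θ - 2 k ‖Δ‖_F`. -/
theorem theta_sub_le_alpha {q : Quartet M.tree} {h g : H}
    (hq : BranchPoints M.tree (Sum.inr h) (Sum.inr g) (Sum.inl (q.1 0)) (Sum.inl (q.1 1))
      (Sum.inl (q.1 2)) (Sum.inl (q.1 3))) :
    M.theta q - 2 * k * frobNorm (M.Delta h g) ≤ M.alpha q := by
  have key := abs_nuclearNorm_unfolding_sub_le (M.sum_condProb_sq_le (q.1 0) h)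
    (M.sum_condProb_sq_le (q.1 1) h) (M.sum_condProb_sq_le (q.1 2) g)
    (M.sum_condProb_sq_le (q.1 3) g) (M.table4_eq_sum hq)
    (P' := fun x₁ x₂ x₃ x₄ => M.table2 (q.1 0) (q.1 1) x₁ x₂ * M.table2 (q.1 2) (q.1 3) x₃ x₄)
    (p' := fun s t => M.hidden1 h s * M.hidden1 g t) (by
      intro x₁ x₂ x₃ x₄
      rw [M.table2_eq_sum hq.xhy, M.table2_eq_sum hq.zgw, Finset.sum_mul_sum]
      refine Finset.sum_congr rfl fun s _ => Finset.sum_congr rfl fun t _ => by ring)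
  have hΔ := sum_abs_le_mul_frobNorm (M.Delta h g)
  simp only [Delta, Matrix.of_apply] at hΔ
  -- Each norm moves by at most `k ‖Δ‖_F`, and a gap is a difference of two norms; hence the factor
  -- `2 k`.
  have k0 := abs_le.1 ((key 0).trans hΔ)
  have k1 := abs_le.1 ((key 1).trans hΔ)
  have k2 := abs_le.1 ((key 2).trans hΔ)
  unfold theta alpha nuclearGap Delta
  rw [le_min_iff]
  constructor
  · have := min_le_left (nuclearNorm (unfolding (fun x₁ x₂ x₃ x₄ =>
      M.table2 (q.1 0) (q.1 1) x₁ x₂ * M.table2 (q.1 2) (q.1 3) x₃ x₄) 1) -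
      nuclearNorm (unfolding (fun x₁ x₂ x₃ x₄ =>
      M.table2 (q.1 0) (q.1 1) x₁ x₂ * M.table2 (q.1 2) (q.1 3) x₃ x₄) 0))
      (nuclearNorm (unfolding (fun x₁ x₂ x₃ x₄ =>
      M.table2 (q.1 0) (q.1 1) x₁ x₂ * M.table2 (q.1 2) (q.1 3) x₃ x₄) 2) -
      nuclearNorm (unfolding (fun x₁ x₂ x₃ x₄ =>
      M.table2 (q.1 0) (q.1 1) x₁ x₂ * M.table2 (q.1 2) (q.1 3) x₃ x₄) 0))
    linarith
  · have := min_le_right (nuclearNorm (unfolding (fun x₁ x₂ x₃ x₄ =>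
      M.table2 (q.1 0) (q.1 1) x₁ x₂ * M.table2 (q.1 2) (q.1 3) x₃ x₄) 1) -
      nuclearNorm (unfolding (fun x₁ x₂ x₃ x₄ =>
      M.table2 (q.1 0) (q.1 1) x₁ x₂ * M.table2 (q.1 2) (q.1 3) x₃ x₄) 0))
      (nuclearNorm (unfolding (fun x₁ x₂ x₃ x₄ =>
      M.table2 (q.1 0) (q.1 1) x₁ x₂ * M.table2 (q.1 2) (q.1 3) x₃ x₄) 2) -
      nuclearNorm (unfolding (fun x₁ x₂ x₃ x₄ =>
      M.table2 (q.1 0) (q.1 1) x₁ x₂ * M.table2 (q.1 2) (q.1 3) x₃ x₄) 0))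
    linarith

end LatentTreeModel

/-! ### The branch points of a quartet -/

open SimpleGraph.IsTree in
theorem SimpleGraph.IsTree.isMedian {V : Type*} {T : SimpleGraph V} (hT : T.IsTree) {v x y z : V}
    (hx : v ≠ x) (hy : v ≠ y) (hz : v ≠ z) (hxy : OnPath T x v y) (hxz : OnPath T x v z)
    (hyz : OnPath T y v z) : IsMedian T v x y z := by
  obtain ⟨a, ha, ha'⟩ := hT.exists_adj_toward hx
  obtain ⟨b, hb, hb'⟩ := hT.exists_adj_toward hy
  obtain ⟨c, hc, hc'⟩ := hT.exists_adj_toward hz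
  have key : ∀ p q a b, OnPath T p v q → T.dist p v = T.dist p a + 1 →
      T.dist q v = T.dist q b + 1 → a ≠ b := by
    rintro p q a b h h1 h2 rfl
    have := hT.connected.dist_triangle (u := p) (v := a) (w := q)
    have := T.dist_comm (u := a) (v := q)
    have := T.dist_comm (u := v) (v := q)
    unfold OnPath at h
    omega
  exact ⟨a, b, c, key _ _ _ _ hxy ha' hb', key _ _ _ _ hxz ha' hc', key _ _ _ _ hyz hb' hc', ha,
    hb, hc, (hT.mem_side_iff ha).2 ha', (hT.mem_side_iff hb).2 hb', (hT.mem_side_iff hc).2 hc'⟩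

open SimpleGraph.IsTree in
/-- The medians of three of the four points of a quartet. -/
theorem SimpleGraph.IsTree.branchPoints {V : Type*} {T : SimpleGraph V} (hT : T.IsTree)
    {h g x y z w : V} (hlt : T.dist x y + T.dist z w < T.dist x z + T.dist y w)
    (xhy : OnPath T x h y) (xhz : OnPath T x h z) (yhz : OnPath T y h z) (zgw : OnPath T z g w)
    (zgx : OnPath T z g x) (wgx : OnPath T w g x) : h ≠ g ∧ BranchPoints T h g x y z w := by
  have c1 := T.dist_comm (u := h) (v := x)
  have c2 := T.dist_comm (u := h) (v := y)
  have c3 := T.dist_comm (u := h) (v := z)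
  have c4 := T.dist_comm (u := g) (v := x)
  have c5 := T.dist_comm (u := g) (v := z)
  have c6 := T.dist_comm (u := g) (v := w)
  have hq := hT.quad x y z w
  have xhw : OnPath T x h w := by
    by_contra hn
    have h1 := hT.onPath_of_not_onPath hn xhy
    have h2 := hT.onPath_of_not_onPath hn xhz
    have h3 := hT.connected.dist_triangle (u := x) (v := h) (w := w)
    have c7 := T.dist_comm (u := h) (v := w)
    unfold OnPath at *
    omega
  have yhw : OnPath T y h w := by
    by_contra hn
    have h1 := hT.onPath_of_not_onPath hn ((onPath_comm _ _ _).1 xhy)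
    have h2 := hT.onPath_of_not_onPath hn yhz
    have h3 := hT.connected.dist_triangle (u := y) (v := h) (w := w)
    have c7 := T.dist_comm (u := h) (v := w)
    unfold OnPath at *
    omega
  have hq' := hT.quad x z h g
  have zgh : OnPath T z g h ∧ OnPath T x h g ∧ h ≠ g := by
    -- Both `h` and `g` lie on the path from `x` to `z`; the strict inequality `hlt` puts `h` nearer
    -- to `x`.
    have : T.dist x h < T.dist x g := by
      unfold OnPath at *
      omega
    refine ⟨?_, ?_, ?_⟩
    · unfold OnPath at *
      omega
    · unfold OnPath at *
      omega
    · rintro rfl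
      exact lt_irrefl _ this
  obtain ⟨zgh, xhg, hne⟩ := zgh
  have hpos := hT.dist_pos hne
  have n1 : ¬OnPath T h g x := by
    unfold OnPath at *
    omega
  have n2 : ¬OnPath T g h z := by
    unfold OnPath at *
    omega
  have wgh : OnPath T w g h := by
    by_contra hn
    exact hT.not_onPath_trans hn n1 wgx
  have yhg : OnPath T y h g := by
    by_contra hn
    exact hT.not_onPath_trans hn n2 yhz
  exact ⟨hne, xhy, xhz, xhw, xhg, yhz, yhw, yhg, zgw, zgh, wgh⟩

namespace IsTrivalent

open SimpleGraph.IsTree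

variable {d : ℕ} {H : Type*} {G : SimpleGraph (Fin d ⊕ H)}

/-- The two inner nodes at which a quartet branches. -/
theorem exists_branchPoints (hG : IsTrivalent G) {q : Fin 4 → Fin d} (hinj : Function.Injective q)
    (hres : Resolves G (Sum.inl (q 0)) (Sum.inl (q 1)) (Sum.inl (q 2)) (Sum.inl (q 3))) :
    ∃ h g : H, h ≠ g ∧
      BranchPoints G (Sum.inr h) (Sum.inr g) (Sum.inl (q 0)) (Sum.inl (q 1)) (Sum.inl (q 2))
        (Sum.inl (q 3)) ∧
      IsMedian G (Sum.inr h) (Sum.inl (q 0)) (Sum.inl (q 1)) (Sum.inl (q 2)) ∧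
      IsMedian G (Sum.inr g) (Sum.inl (q 2)) (Sum.inl (q 3)) (Sum.inl (q 0)) := by
  have hT := hG.isTree
  have hlt := Resolves.dist_lt hG hres
  have hne : ∀ i j, i ≠ j → (Sum.inl (q i) : Fin d ⊕ H) ≠ Sum.inl (q j) := fun i j hij h =>
    hij (hinj (Sum.inl.inj h))
  have hidden : ∀ i j l v, i ≠ j → i ≠ l → j ≠ l → OnPath G (Sum.inl (q i)) v (Sum.inl (q j)) →
      OnPath G (Sum.inl (q i)) v (Sum.inl (q l)) → OnPath G (Sum.inl (q j)) v (Sum.inl (q l)) →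
      ∃ h : H, v = Sum.inr h := by
    intro i j l v hij hil hjl h1 h2 h3
    rcases v with a | h
    · exfalso
      rcases hG.eq_of_onPath_leaf h1 with e | e <;> rcases hG.eq_of_onPath_leaf h2 with e' | e' <;>
        rcases hG.eq_of_onPath_leaf h3 with e'' | e'' <;>
        first
          | exact hne _ _ hij (e.trans e''.symm)
          | exact hne _ _ hil (e.trans e''.symm)
          | exact hne _ _ hil (e.trans e'.symm)
          | exact hne _ _ hjl (e.trans e''.symm)
          | exact hne _ _ hjl (e.trans e'.symm)
          | exact hne _ _ hij (e'.trans e''.symm)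
    · exact ⟨h, rfl⟩
  obtain ⟨v, xvy, xvz, yvz⟩ := hT.exists_median (Sum.inl (q 0)) (Sum.inl (q 1)) (Sum.inl (q 2))
  obtain ⟨h, rfl⟩ := hidden 0 1 2 v (by decide) (by decide) (by decide) xvy xvz yvz
  obtain ⟨v, zvw, zvx, wvx⟩ := hT.exists_median (Sum.inl (q 2)) (Sum.inl (q 3)) (Sum.inl (q 0))
  obtain ⟨g, rfl⟩ := hidden 2 3 0 v (by decide) (by decide) (by decide) zvw zvx wvx
  obtain ⟨hne, hbr⟩ := hT.branchPoints hlt xvy xvz yvz zvw zvx wvx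
  exact ⟨h, g, fun e => hne (congrArg _ e), hbr,
    hT.isMedian (by simp) (by simp) (by simp) xvy xvz yvz,
    hT.isMedian (by simp) (by simp) (by simp) zvw zvx wvx⟩

end IsTrivalent

/-! ### Perturbations along paths, and nonnegative gaps -/

namespace LatentTreeModel

variable {d n k : ℕ} {H : Type*} [Fintype H] (M : LatentTreeModel d n k H)

theorem isTrivalent (h2 : M.A2) : IsTrivalent M.tree := ⟨M.isTree, M.observed_isLeaf, h2⟩

theorem expect_one : M.expect (fun _ => 1) = ∑ x, M.obs x := by
  classical
  unfold expect obs
  rw [Fintype.sum_prod_type]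
  simp

theorem sum_hidden1 (hM : ∑ x, M.obs x = 1) (h : H) : ∑ s, M.hidden1 h s = 1 := by
  rw [← hM, ← expect_one, ← M.sum_expect_mul_hidInd h]
  simp [hidden1_eq]

theorem sum_hidden2 (h g : H) (s : Fin k) : ∑ t, M.hidden2 h g s t = M.hidden1 h s := by
  simp only [hidden2_eq, hidden1_eq]
  exact M.sum_expect_mul_hidInd g _

theorem hidden2_comm (h g : H) (s t : Fin k) : M.hidden2 h g s t = M.hidden2 g h t s := by
  simp only [hidden2_eq, mul_comm]

theorem hidden2_eq_zero {h : H} {t : Fin k} (h0 : M.hidden1 h t = 0) (g : H) (s : Fin k) :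
    M.hidden2 g h s t = 0 := by
  rw [hidden1_eq] at h0
  rw [hidden2_eq]
  exact M.expect_mul_hidInd_eq_zero h0 _

/-- The joint table along a path. -/
theorem hidden2_eq_sum {h h' g : H} (hne : h ≠ h')
    (hp : OnPath M.tree (Sum.inr h) (Sum.inr h') (Sum.inr g)) (s t : Fin k) :
    M.hidden2 h g s t = ∑ u, M.hidden2 h h' s u * M.hidden2 h' g u t / M.hidden1 h' u := by
  rw [hidden2_eq, ← M.sum_expect_mul_hidInd h']
  refine Finset.sum_congr rfl fun u _ => ?_
  have hi : (Sum.inr h : Fin d ⊕ H) ∈ {w | ¬OnPath M.tree (Sum.inr h) (Sum.inr h') w} :=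
    M.isTree.not_onPath_self (by simpa using hne)
  have := M.expect_mul_expect (M.isBranch (Sum.inr h) h') u (dependsOn_hidInd hi s)
    (independentOf_hidInd (h := g) (by simpa using hp) t)
  rw [M.hidden2_comm h' g, hidden2_eq, hidden2_eq, hidden1_eq]
  by_cases h0 : M.expect (hidInd d n h' u) = 0
  · rw [M.expect_mul_hidInd_eq_zero h0 (fun ω => hidInd d n h s ω * hidInd d n g t ω), h0]
    simp
  · rw [eq_div_iff h0]
    exact this

/-- The perturbations along a path. -/
theorem Delta_eq_sum (hM : ∑ x, M.obs x = 1) {h h' g : H} (hne : h ≠ h')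
    (hp : OnPath M.tree (Sum.inr h) (Sum.inr h') (Sum.inr g)) (s t : Fin k) :
    M.Delta h g s t = ∑ u, M.Delta h h' s u * (M.Delta h' g u t / M.hidden1 h' u) := by
  -- Summed over `u`, the first term becomes `P_HG`, and the other three combine to `-P_H P_Gᵀ`,
  -- because marginals and total mass are known. A state `u` of probability zero contributes
  -- nothing.
  have key : ∀ u, M.Delta h h' s u * (M.Delta h' g u t / M.hidden1 h' u) =
      M.hidden2 h h' s u * M.hidden2 h' g u t / M.hidden1 h' u -
        M.hidden2 h h' s u * M.hidden1 g t - M.hidden1 h s * M.hidden2 g h' t u +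
        M.hidden1 h s * M.hidden1 g t * M.hidden1 h' u := by
    intro u
    simp only [Delta, Matrix.of_apply]
    by_cases h0 : M.hidden1 h' u = 0
    · simp [h0, M.hidden2_eq_zero h0]
    · rw [M.hidden2_comm g h']
      field_simp
      ring
  simp only [key, Finset.sum_add_distrib, Finset.sum_sub_distrib, ← Finset.mul_sum,
    ← Finset.sum_mul, M.sum_hidden1 hM, M.sum_hidden2, ← M.hidden2_eq_sum hne hp]
  simp only [Delta, Matrix.of_apply]
  ring

theorem frobNorm_nonneg {ι κ : Type*} [Fintype ι] [Fintype κ] (A : Matrix ι κ ℝ) :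
    0 ≤ frobNorm A := Real.sqrt_nonneg _

theorem frobNorm_mul_le {ι κ l : Type*} [Fintype ι] [Fintype κ] [Fintype l] (A : Matrix ι κ ℝ)
    (B : Matrix κ l ℝ) : frobNorm (A * B) ≤ frobNorm A * frobNorm B := by
  unfold frobNorm
  have h0 : 0 ≤ ∑ i, ∑ j, A i j ^ 2 :=
    Finset.sum_nonneg fun _ _ => Finset.sum_nonneg fun _ _ => sq_nonneg _
  rw [← Real.sqrt_mul h0]
  refine Real.sqrt_le_sqrt ?_
  rw [Finset.sum_mul, Finset.sum_comm (f := fun i j => B i j ^ 2)]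
  refine Finset.sum_le_sum fun i _ => ?_
  rw [Finset.mul_sum]
  exact Finset.sum_le_sum fun j _ => Finset.sum_mul_sq_le_sq_mul_sq _ _ _

theorem frobNorm_le_mul {ι κ : Type*} [Fintype ι] [Fintype κ] {A B : Matrix ι κ ℝ} {c : ℝ}
    (hc : 0 ≤ c) (h : ∀ i j, |A i j| ≤ c * |B i j|) : frobNorm A ≤ c * frobNorm B := by
  unfold frobNorm
  rw [← Real.sqrt_sq hc, ← Real.sqrt_mul (sq_nonneg c), Finset.mul_sum]
  refine Real.sqrt_le_sqrt (Finset.sum_le_sum fun i _ => ?_)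
  rw [Finset.mul_sum]
  refine Finset.sum_le_sum fun j _ => ?_
  rw [← sq_abs, ← sq_abs (B i j), ← mul_pow]
  exact pow_le_pow_left₀ (abs_nonneg _) (h i j) 2

theorem gammaMin_le (h : H) (s : Fin k) : M.gammaMin ≤ M.hidden1 h s :=
  (ciInf_le (Set.finite_range _).bddBelow h).trans (ciInf_le (Set.finite_range _).bddBelow s)

instance : Finite (Quartet M.tree) := by
  unfold Quartet
  infer_instance

theorem thetaMin_le (q : Quartet M.tree) : M.thetaMin ≤ M.theta q :=
  ciInf_le (Set.finite_range _).bddBelow q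

theorem alphaMin_le (q : Quartet M.tree) : M.alphaMin ≤ M.alpha q :=
  ciInf_le (Set.finite_range _).bddBelow q

/-- The perturbation does not increase along a path. -/
theorem frobNorm_Delta_le (hM : ∑ x, M.obs x = 1) {h h' g : H} (hne : h ≠ h')
    (hp : OnPath M.tree (Sum.inr h) (Sum.inr h') (Sum.inr g))
    (hle : frobNorm (M.Delta h h') ≤ M.gammaMin) :
    frobNorm (M.Delta h g) ≤ frobNorm (M.Delta h' g) := by
  have he : M.Delta h g =
      M.Delta h h' * Matrix.of fun u t => M.Delta h' g u t / M.hidden1 h' u := by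
    ext s t
    rw [M.Delta_eq_sum hM hne hp, Matrix.mul_apply]
    simp
  rw [he]
  refine (frobNorm_mul_le _ _).trans ?_
  have h0 := frobNorm_nonneg (M.Delta h h')
  -- If `gammaMin` is 0, the first factor vanishes. Otherwise the weights `1 / P` cost at most `1 /
  -- gammaMin`, which the first factor compensates.
  rcases (h0.trans hle).eq_or_lt with hγ | hγ
  · rw [le_antisymm (hle.trans hγ.ge) h0, zero_mul]
    exact frobNorm_nonneg _
  · have h1 : frobNorm (Matrix.of fun u t => M.Delta h' g u t / M.hidden1 h' u) ≤
        M.gammaMin⁻¹ * frobNorm (M.Delta h' g) := by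
      refine frobNorm_le_mul (inv_nonneg.2 hγ.le) fun u t => ?_
      have := M.gammaMin_le h' u
      rw [Matrix.of_apply, abs_div, abs_of_pos (hγ.trans_le this), div_eq_inv_mul]
      gcongr
    calc _ ≤ M.gammaMin * (M.gammaMin⁻¹ * frobNorm (M.Delta h' g)) :=
          mul_le_mul hle h1 (frobNorm_nonneg _) hγ.le
      _ = _ := by field_simp

/-- The bound on the edges passes to all pairs of hidden variables. -/
theorem A4.frobNorm_le (hM : ∑ x, M.obs x = 1) (h2 : M.A2) (h4 : M.A4) {h g : H} (hne : h ≠ g) :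
    frobNorm (M.Delta h g) ≤ M.thetaMin / ((k : ℝ) ^ 2 + k) := by
  induction hn : M.tree.dist (Sum.inr g) (Sum.inr h) generalizing h with
  | zero => exact absurd (M.isTree.eq_of_dist hn) (by simpa using hne.symm)
  | succ N ih =>
    obtain ⟨v, hv, hd⟩ := M.isTree.exists_adj_toward (x := Sum.inr h) (y := Sum.inr g)
      (by simpa using hne)
    by_cases hvg : v = Sum.inr g
    · subst hvg
      exact (h4 h g hv).trans (min_le_left _ _)
    · have hp : OnPath M.tree (Sum.inr h) v (Sum.inr g) := by
        have := SimpleGraph.dist_eq_one_iff_adj.2 hv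
        have := M.tree.dist_comm (u := Sum.inr g) (v := v)
        have := M.tree.dist_comm (u := Sum.inr g) (v := Sum.inr h)
        unfold OnPath
        omega
      obtain ⟨h', rfl⟩ := (M.isTrivalent h2).exists_inr_of_onPath hp hv.ne (Ne.symm hvg)
      exact (M.frobNorm_Delta_le hM (fun e => hv.ne (congrArg _ e)) hp
        ((h4 h h' hv).trans (min_le_right _ _))).trans
          (ih (fun e => hvg (congrArg _ e)) (by omega))

/-- The loss `2 k ‖Δ‖_F` is at most `θ`, because `2 k ≤ k² + k` for `k ≥ 1`; a prior with total mass
1 excludes `k = 0`. -/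
theorem alpha_nonneg (hM : ∑ x, M.obs x = 1) (h2 : M.A2) (h4 : M.A4 ∨ M.QuartetwiseA4)
    (q : Quartet M.tree) : 0 ≤ M.alpha q := by
  obtain ⟨h, g, hne, hq, hh, hg⟩ := (M.isTrivalent h2).exists_branchPoints q.2.1 q.2.2
  refine le_trans ?_ (M.theta_sub_le_alpha hq)
  have hk : (1 : ℝ) ≤ k := by
    rcases k.eq_zero_or_pos with rfl | hk
    · simpa using M.prior_sum
    · exact_mod_cast hk
  have hpos : 0 < (k : ℝ) ^ 2 + k := by positivity
  have key : frobNorm (M.Delta h g) ≤ M.theta q / ((k : ℝ) ^ 2 + k) := by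
    rcases h4 with h4 | h4
    · refine (A4.frobNorm_le M hM h2 h4 hne).trans ?_
      have := M.thetaMin_le q
      gcongr
    · exact h4 q h g hh hg
  rw [le_div_iff₀ hpos] at key
  have := frobNorm_nonneg (M.Delta h g)
  nlinarith [mul_nonneg this (mul_nonneg (sub_nonneg.2 hk) (zero_le_one.trans hk))]

theorem alphaMin_nonneg (hM : ∑ x, M.obs x = 1) (h2 : M.A2) (h4 : M.A4 ∨ M.QuartetwiseA4) :
    0 ≤ M.alphaMin := Real.iInf_nonneg fun q => M.alpha_nonneg hM h2 h4 q

end LatentTreeModel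

/-! ### Expectations over i.i.d. samples from a finite type -/

section

variable {α : Type*} [Fintype α]

/-- The expectation of a function of `m` i.i.d. samples with the law `p`. -/
noncomputable def iidMean (p : α → ℝ) {m : ℕ} (f : (Fin m → α) → ℝ) : ℝ :=
  ∑ x : Fin m → α, (∏ l, p (x l)) * f x

variable {p : α → ℝ} {m : ℕ}

theorem iidMean_succ (f : (Fin (m + 1) → α) → ℝ) :
    iidMean p f = iidMean p fun y : Fin m → α => ∑ a, p a * f (Fin.cons a y) := by
  unfold iidMean
  rw [← Equiv.sum_comp (Fin.consEquiv fun _ => α), Fintype.sum_prod_type, Finset.sum_comm]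
  refine Finset.sum_congr rfl fun y _ => ?_
  rw [Finset.mul_sum]
  refine Finset.sum_congr rfl fun a _ => ?_
  rw [show (Fin.consEquiv fun _ => α) (a, y) = Fin.cons a y from rfl, Fin.prod_univ_succ]
  simp only [Fin.cons_zero, Fin.cons_succ]
  ring

theorem iidMean_mono (hp : ∀ a, 0 ≤ p a) {f g : (Fin m → α) → ℝ} (h : ∀ x, f x ≤ g x) :
    iidMean p f ≤ iidMean p g :=
  Finset.sum_le_sum fun x _ => mul_le_mul_of_nonneg_left (h x) (Finset.prod_nonneg fun _ _ => hp _)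

theorem iidMean_add (f g : (Fin m → α) → ℝ) :
    iidMean p (fun x => f x + g x) = iidMean p f + iidMean p g := by
  simp only [iidMean, mul_add, Finset.sum_add_distrib]

theorem iidMean_mul_left (c : ℝ) (f : (Fin m → α) → ℝ) :
    iidMean p (fun x => c * f x) = c * iidMean p f := by
  simp only [iidMean, Finset.mul_sum]
  exact Finset.sum_congr rfl fun _ _ => by ring

theorem iidMean_sum {ι : Type*} (s : Finset ι) (f : ι → (Fin m → α) → ℝ) :
    iidMean p (fun x => ∑ i ∈ s, f i x) = ∑ i ∈ s, iidMean p (f i) := by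
  simp only [iidMean, Finset.mul_sum]
  exact Finset.sum_comm

theorem iidMean_const (h1 : ∑ a, p a = 1) (c : ℝ) :
    iidMean p (fun _ : Fin m → α => c) = c := by
  induction m with
  | zero => simp [iidMean]
  | succ m ih =>
    rw [iidMean_succ]
    simp only [← Finset.sum_mul, h1, one_mul, ih]

/-- The second moment of a sum of independent centred variables. -/
theorem iidMean_sum_sq (h1 : ∑ a, p a = 1) {φ : α → ℝ} (h0 : ∑ a, p a * φ a = 0) :
    iidMean p (fun x : Fin m → α => (∑ l, φ (x l)) ^ 2) = m * ∑ a, p a * φ a ^ 2 := by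
  induction m with
  | zero => simp [iidMean]
  | succ m ih =>
    rw [iidMean_succ]
    have key : ∀ y : Fin m → α, ∑ a, p a * (∑ l, φ ((Fin.cons a y : Fin (m + 1) → α) l)) ^ 2 =
        (∑ a, p a * φ a ^ 2) + (∑ l, φ (y l)) ^ 2 := by
      intro y
      simp only [Fin.sum_univ_succ, Fin.cons_zero, Fin.cons_succ]
      have : ∀ a, p a * (φ a + ∑ l, φ (y l)) ^ 2 = p a * φ a ^ 2 +
          (p a * φ a) * (2 * ∑ l, φ (y l)) + p a * (∑ l, φ (y l)) ^ 2 := fun a => by ring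
      simp only [this, Finset.sum_add_distrib, ← Finset.sum_mul, h0, h1]
      ring
    simp only [key]
    rw [iidMean_add, ih, iidMean_const h1]
    push_cast
    ring

open MeasureTheory ProbabilityTheory in
/-- Hoeffding's lemma. -/
theorem sum_mul_exp_le (hp : ∀ a, 0 ≤ p a) (h1 : ∑ a, p a = 1) {h : α → ℝ} {c : ℝ}
    (hc : ∀ a b, h a - h b ≤ c) (t : ℝ) :
    ∑ a, p a * Real.exp (t * (h a - ∑ b, p b * h b)) ≤ Real.exp (c ^ 2 * t ^ 2 / 8) := by
  let _ : MeasurableSpace α := ⊤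
  have hne : Nonempty α := by
    by_contra hn
    rw [not_nonempty_iff] at hn
    simp at h1
  obtain ⟨a₀, ha₀⟩ := Finite.exists_min h
  have hs : ∑ a, ENNReal.ofReal (p a) = 1 := by
    rw [← ENNReal.ofReal_sum_of_nonneg fun a _ => hp a, h1, ENNReal.ofReal_one]
  set q := PMF.ofFintype _ hs with hq
  have hint : ∀ f : α → ℝ, ∫ a, f a ∂q.toMeasure = ∑ a, p a * f a := by
    intro f
    rw [PMF.integral_eq_sum]
    refine Finset.sum_congr rfl fun a _ => ?_
    rw [hq, PMF.ofFintype_apply, ENNReal.toReal_ofReal (hp a), smul_eq_mul]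
  have key := (hasSubgaussianMGF_of_mem_Icc (μ := q.toMeasure) (X := h) (a := h a₀)
    (b := h a₀ + c) (measurable_from_top.aemeasurable)
    (Filter.Eventually.of_forall fun a => ⟨ha₀ a, by linarith [hc a a₀]⟩)).mgf_le t
  unfold mgf at key
  rw [hint, hint] at key
  refine key.trans (le_of_eq ?_)
  congr 1
  simp only [add_sub_cancel_left, NNReal.coe_pow, NNReal.coe_div, coe_nnnorm, NNReal.coe_ofNat,
    div_pow, Real.norm_eq_abs, sq_abs]
  ring

/-- A function of independent variables with bounded differences is subgaussian. -/
theorem iidMean_exp_le (hp : ∀ a, 0 ≤ p a) (h1 : ∑ a, p a = 1) {c : ℝ} {f : (Fin m → α) → ℝ}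
    (hc : ∀ x l a, f (Function.update x l a) - f x ≤ c) (t : ℝ) :
    iidMean p (fun x => Real.exp (t * (f x - iidMean p f))) ≤
      Real.exp (m * (c ^ 2 * t ^ 2 / 8)) := by
  induction m with
  | zero => simp [iidMean]
  | succ m ih =>
    -- Averaging over the first sample keeps the bounded differences. Hoeffding's lemma controls the
    -- deviation of `f` from this average, and induction controls the average.
    set g : (Fin m → α) → ℝ := fun y => ∑ a, p a * f (Fin.cons a y) with hg
    have hgc : ∀ y l a, g (Function.update y l a) - g y ≤ c := by
      intro y l a
      simp only [hg]
      rw [← Finset.sum_sub_distrib]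
      calc _ ≤ ∑ b, p b * c := Finset.sum_le_sum fun b _ => by
            rw [← mul_sub]
            refine mul_le_mul_of_nonneg_left ?_ (hp b)
            have := hc (Fin.cons b y) l.succ a
            rwa [← Fin.cons_update (α := fun _ => α) b y l a] at this
        _ = c := by rw [← Finset.sum_mul, h1, one_mul]
    rw [iidMean_succ]
    have hmean : iidMean p f = iidMean p g := iidMean_succ f
    rw [hmean]
    calc _ ≤ iidMean p fun y => Real.exp (c ^ 2 * t ^ 2 / 8) *
            Real.exp (t * (g y - iidMean p g)) := by
          refine iidMean_mono hp fun y => ?_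
          have key := sum_mul_exp_le hp h1 (h := fun a => f (Fin.cons a y)) (c := c) (fun a b => by
            have := hc (Fin.cons b y) 0 a
            rwa [Fin.update_cons_zero] at this) t
          refine le_trans (le_of_eq ?_) (mul_le_mul_of_nonneg_right key (Real.exp_nonneg _))
          rw [Finset.sum_mul]
          refine Finset.sum_congr rfl fun a _ => ?_
          rw [mul_assoc, ← Real.exp_add]
          congr 2
          simp only [hg]
          ring
      _ ≤ _ := by
          rw [iidMean_mul_left]
          refine (mul_le_mul_of_nonneg_left (ih hgc) (Real.exp_nonneg _)).trans (le_of_eq ?_)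
          rw [← Real.exp_add]
          congr 1
          push_cast
          ring

/-! ### Empirical matrices -/

variable {ι : Type*} [Fintype ι] [DecidableEq ι]

/-- The expectation of the matrix with a single entry `1` at the place `cell a`. -/
noncomputable def meanMatrix (p : α → ℝ) (cell : α → ι × ι) : Matrix ι ι ℝ :=
  Matrix.of fun r s => ∑ a, if cell a = (r, s) then p a else 0

/-- The mean over the sample `x` of the matrices with a single entry `1` at the place `cell a`. -/
noncomputable def sampleMatrix (cell : α → ι × ι) (x : Fin m → α) : Matrix ι ι ℝ :=
  Matrix.of fun r s => (∑ l, if cell (x l) = (r, s) then (1 : ℝ) else 0) / m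

/-- The change is the difference of two matrix units, each of nuclear norm at most 1, divided by
`m`. -/
theorem nuclearNorm_sampleMatrix_update_le {α : Type*} (cell : α → ι × ι) (x : Fin m → α) (l : Fin m) (a : α) :
    nuclearNorm (sampleMatrix cell (Function.update x l a) - sampleMatrix cell x) ≤ 2 / m := by
  have hone : ∀ c : ι × ι,
      nuclearNorm (Matrix.vecMulVec (Pi.single c.1 (1 : ℝ)) (Pi.single c.2 1)) ≤ 1 := fun c =>
    LatentTreeModel.nuclearNorm_vecMulVec_le_one (by simp [Pi.single_apply])
      (by simp [Pi.single_apply])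
  have he : sampleMatrix cell (Function.update x l a) - sampleMatrix cell x =
      (1 / m : ℝ) • Matrix.vecMulVec (Pi.single (cell a).1 (1 : ℝ)) (Pi.single (cell a).2 1) +
      (-(1 / m) : ℝ) • Matrix.vecMulVec (Pi.single (cell (x l)).1 (1 : ℝ))
        (Pi.single (cell (x l)).2 1) := by
    ext r s
    have hsingle : ∀ c : ι × ι, Matrix.vecMulVec (Pi.single c.1 (1 : ℝ)) (Pi.single c.2 1) r s =
        if c = (r, s) then (1 : ℝ) else 0 := by
      intro c
      simp only [Matrix.vecMulVec_apply, Pi.single_apply, Prod.ext_iff, eq_comm (a := r),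
        eq_comm (a := s)]
      split_ifs <;> simp_all
    have hsum : ∀ y : Fin m → α, ∑ l', (if cell (y l') = (r, s) then (1 : ℝ) else 0) =
        (if cell (y l) = (r, s) then (1 : ℝ) else 0) +
          ∑ l' ∈ Finset.univ.erase l, (if cell (y l') = (r, s) then (1 : ℝ) else 0) := fun y =>
      (Finset.add_sum_erase _ _ (Finset.mem_univ l)).symm
    have hrest : ∑ l' ∈ Finset.univ.erase l,
        (if cell (Function.update x l a l') = (r, s) then (1 : ℝ) else 0) =
        ∑ l' ∈ Finset.univ.erase l, (if cell (x l') = (r, s) then (1 : ℝ) else 0) := by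
      refine Finset.sum_congr rfl fun l' hl' => ?_
      rw [Function.update_of_ne (Finset.ne_of_mem_erase hl')]
    simp only [sampleMatrix, Matrix.sub_apply, Matrix.add_apply, Matrix.smul_apply, smul_eq_mul,
      Matrix.of_apply, hsingle, hsum (Function.update x l a), hsum x, hrest, Function.update_self]
    ring
  rw [he]
  refine (nuclearNorm_add_le _ _).trans ?_
  have e1 := (nuclearNorm_smul_le (1 / m : ℝ) (Matrix.vecMulVec (Pi.single (cell a).1 (1 : ℝ))
    (Pi.single (cell a).2 1))).trans (mul_le_of_le_one_right (abs_nonneg _) (hone _))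
  have e2 := (nuclearNorm_smul_le (-(1 / m) : ℝ) (Matrix.vecMulVec
    (Pi.single (cell (x l)).1 (1 : ℝ)) (Pi.single (cell (x l)).2 1))).trans
      (mul_le_of_le_one_right (abs_nonneg _) (hone _))
  rw [abs_neg] at e2
  rw [abs_of_nonneg (by positivity)] at e1 e2
  calc _ ≤ (1 / m : ℝ) + 1 / m := add_le_add e1 e2
    _ = 2 / m := by ring

/-- An entry with probability `P` has the variance `(P - P²) / m`, and the probabilities add up to
1. -/
theorem iidMean_frobNorm_sq_le (h1 : ∑ a, p a = 1) (hm : 0 < m)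
    (cell : α → ι × ι) :
    iidMean p (fun x : Fin m → α => frobNorm (sampleMatrix cell x - meanMatrix p cell) ^ 2) ≤
      1 / m := by
  have hm' : (0 : ℝ) < m := Nat.cast_pos.2 hm
  have hsq : ∀ x : Fin m → α, frobNorm (sampleMatrix cell x - meanMatrix p cell) ^ 2 =
      ∑ e : ι × ι, (1 / m : ℝ) ^ 2 * (∑ l, ((if cell (x l) = e then (1 : ℝ) else 0) -
        ∑ a, if cell a = e then p a else 0)) ^ 2 := by
    intro x
    have h0 : 0 ≤ ∑ r, ∑ s, (sampleMatrix cell x - meanMatrix p cell) r s ^ 2 :=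
      Finset.sum_nonneg fun _ _ => Finset.sum_nonneg fun _ _ => sq_nonneg _
    unfold frobNorm
    rw [Real.sq_sqrt h0, Fintype.sum_prod_type]
    refine Finset.sum_congr rfl fun r _ => Finset.sum_congr rfl fun s _ => ?_
    rw [← mul_pow, Finset.sum_sub_distrib]
    simp only [sampleMatrix, meanMatrix, Matrix.sub_apply, Matrix.of_apply, Finset.sum_const,
      Finset.card_univ, Fintype.card_fin, nsmul_eq_mul]
    field_simp
  simp only [hsq]
  rw [iidMean_sum]
  have hcell : ∀ e : ι × ι, iidMean p (fun x : Fin m → α => (1 / m : ℝ) ^ 2 *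
      (∑ l, ((if cell (x l) = e then (1 : ℝ) else 0) - ∑ a, if cell a = e then p a else 0)) ^ 2) ≤
      1 / m * ∑ a, if cell a = e then p a else 0 := by
    intro e
    have hP : ∑ a, p a * (if cell a = e then (1 : ℝ) else 0) =
        ∑ a, if cell a = e then p a else 0 := by simp
    generalize (∑ a, if cell a = e then p a else 0) = P at hP ⊢
    rw [iidMean_mul_left, iidMean_sum_sq (φ := fun a => (if cell a = e then (1 : ℝ) else 0) - P) h1]
    · have : ∀ a, p a * ((if cell a = e then (1 : ℝ) else 0) - P) ^ 2 =
          (p a * if cell a = e then (1 : ℝ) else 0) * (1 - 2 * P) + p a * P ^ 2 := by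
        intro a
        split_ifs <;> ring
      simp only [this, Finset.sum_add_distrib, ← Finset.sum_mul, hP, h1]
      have : (1 / m : ℝ) ^ 2 * (m * (P * (1 - 2 * P) + 1 * P ^ 2)) =
          1 / m * P - 1 / m * P ^ 2 := by
        field_simp
        ring
      rw [this]
      have : 0 ≤ 1 / m * P ^ 2 := by positivity
      linarith
    · simp only [mul_sub, Finset.sum_sub_distrib, hP, ← Finset.sum_mul, h1]
      ring
  refine (Finset.sum_le_sum fun e _ => hcell e).trans (le_of_eq ?_)
  rw [← Finset.mul_sum, Finset.sum_comm]
  simp [h1]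

/-- Instead of Jensen's inequality, the pointwise bound `F ≤ √m / 2 * F² + 1 / (2 √m)` is averaged.
-/
theorem iidMean_frobNorm_le (hp : ∀ a, 0 ≤ p a) (h1 : ∑ a, p a = 1) (hm : 0 < m)
    (cell : α → ι × ι) :
    iidMean p (fun x : Fin m → α => frobNorm (sampleMatrix cell x - meanMatrix p cell)) ≤
      1 / √m := by
  have hm' : (0 : ℝ) < √m := Real.sqrt_pos.2 (Nat.cast_pos.2 hm)
  have hsq : √(m : ℝ) ^ 2 = m := Real.sq_sqrt (Nat.cast_nonneg m)
  calc _ ≤ iidMean p (fun x : Fin m → α =>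
          √m / 2 * frobNorm (sampleMatrix cell x - meanMatrix p cell) ^ 2 + 1 / (2 * √m)) := by
        refine iidMean_mono hp fun x => ?_
        generalize frobNorm (sampleMatrix cell x - meanMatrix p cell) = F
        have : √(m : ℝ) / 2 * F ^ 2 + 1 / (2 * √m) - F = (√m * F - 1) ^ 2 / (2 * √m) := by
          field_simp
          ring
        have : 0 ≤ (√(m : ℝ) * F - 1) ^ 2 / (2 * √m) := by positivity
        linarith
    _ ≤ √m / 2 * (1 / m) + 1 / (2 * √m) := by
        rw [iidMean_add, iidMean_mul_left, iidMean_const h1]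
        gcongr
        exact iidMean_frobNorm_sq_le h1 hm cell
    _ = 1 / √m := by
        rw [← hsq, Real.sqrt_sq hm'.le]
        field_simp
        ring

open Classical in
/-- A gap between the nuclear norms of two matrices is visible in the sample. -/
theorem iidMean_nuclearNorm_le (hp : ∀ a, 0 ≤ p a) (h1 : ∑ a, p a = 1) (hm : 0 < m)
    (cell cell' : α → ι × ι) {g : ℝ}
    (hg : g ≤ nuclearNorm (meanMatrix p cell') - nuclearNorm (meanMatrix p cell))
    (hlarge : 4 * √(Fintype.card ι) ≤ √m * g) :
    iidMean p (fun x : Fin m → α =>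
      if nuclearNorm (sampleMatrix cell' x) ≤ nuclearNorm (sampleMatrix cell x) then 1 else 0) ≤
      Real.exp (-(1 / 32) * m * g ^ 2) := by
  have hm' : (0 : ℝ) < m := Nat.cast_pos.2 hm
  have hs : (0 : ℝ) < √m := Real.sqrt_pos.2 hm'
  have hcard : 0 ≤ 4 * √(Fintype.card ι : ℝ) := by positivity
  have hg0 : 0 ≤ g := nonneg_of_mul_nonneg_right (hcard.trans hlarge) hs
  set f : (Fin m → α) → ℝ := fun x =>
    nuclearNorm (sampleMatrix cell x) - nuclearNorm (sampleMatrix cell' x) with hf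
  have hdiff : ∀ x l a, f (Function.update x l a) - f x ≤ 4 / m := by
    intro x l a
    have e1 := (abs_le.1 ((abs_nuclearNorm_sub_le _ _).trans
      (nuclearNorm_sampleMatrix_update_le cell x l a))).2
    have e2 := (abs_le.1 ((abs_nuclearNorm_sub_le _ _).trans
      (nuclearNorm_sampleMatrix_update_le cell' x l a))).1
    have : (4 / m : ℝ) = 2 / m + 2 / m := by ring
    simp only [hf]
    linarith
  -- The two errors of expectation cost at most `2 √(card ι) / √m`, which by `hlarge` is at most
  -- half of the gap.
  have hmean : iidMean p f ≤ -(g / 2) := by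
    calc iidMean p f ≤ iidMean p fun x => -g + √(Fintype.card ι) *
          (frobNorm (sampleMatrix cell x - meanMatrix p cell) +
            frobNorm (sampleMatrix cell' x - meanMatrix p cell')) := by
          refine iidMean_mono hp fun x => ?_
          have e1 := (abs_le.1 ((abs_nuclearNorm_sub_le (sampleMatrix cell x) (meanMatrix p cell)).trans
            (nuclearNorm_le_sqrt_card_mul_frobNorm _))).2
          have e2 := (abs_le.1 ((abs_nuclearNorm_sub_le (sampleMatrix cell' x)
            (meanMatrix p cell')).trans (nuclearNorm_le_sqrt_card_mul_frobNorm _))).1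
          simp only [hf]
          linarith
      _ ≤ -g + √(Fintype.card ι) * (1 / √m + 1 / √m) := by
          rw [iidMean_add, iidMean_const h1, iidMean_mul_left, iidMean_add]
          gcongr
          · exact iidMean_frobNorm_le hp h1 hm cell
          · exact iidMean_frobNorm_le hp h1 hm cell'
      _ ≤ -(g / 2) := by
          have : √(Fintype.card ι : ℝ) * (1 / √m + 1 / √m) ≤ g / 2 := by
            rw [show √(Fintype.card ι : ℝ) * (1 / √m + 1 / √m) =
              2 * √(Fintype.card ι : ℝ) / √m by ring, div_le_iff₀ hs]
            linarith
          linarith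
  -- This minimises the exponent `-t g / 2 + 2 t² / m`, with the value `-m g² / 32`.
  set t : ℝ := m * g / 8 with ht
  have ht0 : 0 ≤ t := by positivity
  calc _ ≤ iidMean p fun x => Real.exp (-(t * (g / 2))) *
          Real.exp (t * (f x - iidMean p f)) := by
        refine iidMean_mono hp fun x => ?_
        rw [← Real.exp_add]
        split_ifs with hx
        · refine Real.one_le_exp ?_
          have : 0 ≤ f x := sub_nonneg.2 hx
          have := mul_nonneg ht0 (show 0 ≤ f x - iidMean p f - g / 2 by linarith)
          linarith
        · exact Real.exp_nonneg _
    _ ≤ Real.exp (-(t * (g / 2))) * Real.exp (m * ((4 / m : ℝ) ^ 2 * t ^ 2 / 8)) := by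
        rw [iidMean_mul_left]
        exact mul_le_mul_of_nonneg_left (iidMean_exp_le hp h1 hdiff t) (Real.exp_nonneg _)
    _ = _ := by
        rw [← Real.exp_add]
        congr 1
        rw [ht]
        field_simp
        ring

end

/-! ### The quartet test -/

section

variable {d n m : ℕ}

/-- The entry of the `j`-th unfolding to which an observation contributes. -/
def quartetCell (q : Fin 4 → Fin d) : Fin 3 → (Fin d → Fin n) → (Fin n × Fin n) × (Fin n × Fin n)
  | 0, a => ((a (q 0), a (q 1)), (a (q 2), a (q 3)))
  | 1, a => ((a (q 0), a (q 2)), (a (q 1), a (q 3)))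
  | 2, a => ((a (q 0), a (q 3)), (a (q 1), a (q 2)))

theorem unfolding_empirical4 (data : Fin m → Fin d → Fin n) (q : Fin 4 → Fin d) (j : Fin 3) :
    unfolding (empirical4 data q) j = sampleMatrix (quartetCell q j) data := by
  ext r s
  fin_cases j <;>
  · simp only [unfolding, empirical4, sampleMatrix, quartetCell, Matrix.of_apply, Prod.ext_iff]
    congr 1
    refine Finset.sum_congr rfl fun l _ => if_congr (by tauto) rfl rfl

theorem LatentTreeModel.unfolding_table4 {k : ℕ} {H : Type*} [Fintype H]
    (M : LatentTreeModel d n k H) (q : Fin 4 → Fin d) (j : Fin 3) :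
    unfolding (M.table4 q) j = meanMatrix M.obs (quartetCell q j) := by
  ext r s
  fin_cases j <;>
  · simp only [unfolding, LatentTreeModel.table4, meanMatrix, quartetCell, Matrix.of_apply,
      Prod.ext_iff]
    refine Finset.sum_congr rfl fun l _ => if_congr (by tauto) rfl rfl

/-- After `regroup`, an unfolding may list the second pair in the opposite order, which only
permutes columns. -/
theorem nuclearNorm_sampleMatrix_swap {α ι : Type*} [Fintype ι] [DecidableEq ι]
    (cell : α → (ι × ι) × (ι × ι)) (x : Fin m → α) :
    nuclearNorm (sampleMatrix (fun a => ((cell a).1, (cell a).2.swap)) x) =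
      nuclearNorm (sampleMatrix cell x) := by
  rw [← nuclearNorm_submatrix (sampleMatrix cell x) (Equiv.refl _) (Equiv.prodComm _ _)]
  congr 1
  ext r s
  simp only [sampleMatrix, Matrix.submatrix_apply, Matrix.of_apply]
  congr 1
  refine Finset.sum_congr rfl fun l _ => if_congr ?_ rfl rfl
  simp only [Prod.ext_iff, Prod.fst_swap, Prod.snd_swap, Equiv.refl_apply, Equiv.prodComm_apply]
  tauto

/-- The test answers `j` if the grouping `j` has the smallest norm of the three. -/
theorem quartetTest_eq {argmin : (Fin 3 → ℝ) → Fin 3} (hmin : ∀ (a : Fin 3 → ℝ) (i : Fin 3), a (argmin a) ≤ a i)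
    {data : Fin m → Fin d → Fin n} {q : Fin 4 → Fin d} {j : Fin 3}
    (h : ∀ i : Fin 2, nuclearNorm (sampleMatrix (quartetCell (q ∘ regroup j) 0) data) <
      nuclearNorm (sampleMatrix (quartetCell (q ∘ regroup j) i.succ) data)) :
    quartetTest argmin data q = j := by
  unfold quartetTest
  simp only [unfolding_empirical4]
  have key := hmin (fun i => nuclearNorm (sampleMatrix (quartetCell q i) data)) j
  have s := fun i => nuclearNorm_sampleMatrix_swap (quartetCell q i) data
  generalize argmin _ = i at key ⊢
  have h0 := h 0
  have h1 := h 1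
  by_contra hne
  revert key
  rw [imp_false, not_le]
  fin_cases j <;> fin_cases i <;> first | exact absurd rfl hne | skip
  · exact h0
  · exact h1
  · exact h0
  · exact h1.trans_eq (s 2)
  · exact h0.trans_eq (s 0)
  · exact h1.trans_eq (s 1)

end

/-! ### Recovery of the topology -/

section

open MeasureTheory ProbabilityTheory

variable {d n k m : ℕ} {H : Type*} [Fintype H] {M : LatentTreeModel d n k H} {β : ℝ}

theorem LatentTreeModel.obs_nonneg (x : Fin d → Fin n) : 0 ≤ M.obs x := by
  classical
  exact Finset.sum_nonneg fun z _ => joint_nonneg x z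

theorem regroup_injective (j : Fin 3) : Function.Injective (regroup j) := by
  fin_cases j <;> decide

open Classical in
/-- The probability that the algorithm fails, for a fixed rule for its choices. -/
theorem iidMean_failure_le (hd : 4 ≤ d) (hβ : 1 / 2 ≤ β) (hβ' : β < 1) (ρ : ChoiceRule d β)
    (hM : ∑ x, M.obs x = 1) (h2 : M.A2) (h4 : M.A4 ∨ M.QuartetwiseA4) (hm : 0 < m)
    (hlarge : 16 * (n : ℝ) ^ 2 ≤ m * M.alphaMin ^ 2) :
    iidMean M.obs (fun x : Fin m → Fin d → Fin n =>
      if SameTopology (BuildTree.output hd ρ x) M.tree then 0 else 1) ≤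
      6 * ((1 + 2 * searchRate β) * (d * Real.log d)) *
        Real.exp (-(1 / 32) * m * M.alphaMin ^ 2) := by
  have : Nonempty H := ⟨M.root⟩
  obtain ⟨Q, hQ, hcard, hgood⟩ := exists_tests (M.isTrivalent h2) hd hβ hβ' ρ
  have hα := M.alphaMin_nonneg hM h2 h4
  have hlarge' : 4 * √(Fintype.card (Fin n × Fin n)) ≤ √m * M.alphaMin := by
    have h := Real.sqrt_le_sqrt hlarge
    rw [Real.sqrt_mul (Nat.cast_nonneg m), Real.sqrt_sq hα,
      show 16 * (n : ℝ) ^ 2 = (4 * n) ^ 2 by ring, Real.sqrt_sq (by positivity)] at h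
    simpa using h
  have htest : ∀ q ∈ Q, ∀ j, Answer M.tree q j → ∀ i : Fin 2,
      iidMean M.obs (fun x : Fin m → Fin d → Fin n =>
        if nuclearNorm (sampleMatrix (quartetCell (q ∘ regroup j) i.succ) x) ≤
          nuclearNorm (sampleMatrix (quartetCell (q ∘ regroup j) 0) x) then 1 else 0) ≤
        Real.exp (-(1 / 32) * m * M.alphaMin ^ 2) := by
    intro q hq j hj i
    refine iidMean_nuclearNorm_le (fun _ => LatentTreeModel.obs_nonneg _) hM hm _ _ ?_ hlarge'
    refine (M.alphaMin_le ⟨q ∘ regroup j, (hQ q hq).comp (regroup_injective j), hj⟩).trans ?_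
    rw [← M.unfolding_table4, ← M.unfolding_table4]
    fin_cases i
    · exact min_le_left _ _
    · exact min_le_right _ _
  -- A failure means that in some test of `Q` a wrong grouping has a norm not above that of the
  -- correct one. The correct `j` enters through an indicator, so the union bound has `3 * 2 = 6`
  -- terms per test.
  calc _ ≤ iidMean M.obs fun x : Fin m → Fin d → Fin n => ∑ q ∈ Q, ∑ j, ∑ i : Fin 2,
        if Answer M.tree q j ∧ nuclearNorm (sampleMatrix (quartetCell (q ∘ regroup j) i.succ) x) ≤
          nuclearNorm (sampleMatrix (quartetCell (q ∘ regroup j) 0) x) then 1 else 0 := by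
        refine iidMean_mono (fun _ => LatentTreeModel.obs_nonneg _) fun x => ?_
        have h0 : ∀ q j (i : Fin 2), (0 : ℝ) ≤ if Answer M.tree q j ∧
          nuclearNorm (sampleMatrix (quartetCell (q ∘ regroup j) i.succ) x) ≤
          nuclearNorm (sampleMatrix (quartetCell (q ∘ regroup j) 0) x) then 1 else 0 := by
          intro q j i
          split_ifs <;> norm_num
        split_ifs with hx
        · exact Finset.sum_nonneg fun q _ => Finset.sum_nonneg fun j _ =>
            Finset.sum_nonneg fun i _ => h0 q j i
        · have : ¬TestsCorrect M.tree ρ.argmin x Q := fun h => hx (hgood n m x h)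
          unfold TestsCorrect at this
          push Not at this
          obtain ⟨q, hq, j, hj, hne⟩ := this
          have : ∃ i : Fin 2, nuclearNorm (sampleMatrix (quartetCell (q ∘ regroup j) i.succ) x) ≤
              nuclearNorm (sampleMatrix (quartetCell (q ∘ regroup j) 0) x) := by
            by_contra! h
            exact hne (quartetTest_eq ρ.argmin_le h)
          obtain ⟨i, hi⟩ := this
          refine le_trans ?_ (Finset.single_le_sum (fun q _ => Finset.sum_nonneg fun j _ =>
            Finset.sum_nonneg fun i _ => h0 q j i) hq)
          refine le_trans ?_ (Finset.single_le_sum (fun j _ =>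
            Finset.sum_nonneg fun i _ => h0 q j i) (Finset.mem_univ j))
          refine le_trans ?_ (Finset.single_le_sum (fun i _ => h0 q j i) (Finset.mem_univ i))
          rw [if_pos ⟨hj, hi⟩]
    _ ≤ ∑ q ∈ Q, ∑ j : Fin 3, ∑ i : Fin 2, Real.exp (-(1 / 32) * m * M.alphaMin ^ 2) := by
        rw [iidMean_sum]
        refine Finset.sum_le_sum fun q hq => ?_
        rw [iidMean_sum]
        refine Finset.sum_le_sum fun j _ => ?_
        rw [iidMean_sum]
        refine Finset.sum_le_sum fun i _ => ?_
        by_cases hj : Answer M.tree q j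
        · simpa only [hj, true_and] using htest q hq j hj i
        · simp only [hj, false_and, if_false]
          rw [iidMean_const hM]
          exact Real.exp_nonneg _
    _ = 6 * Q.card * Real.exp (-(1 / 32) * m * M.alphaMin ^ 2) := by
        simp only [Finset.sum_const, Finset.card_univ, Fintype.card_fin, nsmul_eq_mul]
        push_cast
        ring
    _ ≤ _ := by gcongr

variable {Ω S : Type*} [MeasurableSpace Ω] [MeasurableSpace S] {μ : Measure Ω}
  [IsProbabilityMeasure μ] {X : Fin m → Ω → Fin d → Fin n} {ξ : Ω → S}

namespace IsSampling

/-- The table is the law of a sample under a probability measure, so its total mass is 1; this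
requires at least one sample. -/
theorem sum_obs (h : IsSampling M μ X ξ) (hm : 0 < m) : ∑ x, M.obs x = 1 := by
  have key := h.law_sample ⟨0, hm⟩
  simp only [← key]
  have := sum_measureReal_preimage_singleton (μ := μ) (Finset.univ : Finset (Fin d → Fin n))
    (f := X ⟨0, hm⟩) fun y _ => h.measurable_sample _ (measurableSet_singleton y)
  exact this.trans (by simp)

theorem measureReal_eq_iidMean (h : IsSampling M μ X ξ) (B : Set (Fin m → Fin d → Fin n)) :
    μ.real ((fun ω l => X l ω) ⁻¹' B) = iidMean M.obs (B.indicator 1) := by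
  classical
  have hmeas : Measurable fun ω l => X l ω := measurable_pi_lambda _ h.measurable_sample
  have hpoint : ∀ x : Fin m → Fin d → Fin n,
      μ.real ((fun ω l => X l ω) ⁻¹' {x}) = ∏ l, M.obs (x l) := by
    intro x
    have := h.iIndepFun_sample.measure_inter_preimage_eq_mul Finset.univ
      (sets := fun l => {x l}) fun l _ => measurableSet_singleton _
    have he : (fun ω l => X l ω) ⁻¹' {x} = ⋂ l ∈ Finset.univ, X l ⁻¹' {x l} := by
      ext ω
      simp [funext_iff]
    rw [he, Measure.real, this, ENNReal.toReal_prod]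
    exact Finset.prod_congr rfl fun l _ => h.law_sample l (x l)
  have := sum_measureReal_preimage_singleton (μ := μ)
    (Finset.univ.filter (· ∈ B)) (f := fun ω l => X l ω)
    fun y _ => hmeas (measurableSet_singleton y)
  rw [Finset.coe_filter] at this
  simp only [Finset.mem_univ, true_and, Set.ofPred_mem_eq] at this
  rw [← this, Finset.sum_filter]
  refine Finset.sum_congr rfl fun x _ => ?_
  by_cases hx : x ∈ B <;> simp [hx, hpoint]

/-- The probability of an event that depends on the samples and on the independent seed. -/
theorem measureReal_le (h : IsSampling M μ X ξ) [Countable S] [MeasurableSingletonClass S]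
    (B : S → Set (Fin m → Fin d → Fin n)) {ε : ℝ} (hε : 0 ≤ ε)
    (hB : ∀ s, iidMean M.obs ((B s).indicator 1) ≤ ε) :
    μ.real {ω | (fun l => X l ω) ∈ B (ξ ω)} ≤ ε := by
  have hsub : {ω | (fun l => X l ω) ∈ B (ξ ω)} ⊆
      ⋃ s, ξ ⁻¹' {s} ∩ (fun ω l => X l ω) ⁻¹' B s := fun ω hω =>
    Set.mem_iUnion.2 ⟨ξ ω, rfl, hω⟩
  have hone : ∑' s, μ (ξ ⁻¹' {s}) = 1 := by
    rw [← measure_iUnion]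
    · rw [← Set.preimage_iUnion, Set.iUnion_of_singleton, Set.preimage_univ, measure_univ]
    · intro s t hst
      exact Disjoint.preimage _ (Set.disjoint_singleton.2 hst)
    · exact fun s => h.measurable_seed (measurableSet_singleton s)
  refine ENNReal.toReal_le_of_le_ofReal hε ?_
  -- The event is split by the value of the seed; by independence the bound for a fixed rule applies
  -- to each piece.
  calc _ ≤ ∑' s, μ (ξ ⁻¹' {s} ∩ (fun ω l => X l ω) ⁻¹' B s) :=
        (measure_mono hsub).trans (measure_iUnion_le _)
    _ ≤ ∑' s, μ (ξ ⁻¹' {s}) * ENNReal.ofReal ε := by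
        refine ENNReal.tsum_le_tsum fun s => ?_
        rw [h.indepFun_seed.measure_inter_preimage_eq_mul _ _ (measurableSet_singleton s)
          (Set.toFinite _).measurableSet]
        gcongr
        refine ENNReal.le_ofReal_iff_toReal_le (measure_ne_top _ _) hε |>.2 ?_
        exact (h.measureReal_eq_iidMean _).le.trans (hB s)
    _ = ENNReal.ofReal ε := by rw [ENNReal.tsum_mul_right, hone, one_mul]

theorem recovery (h : IsSampling M μ X ξ) [Countable S] [MeasurableSingletonClass S] (hd : 4 ≤ d)
    (hβ : 1 / 2 ≤ β) (hβ' : β < 1) (ρ : S → ChoiceRule d β) (h2 : M.A2)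
    (h4 : M.A4 ∨ M.QuartetwiseA4) (hm : 0 < m)
    (hlarge : 16 * (n : ℝ) ^ 2 ≤ m * M.alphaMin ^ 2) :
    1 - 6 * ((1 + 2 * searchRate β) * (d * Real.log d)) *
        Real.exp (-(1 / 32) * m * M.alphaMin ^ 2) ≤
      μ.real {ω | SameTopology (BuildTree.output hd (ρ (ξ ω)) fun l => X l ω) M.tree} := by
  classical
  have hfail : ∀ s, iidMean M.obs ({x : Fin m → Fin d → Fin n |
      ¬SameTopology (BuildTree.output hd (ρ s) x) M.tree}.indicator 1) ≤ _ := fun s =>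
    le_trans (le_of_eq (by
      congr 1
      funext x
      by_cases hx : SameTopology (BuildTree.output hd (ρ s) x) M.tree <;> simp [hx]))
    (iidMean_failure_le hd hβ hβ' (ρ s) (h.sum_obs hm) h2 h4 hm hlarge)
  have hbad := h.measureReal_le _ (by
    have := searchRate_pos hβ hβ'
    have := Real.log_natCast_nonneg d
    positivity) hfail
  have hcover : μ.real Set.univ ≤
      μ.real {ω | SameTopology (BuildTree.output hd (ρ (ξ ω)) fun l => X l ω) M.tree} +
      μ.real {ω | (fun l => X l ω) ∈ {x : Fin m → Fin d → Fin n |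
        ¬SameTopology (BuildTree.output hd (ρ (ξ ω)) x) M.tree}} := by
    refine le_trans (measureReal_mono fun ω _ => ?_) (measureReal_union_le _ _)
    exact em _
  rw [probReal_univ] at hcover
  linarith

end IsSampling

theorem one_le_mul_log (hd : 4 ≤ d) : 1 ≤ (d : ℝ) * Real.log d := by
  have h1 : (4 : ℝ) ≤ d := by exact_mod_cast hd
  have h2 : 1 ≤ Real.log d := by
    rw [Real.le_log_iff_exp_le (by linarith)]
    linarith [Real.exp_one_lt_three]
  nlinarith

end

theorem mainTheorem4 (β : ℝ) (hβ : 1 / 2 ≤ β) (hβ' : β < 1) :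
    (∃ c C : ℝ, 0 < c ∧ 0 < C ∧
      ∀ (d n k m : ℕ) (hd : 4 ≤ d) (H : Type*) [Fintype H] (M : LatentTreeModel d n k H),
        M.A1 → M.A2 → M.A3 → M.A4 ∨ M.QuartetwiseA4 →
        C * (n : ℝ) ^ 2 ≤ (m : ℝ) * M.alphaMin ^ 2 →
        ∀ (Ω S : Type*) [MeasurableSpace Ω] [MeasurableSpace S] [Countable S]
          [MeasurableSingletonClass S] (μ : MeasureTheory.Measure Ω)
          [MeasureTheory.IsProbabilityMeasure μ] (X : Fin m → Ω → Fin d → Fin n) (ξ : Ω → S)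
          (ρ : S → ChoiceRule d β), IsSampling M μ X ξ →
          1 - 8 * c * (d * Real.log d) * Real.exp (-(1 / 32) * m * M.alphaMin ^ 2) ≤
            μ.real {ω | SameTopology
              (BuildTree.output hd (ρ (ξ ω)) fun l => X l ω) M.tree}) ∧
    ∀ n : ℕ, ∃ c : ℝ, 0 < c ∧
      ∀ (d k m : ℕ) (hd : 4 ≤ d) (H : Type*) [Fintype H] (M : LatentTreeModel d n k H),
        M.A1 → M.A2 → M.A3 → M.A4 ∨ M.QuartetwiseA4 →
        ∀ (Ω S : Type*) [MeasurableSpace Ω] [MeasurableSpace S] [Countable S]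
          [MeasurableSingletonClass S] (μ : MeasureTheory.Measure Ω)
          [MeasureTheory.IsProbabilityMeasure μ] (X : Fin m → Ω → Fin d → Fin n) (ξ : Ω → S)
          (ρ : S → ChoiceRule d β), IsSampling M μ X ξ →
          1 - 8 * c * (d * Real.log d) * Real.exp (-(1 / 32) * m * M.alphaMin ^ 2) ≤
            μ.real {ω | SameTopology
              (BuildTree.output hd (ρ (ξ ω)) fun l => X l ω) M.tree} := by

  have hr := searchRate_pos hβ hβ'
  have hexp : ∀ n : ℕ, 1 ≤ Real.exp ((n : ℝ) ^ 2 / 2) := fun n => Real.one_le_exp (by positivity)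
  have large : ∀ c : ℝ, 1 + 2 * searchRate β ≤ c → ∀ (d : ℕ), 4 ≤ d → ∀ x : ℝ,
      6 * ((1 + 2 * searchRate β) * (d * Real.log d)) * Real.exp x ≤
        8 * c * (d * Real.log d) * Real.exp x := by
    intro c hc d hd x
    have h1 := one_le_mul_log hd
    have h2 : 6 * ((1 + 2 * searchRate β) * (d * Real.log d)) ≤ 8 * c * (d * Real.log d) := by
      rw [← mul_assoc]
      exact mul_le_mul_of_nonneg_right (by linarith) (by linarith)
    exact mul_le_mul_of_nonneg_right h2 (Real.exp_nonneg x)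
  have small : ∀ c : ℝ, 0 ≤ c → ∀ (d : ℕ), 4 ≤ d → ∀ x : ℝ, 1 ≤ c * Real.exp x →
      1 - 8 * c * (d * Real.log d) * Real.exp x ≤ 0 := by
    intro c hc d hd x hx
    have := mul_le_mul hx (one_le_mul_log hd) zero_le_one (by linarith)
    linarith
  -- The factor `exp (n² / 2)` is the inverse of `exp (-m α² / 32)` at the threshold `m α² = 16 n²`.
  refine ⟨⟨1 + 2 * searchRate β, 16, by positivity, by norm_num, ?_⟩, fun n =>
    ⟨(1 + 2 * searchRate β) * Real.exp ((n : ℝ) ^ 2 / 2), by positivity, ?_⟩⟩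
  · intro d n k m hd H _ M _ h2 _ h4 hlarge Ω S _ _ _ _ μ _ X ξ ρ h
    rcases m.eq_zero_or_pos with rfl | hm
    · refine (small _ (by positivity) d hd _ ?_).trans MeasureTheory.measureReal_nonneg
      simp only [Nat.cast_zero, mul_zero, zero_mul, Real.exp_zero]
      linarith
    · exact (sub_le_sub_left (large _ le_rfl d hd _) _).trans
        (h.recovery hd hβ hβ' ρ h2 h4 hm hlarge)
  · intro d k m hd H _ M _ h2 _ h4 Ω S _ _ _ _ μ _ X ξ ρ h
    by_cases hlarge : 0 < m ∧ 16 * (n : ℝ) ^ 2 ≤ m * M.alphaMin ^ 2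
    · refine (sub_le_sub_left (large _ ?_ d hd _) _).trans
        (h.recovery hd hβ hβ' ρ h2 h4 hlarge.1 hlarge.2)
      exact le_mul_of_one_le_right (by positivity) (hexp n)
    -- Below the threshold, or without samples, the constant outweighs the exponential and the
    -- claimed lower bound is not positive.
    · refine (small _ (by positivity) d hd _ ?_).trans MeasureTheory.measureReal_nonneg
      rw [mul_assoc, ← Real.exp_add]
      refine one_le_mul_of_one_le_of_one_le (by linarith) (Real.one_le_exp ?_)
      rcases m.eq_zero_or_pos with rfl | hm
      · simp only [Nat.cast_zero, mul_zero, zero_mul, add_zero]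
        positivity
      · have := not_le.1 fun h => hlarge ⟨hm, h⟩
        linarith
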